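/- Let $b,c\in\mathbb R$ with $c\neq 0$ and $2b+c\neq 0$, fix a sign $\pm$, and consider on $\mathbb R^3$, with coordinates $x,y,z$ and $\partial_{ij}=\partial_i\wedge\partial_j$, $\partial_{123}=\partial_1\wedge\partial_2\wedge\partial_3$, the quadratic Poisson tensor $$\Lambda_8=\Lambda_{8,I}\pm z^2\partial_{12},\qquad \Lambda_{8,I}=b(x^2+y^2)\partial_{12}+(2b+c)(xz\,\partial_{23}+yz\,\partial_{31}).$$ Let $H^k(\Lambda)$ be its formal Poisson cohomology, i.e. the degree-$k$ cohomology of $[\Lambda,\cdot]$ (Schouten bracket) on polyvector fields with coefficients in $\mathbb R[[x,y,z]]$. Put $D'=x^2+y^2$, $Y_1=x\partial_1+y\partial_2$, $Y_2=x\partial_2-y\partial_1$, $Y_3=z\partial_3$, $Y_{ij}=Y_i\wedge Y_j$, $Y_{123}=Y_1\wedge Y_2\wedge Y_3$, and $0\in\mathbb N$. Below, "$H^k=\bigoplus_i\mathbb R\,r_i$" means: every formal series $\sum_i c_ir_i$ with $c_i\in\mathbb R$ (each coefficient of which is a finite sum) is a $k$-cocycle, and every class of $H^k$ contains exactly one such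 series; $\operatorname{Cas}(\cdot)$ denotes the algebra of formal Casimir functions, i.e. $H^0$, and direct sums in it are formal in the same sense. 1. Suppose $b/c\in\mathbb Q$ and $b(2b+c)>0$. Write $b/c=\beta/\gamma$ with $\beta,\gamma$ coprime integers, $\beta>0$, and let $I=\{i\in\mathbb N:\gamma i\in 2\mathbb Z\}$. Then $$\operatorname{Cas}(\Lambda_{8,I})=\bigoplus_{i\in I}\mathbb R\,D'^{(\beta+\frac{\gamma}{2})i}z^{\beta i},\qquad H^0(\Lambda_8)=\operatorname{Cas}(\Lambda_8)=\bigoplus_{i\in I}\mathbb R\Big(D'\pm\frac{z^2}{3b+c}\Big)^{(\beta+\frac{\gamma}{2})i}z^{\beta i},$$ $$H^1(\Lambda_8)=\operatorname{Cas}(\Lambda_{8,I})Y_2\oplus\operatorname{Cas}(\Lambda_8)(Y_1+Y_3),$$ $$H^2(\Lambda_8)=\operatorname{Cas}(\Lambda_{8,I})Y_{12}\oplus\operatorname{Cas}(\Lambda_{8,I})Y_{23}\oplus\bigoplus_{k\in\mathbb N\setminus(I(3\beta+\gamma)+2)}\mathbb R\,z^k\partial_{12},$$ $$H^3(\Lambda_8)=\operatorname{Cas}(\Lambda_{8,I})Y_{123}\oplus\bigoplus_{k\in\mathbb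 N\setminus(I(3\beta+\gamma)+3)}\mathbb R\,z^k\partial_{123},$$ where $I(3\beta+\gamma)+m=\{(3\beta+\gamma)i+m:i\in I\}$. 2. Suppose $b/c\notin\mathbb Q$, or $b/c\in\mathbb Q$ and $b(2b+c)<0$. Then $$H^0(\Lambda_8)=\operatorname{Cas}(\Lambda_8)=\mathbb R,\qquad H^1(\Lambda_8)=\mathbb R\,Y_2\oplus\mathbb R\,(Y_1+Y_3).$$ If $b/c=-1/\gamma$ for some $\gamma\in\{4,6,8,\dots\}$, then with $\mathcal A_\gamma=D'^{\frac{\gamma}{2}-1}z^{-1}$ (so that $\mathcal A_\gamma Y_{23}=D'^{\frac\gamma2-1}\,Y_2\wedge\partial_3$ and $\mathcal A_\gamma Y_{123}=D'^{\frac\gamma2-1}\,Y_1\wedge Y_2\wedge\partial_3$) $$H^2(\Lambda_8)=\mathbb R\,Y_{12}\oplus\mathbb R\,Y_{23}\oplus\bigoplus_{k\in\mathbb N\setminus\{2,\gamma-1\}}\mathbb R\,z^k\partial_{12}\oplus\mathbb R\,\mathcal A_\gamma Y_{23},$$ $$H^3(\Lambda_8)=\mathbb R\,Y_{123}\oplus\bigoplus_{k\in\mathbb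 N\setminus\{3,\gamma\}}\mathbb R\,z^k\partial_{123}\oplus\mathbb R\,\mathcal A_\gamma Y_{123};$$ otherwise $$H^2(\Lambda_8)=\mathbb R\,Y_{12}\oplus\mathbb R\,Y_{23}\oplus\bigoplus_{k\in\mathbb N\setminus\{2\}}\mathbb R\,z^k\partial_{12},\qquad H^3(\Lambda_8)=\mathbb R\,Y_{123}\oplus\bigoplus_{k\in\mathbb N\setminus\{3\}}\mathbb R\,z^k\partial_{123}.$$ 3. Suppose $b=0$. Then $$\operatorname{Cas}(\Lambda_{8,I})=\bigoplus_{i\in\mathbb N}\mathbb R\,D'^i,\qquad H^0(\Lambda_8)=\operatorname{Cas}(\Lambda_8)=\bigoplus_{i\in\mathbb N}\mathbb R\Big(D'\pm\frac{z^2}{c}\Big)^i,$$ $$H^1(\Lambda_8)=\operatorname{Cas}(\Lambda_{8,I})Y_2\oplus\operatorname{Cas}(\Lambda_8)(Y_1+Y_3),$$ $$H^2(\Lambda_8)=\operatorname{Cas}(\Lambda_{8,I})Y_{12}\oplus\operatorname{Cas}(\Lambda_{8,I})Y_{23}\oplus\bigoplus_{k\in\mathbb N\setminus(2\mathbb N+2)}\mathbb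 R\,z^k\partial_{12},$$ $$H^3(\Lambda_8)=\operatorname{Cas}(\Lambda_{8,I})Y_{123}\oplus\bigoplus_{k\in\mathbb N\setminus(2\mathbb N+3)}\mathbb R\,z^k\partial_{123}.$$ -/

import Mathlib

noncomputable section

namespace FormalPoisson

open MvPowerSeries

/-- Real formal power series in the three variables `x = X 0`, `y = X 1`, `z = X 2`. -/
abbrev Series : Type := MvPowerSeries (Fin 3) ℝ

/-- Polyvector fields on `ℝ³` with formal power series coefficients. The value `P S` at
`S = {i₁ < ⋯ < iₖ}` is the coefficient of `∂_{i₁} ∧ ⋯ ∧ ∂_{iₖ}`; the value at `∅` is the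
function part. -/
abbrev PolyVec : Type := Finset (Fin 3) → Series

/-- The polyvector fields of degree `k` (the `k`-cochains). -/
def ofDegree (k : ℕ) : Submodule ℝ PolyVec where
  carrier := {P | ∀ S, S.card ≠ k → P S = 0}
  zero_mem' := fun _ _ => rfl
  add_mem' := fun {P Q} hP hQ S hS => by
    rw [Pi.add_apply, hP S hS, hQ S hS, add_zero]
  smul_mem' := fun a P hP S hS => by
    rw [Pi.smul_apply, hP S hS, smul_zero]

/-- The sign of the shuffle that sorts `∂_T ∧ ∂_U` for disjoint `T` and `U`. -/
def shuffleSign (T U : Finset (Fin 3)) : ℝ :=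
  (-1) ^ ((T ×ˢ U).filter fun p => p.2 < p.1).card

/-- The exterior product of polyvector fields. -/
def wedge (P Q : PolyVec) : PolyVec := fun S =>
  ∑ T ∈ S.powerset, shuffleSign T (S \ T) • (P T * Q (S \ T))

/-- The polyvector field acted on coefficientwise by `∂/∂x_i`. -/
def coeffDeriv (i : Fin 3) (P : PolyVec) : PolyVec := fun S => pderiv ℝ i (P S)

/-- The left derivative with respect to the odd variable `∂_i`: the linear map with
`∂_i ∧ R ↦ R` and `R ↦ 0` for `R` free of `∂_i`. -/
def leftContract (i : Fin 3) (P : PolyVec) : PolyVec := fun S =>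
  if i ∈ S then 0 else shuffleSign {i} S • P (insert i S)

/-- The right derivative with respect to the odd variable `∂_i`: the linear map with
`R ∧ ∂_i ↦ R` and `R ↦ 0` for `R` free of `∂_i`. -/
def rightContract (i : Fin 3) (P : PolyVec) : PolyVec := fun S =>
  if i ∈ S then 0 else shuffleSign S {i} • P (insert i S)

/-- The Schouten bracket of polyvector fields, in coordinates. It is normalized by
`[V, f] = V(f)` and `[V, W]` = the Lie bracket, for vector fields `V`, `W` and functions `f`. -/
def schouten (P Q : PolyVec) : PolyVec :=
  ∑ i : Fin 3, (wedge (rightContract i P) (coeffDeriv i Q)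
    - wedge (coeffDeriv i P) (leftContract i Q))

lemma wedge_add (P Q R : PolyVec) : wedge P (Q + R) = wedge P Q + wedge P R := by
  funext S
  simp only [wedge, Pi.add_apply, mul_add, smul_add, Finset.sum_add_distrib]

lemma wedge_smul (a : ℝ) (P Q : PolyVec) : wedge P (a • Q) = a • wedge P Q := by
  funext S
  simp only [wedge, Pi.smul_apply, mul_smul_comm, Finset.smul_sum]
  exact Finset.sum_congr rfl fun T _ => smul_comm _ _ _

lemma coeffDeriv_add (i : Fin 3) (P Q : PolyVec) :
    coeffDeriv i (P + Q) = coeffDeriv i P + coeffDeriv i Q := by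
  funext S
  exact map_add (pderiv ℝ i) (P S) (Q S)

lemma coeffDeriv_smul (i : Fin 3) (a : ℝ) (P : PolyVec) :
    coeffDeriv i (a • P) = a • coeffDeriv i P := by
  funext S
  exact (pderiv ℝ i).map_smul a (P S)

lemma leftContract_add (i : Fin 3) (P Q : PolyVec) :
    leftContract i (P + Q) = leftContract i P + leftContract i Q := by
  funext S
  by_cases h : i ∈ S <;> simp [leftContract, h]

lemma leftContract_smul (i : Fin 3) (a : ℝ) (P : PolyVec) :
    leftContract i (a • P) = a • leftContract i P := by
  funext S
  by_cases h : i ∈ S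
  · simp [leftContract, h]
  · simp only [leftContract, h, if_false, Pi.smul_apply]
    exact smul_comm _ _ _

/-- The Lichnerowicz–Poisson coboundary operator `[Λ, ·]`. -/
def coboundaryMap (Λ : PolyVec) : PolyVec →ₗ[ℝ] PolyVec where
  toFun := schouten Λ
  map_add' P Q := by
    simp only [schouten, coeffDeriv_add, leftContract_add, wedge_add, ← Finset.sum_add_distrib]
    exact Finset.sum_congr rfl fun i _ => by abel
  map_smul' a P := by
    simp only [schouten, coeffDeriv_smul, leftContract_smul, wedge_smul, RingHom.id_apply,
      Finset.smul_sum, smul_sub]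

/-- The `k`-cocycles of `[Λ, ·]`. -/
def cocycles (Λ : PolyVec) (k : ℕ) : Submodule ℝ PolyVec :=
  ofDegree k ⊓ LinearMap.ker (coboundaryMap Λ)

/-- The `k`-coboundaries of `[Λ, ·]`. -/
def coboundaries (Λ : PolyVec) : ℕ → Submodule ℝ PolyVec
  | 0 => ⊥
  | k + 1 => (ofDegree k).map (coboundaryMap Λ)

/-- The `k`-th formal Poisson cohomology space of `Λ`: `k`-cocycles modulo `k`-coboundaries. -/
abbrev Cohomology (Λ : PolyVec) (k : ℕ) : Type :=
  cocycles Λ k ⧸ (coboundaries Λ k).submoduleOf (cocycles Λ k)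

/-- The formal (coefficientwise) sum `∑ᵢ cᵢ rᵢ` of a family of polyvector fields. -/
def formalSum {ι : Type} (c : ι → ℝ) (r : ι → PolyVec) : PolyVec := fun S =>
  fun e => ∑ᶠ i, c i * coeff e (r i S)

/-- The `k`-th cohomology space of `Λ` is the formal direct sum `⊕ᵢ ℝ rᵢ`: every coefficient
occurs in finitely many of the `rᵢ` only, all formal series `∑ᵢ cᵢ rᵢ` are `k`-cocycles, and each
cohomology class contains exactly one of them. -/
structure IsFormalBasis (Λ : PolyVec) (k : ℕ) {ι : Type} (r : ι → PolyVec) : Prop where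
  locallyFinite : ∀ S e, {i | coeff e (r i S) ≠ 0}.Finite
  isCocycle : ∀ c : ι → ℝ, formalSum c r ∈ cocycles Λ k
  bijective : Function.Bijective fun c : ι → ℝ =>
    (Submodule.Quotient.mk ⟨formalSum c r, isCocycle c⟩ : Cohomology Λ k)

/-- A formal function, as a polyvector field of degree `0`. -/
def ofFun (f : Series) : PolyVec := Pi.single ∅ f

/-- The product of a function and a polyvector field. -/
def mulFun (f : Series) (P : PolyVec) : PolyVec := fun S => f * P S

/-- The coordinate vector field `∂_{i+1}` (`∂ 0 = ∂₁`, `∂ 1 = ∂₂`, `∂ 2 = ∂₃`). -/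
def del (i : Fin 3) : PolyVec := Pi.single {i} 1

def x : Series := X 0
def y : Series := X 1
def z : Series := X 2

/-- `D' = x² + y²` -/
def D' : Series := x ^ 2 + y ^ 2

def del12 : PolyVec := wedge (del 0) (del 1)
def del23 : PolyVec := wedge (del 1) (del 2)
def del31 : PolyVec := wedge (del 2) (del 0)
def del123 : PolyVec := wedge (wedge (del 0) (del 1)) (del 2)

/-- `Y₁ = x∂₁ + y∂₂` -/
def Y1 : PolyVec := mulFun x (del 0) + mulFun y (del 1)
/-- `Y₂ = x∂₂ - y∂₁` -/
def Y2 : PolyVec := mulFun x (del 1) - mulFun y (del 0)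
/-- `Y₃ = z∂₃` -/
def Y3 : PolyVec := mulFun z (del 2)
def Y12 : PolyVec := wedge Y1 Y2
def Y23 : PolyVec := wedge Y2 Y3
def Y123 : PolyVec := wedge (wedge Y1 Y2) Y3

/-- `Λ_{8,I} = b(x²+y²)∂₁₂ + (2b+c)(xz∂₂₃ + yz∂₃₁)` -/
def Lambda8I (b c : ℝ) : PolyVec :=
  b • mulFun D' del12 + (2 * b + c) • (mulFun (x * z) del23 + mulFun (y * z) del31)

/-- `Λ₈ = Λ_{8,I} + ε z²∂₁₂`, where `ε = ±1`. -/
def Lambda8 (b c ε : ℝ) : PolyVec :=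
  Lambda8I b c + ε • mulFun (z ^ 2) del12

/-- The exponents `i ∈ ℕ` with `γ i ∈ 2ℤ`. -/
abbrev Admissible (γ : ℤ) : Type := {i : ℕ // Even (γ * (i : ℤ))}

/-- The exponent `(β + γ/2) i`, a natural number when `γ i` is even and `2β + γ > 0`. -/
def casExp (β : ℕ) (γ : ℤ) (i : ℕ) : ℕ := ((2 * (β : ℤ) + γ) * (i : ℤ) / 2).toNat

/-- `D'^{(β+γ/2)i} z^{βi}` -/
def casI (β : ℕ) (γ : ℤ) (i : Admissible γ) : Series :=
  D' ^ casExp β γ i * z ^ (β * (i : ℕ))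

/-- `(D' + κ z²)^{(β+γ/2)i} z^{βi}` -/
def cas (κ : ℝ) (β : ℕ) (γ : ℤ) (i : Admissible γ) : Series :=
  (D' + κ • z ^ 2) ^ casExp β γ i * z ^ (β * (i : ℕ))

end FormalPoisson

end

open FormalPoisson

/-!
The proof reduces the cohomology of `Λ₈` to linear algebra with formal series in the two invariants
`s = x² + y²` and `z` of the rotation field `Y₂`.

**Reduction to rotation invariant cochains.** The modular vector field of `Λ₈` is `c Y₂`: with the
divergence operator `δ` of the volume form `dx ∧ dy ∧ dz` and `d = [Λ₈, ·]` one has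
`d δ + δ d = -c L`, where `L` is the Lie derivative along `Y₂` (`divergence_homotopy`). So `L`
commutes with `d` and acts by zero on cohomology. It preserves the finite-dimensional spaces of
polyvector fields with coefficients of fixed degrees in `(x, y)` and in `z`, and acts semisimply
(`rotLie_eq_zero_of_rotLie_rotLie`), so the space of cochains is the direct sum of the kernel and
the range of `L`. Hence every class has an invariant representative (`exists_invariant_cocycle`),
and an invariant coboundary has an invariant primitive (`exists_invariant_primitive`).

**The invariant complex.** Invariant cochains have coefficients in `ℝ[[s, z]]` with respect to `1`;
`Y₁, Y₂, ∂₃`; `∂₁₂, Y₂ ∧ ∂₃, Y₁ ∧ ∂₃`; `∂₁₂₃`. With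
`E = (2b + c) z ∂_z - 2 (b s + ε z²) ∂_s` and `T_μ f = s (E f - μ f) - 2 ε z² f` the differential is
* `d f = E f · Y₂`,
* `d (f Y₁ + g Y₂ + h ∂₃) = -(T₀ f + 2 ε z h) ∂₁₂ + (E h - (2b + c) h) Y₂ ∧ ∂₃`,
* `d (p ∂₁₂ + q Y₂ ∧ ∂₃ + r Y₁ ∧ ∂₃) = -T_{2b+c} r · ∂₁₂₃`.

**Resonances.** Give `s` degree two and `z` degree one. In each degree `E` is triangular on the
monomials, with the eigenvalue `w = (2b + c) q - 2 b p` at `s ^ p z ^ q`, and at most one monomial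
of each degree is resonant, that is, satisfies `w = μ`, for `μ = 0` and for `μ = 2b + c`
(`uniqueResonance_zero`, `uniqueResonance_zWeight`). So the resonant monomials are a basis of the
cokernel of `E - μ`, and an element of its kernel is determined by its resonant coefficients, which
are arbitrary. The operator `T_μ` maps `s ^ p z ^ q` to
`(w - μ) s ^ (p + 1) z ^ q - 2 ε (p + 1) s ^ p z ^ (q + 2)`. As `ε ≠ 0`, it is injective with a
one-dimensional cokernel in each degree `k`, spanned by `s ^ (p + 1) z ^ q` if `(p, q)` is resonant
and of degree `k - 2`, and by `z ^ k` if there is no such resonance (`exists_divOp_solution`,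
`eq_zero_of_divOp_eq`). This gives the third cohomology.

**Degrees one and two.** If `E h = (2b + c) h`, multiplication by `z` turns `-(T₀ f + 2 ε z h)` into
`T_{2b+c} (h - z f)` (`mulZ_vector_coboundary`). By the injectivity of `T_{2b+c}`, the invariant
`1`-cocycles are the `f (Y₁ + Y₃) + g Y₂` with `E f = 0`, and the second cohomology has the basis
consisting of the `m ∂₁₂`, where `z m` runs through the basis monomials of the cokernel of
`T_{2b+c}` that are divisible by `z`, and the `m (Y₂ ∧ ∂₃)`, where `m` runs through the resonant
monomials of `E - (2b + c)`.

**Casimir functions.** For `κ (3b + c) = ε` the function `s + κ z²` is an eigenvector of the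
derivation `E` with the eigenvalue `-2b` of `s`, so `(s + κ z²) ^ p z ^ q` is a Casimir function
with leading monomial `s ^ p z ^ q` for each resonance `(p, q)` of `E`. It remains to solve
`(2b + c) q = 2 b p`, and `(2b + c) q - 2 b p = 2b + c`, in natural numbers in each of the three
cases.
-/

set_option linter.unusedSimpArgs false

noncomputable section

namespace FormalPoisson

open MvPowerSeries

/-! ### Exterior products and contractions in coordinates -/

lemma shuffleSign_eq (T U : Finset (Fin 3)) (n : ℕ)
    (h : ((T ×ˢ U).filter fun p => p.2 < p.1).card = n) : shuffleSign T U = (-1) ^ n := by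
  rw [shuffleSign, h]

lemma wedge_apply_empty (P Q : PolyVec) : wedge P Q ∅ = P ∅ * Q ∅ := by
  simp [wedge, shuffleSign]

lemma wedge_apply_0 (P Q : PolyVec) : wedge P Q {0} =
    P ∅ * Q {0} + P {0} * Q ∅ := by
  rw [wedge, show ({0} : Finset (Fin 3)).powerset =
    {∅, {0}} by decide]
  repeat rw [Finset.sum_insert (by decide)]
  rw [Finset.sum_singleton]
  rw [shuffleSign_eq ∅ _ 0 (by decide), shuffleSign_eq {0} _ 0 (by decide)]
  simp only [show ({0} : Finset (Fin 3)) \ ∅ = {0} by decide,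
    show ({0} : Finset (Fin 3)) \ {0} = ∅ by decide,
    pow_zero, one_smul]

lemma wedge_apply_1 (P Q : PolyVec) : wedge P Q {1} =
    P ∅ * Q {1} + P {1} * Q ∅ := by
  rw [wedge, show ({1} : Finset (Fin 3)).powerset =
    {∅, {1}} by decide]
  repeat rw [Finset.sum_insert (by decide)]
  rw [Finset.sum_singleton]
  rw [shuffleSign_eq ∅ _ 0 (by decide), shuffleSign_eq {1} _ 0 (by decide)]
  simp only [show ({1} : Finset (Fin 3)) \ ∅ = {1} by decide,
    show ({1} : Finset (Fin 3)) \ {1} = ∅ by decide,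
    pow_zero, one_smul]

lemma wedge_apply_2 (P Q : PolyVec) : wedge P Q {2} =
    P ∅ * Q {2} + P {2} * Q ∅ := by
  rw [wedge, show ({2} : Finset (Fin 3)).powerset =
    {∅, {2}} by decide]
  repeat rw [Finset.sum_insert (by decide)]
  rw [Finset.sum_singleton]
  rw [shuffleSign_eq ∅ _ 0 (by decide), shuffleSign_eq {2} _ 0 (by decide)]
  simp only [show ({2} : Finset (Fin 3)) \ ∅ = {2} by decide,
    show ({2} : Finset (Fin 3)) \ {2} = ∅ by decide,
    pow_zero, one_smul]

lemma wedge_apply_01 (P Q : PolyVec) : wedge P Q {0, 1} =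
    P ∅ * Q {0, 1} + P {0} * Q {1} - P {1} * Q {0} + P {0, 1} * Q ∅ := by
  rw [wedge, show ({0, 1} : Finset (Fin 3)).powerset =
    {∅, {0}, {1}, {0, 1}} by decide]
  repeat rw [Finset.sum_insert (by decide)]
  rw [Finset.sum_singleton]
  rw [shuffleSign_eq ∅ _ 0 (by decide), shuffleSign_eq {0} _ 0 (by decide),
    shuffleSign_eq {1} _ 1 (by decide), shuffleSign_eq {0, 1} _ 0 (by decide)]
  simp only [show ({0, 1} : Finset (Fin 3)) \ ∅ = {0, 1} by decide,
    show ({0, 1} : Finset (Fin 3)) \ {0} = {1} by decide,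
    show ({0, 1} : Finset (Fin 3)) \ {1} = {0} by decide,
    show ({0, 1} : Finset (Fin 3)) \ {0, 1} = ∅ by decide,
    pow_zero, pow_one, one_smul, neg_smul]
  ring

lemma wedge_apply_02 (P Q : PolyVec) : wedge P Q {0, 2} =
    P ∅ * Q {0, 2} + P {0} * Q {2} - P {2} * Q {0} + P {0, 2} * Q ∅ := by
  rw [wedge, show ({0, 2} : Finset (Fin 3)).powerset =
    {∅, {0}, {2}, {0, 2}} by decide]
  repeat rw [Finset.sum_insert (by decide)]
  rw [Finset.sum_singleton]
  rw [shuffleSign_eq ∅ _ 0 (by decide), shuffleSign_eq {0} _ 0 (by decide),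
    shuffleSign_eq {2} _ 1 (by decide), shuffleSign_eq {0, 2} _ 0 (by decide)]
  simp only [show ({0, 2} : Finset (Fin 3)) \ ∅ = {0, 2} by decide,
    show ({0, 2} : Finset (Fin 3)) \ {0} = {2} by decide,
    show ({0, 2} : Finset (Fin 3)) \ {2} = {0} by decide,
    show ({0, 2} : Finset (Fin 3)) \ {0, 2} = ∅ by decide,
    pow_zero, pow_one, one_smul, neg_smul]
  ring

lemma wedge_apply_12 (P Q : PolyVec) : wedge P Q {1, 2} =
    P ∅ * Q {1, 2} + P {1} * Q {2} - P {2} * Q {1} + P {1, 2} * Q ∅ := by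
  rw [wedge, show ({1, 2} : Finset (Fin 3)).powerset =
    {∅, {1}, {2}, {1, 2}} by decide]
  repeat rw [Finset.sum_insert (by decide)]
  rw [Finset.sum_singleton]
  rw [shuffleSign_eq ∅ _ 0 (by decide), shuffleSign_eq {1} _ 0 (by decide),
    shuffleSign_eq {2} _ 1 (by decide), shuffleSign_eq {1, 2} _ 0 (by decide)]
  simp only [show ({1, 2} : Finset (Fin 3)) \ ∅ = {1, 2} by decide,
    show ({1, 2} : Finset (Fin 3)) \ {1} = {2} by decide,
    show ({1, 2} : Finset (Fin 3)) \ {2} = {1} by decide,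
    show ({1, 2} : Finset (Fin 3)) \ {1, 2} = ∅ by decide,
    pow_zero, pow_one, one_smul, neg_smul]
  ring

lemma wedge_apply_012 (P Q : PolyVec) : wedge P Q {0, 1, 2} =
    P ∅ * Q {0, 1, 2} + P {0} * Q {1, 2} - P {1} * Q {0, 2} + P {2} * Q {0, 1}
      + P {0, 1} * Q {2} - P {0, 2} * Q {1} + P {1, 2} * Q {0} + P {0, 1, 2} * Q ∅ := by
  rw [wedge, show ({0, 1, 2} : Finset (Fin 3)).powerset =
    {∅, {0}, {1}, {2}, {0, 1}, {0, 2}, {1, 2}, {0, 1, 2}} by decide]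
  repeat rw [Finset.sum_insert (by decide)]
  rw [Finset.sum_singleton]
  rw [shuffleSign_eq ∅ _ 0 (by decide), shuffleSign_eq {0} _ 0 (by decide),
    shuffleSign_eq {1} _ 1 (by decide), shuffleSign_eq {2} _ 2 (by decide),
    shuffleSign_eq {0, 1} _ 0 (by decide), shuffleSign_eq {0, 2} _ 1 (by decide),
    shuffleSign_eq {1, 2} _ 2 (by decide), shuffleSign_eq {0, 1, 2} _ 0 (by decide)]
  simp only [show ({0, 1, 2} : Finset (Fin 3)) \ ∅ = {0, 1, 2} by decide,
    show ({0, 1, 2} : Finset (Fin 3)) \ {0} = {1, 2} by decide,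
    show ({0, 1, 2} : Finset (Fin 3)) \ {1} = {0, 2} by decide,
    show ({0, 1, 2} : Finset (Fin 3)) \ {2} = {0, 1} by decide,
    show ({0, 1, 2} : Finset (Fin 3)) \ {0, 1} = {2} by decide,
    show ({0, 1, 2} : Finset (Fin 3)) \ {0, 2} = {1} by decide,
    show ({0, 1, 2} : Finset (Fin 3)) \ {1, 2} = {0} by decide,
    show ({0, 1, 2} : Finset (Fin 3)) \ {0, 1, 2} = ∅ by decide,
    pow_zero, pow_one, neg_one_sq, one_smul, neg_smul]
  ring

lemma leftContract_apply (P : PolyVec) :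
    leftContract 0 P ∅ = P {0} ∧
    leftContract 0 P {1} = P {0, 1} ∧
    leftContract 0 P {2} = P {0, 2} ∧
    leftContract 0 P {1, 2} = P {0, 1, 2} ∧
    leftContract 1 P ∅ = P {1} ∧
    leftContract 1 P {0} = -P {0, 1} ∧
    leftContract 1 P {2} = P {1, 2} ∧
    leftContract 1 P {0, 2} = -P {0, 1, 2} ∧
    leftContract 2 P ∅ = P {2} ∧
    leftContract 2 P {0} = -P {0, 2} ∧
    leftContract 2 P {1} = -P {1, 2} ∧
    leftContract 2 P {0, 1} = P {0, 1, 2} := by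
  refine ⟨?_, ?_, ?_, ?_, ?_, ?_, ?_, ?_, ?_, ?_, ?_, ?_⟩
  · rw [leftContract, if_neg (by decide), shuffleSign_eq {0} ∅ 0 (by decide),
      show insert 0 ∅ = ({0} : Finset (Fin 3)) by decide]; simp
  · rw [leftContract, if_neg (by decide), shuffleSign_eq {0} {1} 0 (by decide),
      show insert 0 {1} = ({0, 1} : Finset (Fin 3)) by decide]; simp
  · rw [leftContract, if_neg (by decide), shuffleSign_eq {0} {2} 0 (by decide),
      show insert 0 {2} = ({0, 2} : Finset (Fin 3)) by decide]; simp
  · rw [leftContract, if_neg (by decide), shuffleSign_eq {0} {1, 2} 0 (by decide),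
      show insert 0 {1, 2} = ({0, 1, 2} : Finset (Fin 3)) by decide]; simp
  · rw [leftContract, if_neg (by decide), shuffleSign_eq {1} ∅ 0 (by decide),
      show insert 1 ∅ = ({1} : Finset (Fin 3)) by decide]; simp
  · rw [leftContract, if_neg (by decide), shuffleSign_eq {1} {0} 1 (by decide),
      show insert 1 {0} = ({0, 1} : Finset (Fin 3)) by decide]; simp
  · rw [leftContract, if_neg (by decide), shuffleSign_eq {1} {2} 0 (by decide),
      show insert 1 {2} = ({1, 2} : Finset (Fin 3)) by decide]; simp
  · rw [leftContract, if_neg (by decide), shuffleSign_eq {1} {0, 2} 1 (by decide),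
      show insert 1 {0, 2} = ({0, 1, 2} : Finset (Fin 3)) by decide]; simp
  · rw [leftContract, if_neg (by decide), shuffleSign_eq {2} ∅ 0 (by decide),
      show insert 2 ∅ = ({2} : Finset (Fin 3)) by decide]; simp
  · rw [leftContract, if_neg (by decide), shuffleSign_eq {2} {0} 1 (by decide),
      show insert 2 {0} = ({0, 2} : Finset (Fin 3)) by decide]; simp
  · rw [leftContract, if_neg (by decide), shuffleSign_eq {2} {1} 1 (by decide),
      show insert 2 {1} = ({1, 2} : Finset (Fin 3)) by decide]; simp
  · rw [leftContract, if_neg (by decide), shuffleSign_eq {2} {0, 1} 2 (by decide),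
      show insert 2 {0, 1} = ({0, 1, 2} : Finset (Fin 3)) by decide]; simp

lemma leftContract_of_mem {i : Fin 3} {S : Finset (Fin 3)} (h : i ∈ S) (P : PolyVec) :
    leftContract i P S = 0 := if_pos h

lemma rightContract_apply (P : PolyVec) :
    rightContract 0 P ∅ = P {0} ∧
    rightContract 0 P {1} = -P {0, 1} ∧
    rightContract 0 P {2} = -P {0, 2} ∧
    rightContract 0 P {1, 2} = P {0, 1, 2} ∧
    rightContract 1 P ∅ = P {1} ∧
    rightContract 1 P {0} = P {0, 1} ∧
    rightContract 1 P {2} = -P {1, 2} ∧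
    rightContract 1 P {0, 2} = -P {0, 1, 2} ∧
    rightContract 2 P ∅ = P {2} ∧
    rightContract 2 P {0} = P {0, 2} ∧
    rightContract 2 P {1} = P {1, 2} ∧
    rightContract 2 P {0, 1} = P {0, 1, 2} := by
  refine ⟨?_, ?_, ?_, ?_, ?_, ?_, ?_, ?_, ?_, ?_, ?_, ?_⟩
  · rw [rightContract, if_neg (by decide), shuffleSign_eq ∅ {0} 0 (by decide),
      show insert 0 ∅ = ({0} : Finset (Fin 3)) by decide]; simp
  · rw [rightContract, if_neg (by decide), shuffleSign_eq {1} {0} 1 (by decide),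
      show insert 0 {1} = ({0, 1} : Finset (Fin 3)) by decide]; simp
  · rw [rightContract, if_neg (by decide), shuffleSign_eq {2} {0} 1 (by decide),
      show insert 0 {2} = ({0, 2} : Finset (Fin 3)) by decide]; simp
  · rw [rightContract, if_neg (by decide), shuffleSign_eq {1, 2} {0} 2 (by decide),
      show insert 0 {1, 2} = ({0, 1, 2} : Finset (Fin 3)) by decide]; simp
  · rw [rightContract, if_neg (by decide), shuffleSign_eq ∅ {1} 0 (by decide),
      show insert 1 ∅ = ({1} : Finset (Fin 3)) by decide]; simp
  · rw [rightContract, if_neg (by decide), shuffleSign_eq {0} {1} 0 (by decide),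
      show insert 1 {0} = ({0, 1} : Finset (Fin 3)) by decide]; simp
  · rw [rightContract, if_neg (by decide), shuffleSign_eq {2} {1} 1 (by decide),
      show insert 1 {2} = ({1, 2} : Finset (Fin 3)) by decide]; simp
  · rw [rightContract, if_neg (by decide), shuffleSign_eq {0, 2} {1} 1 (by decide),
      show insert 1 {0, 2} = ({0, 1, 2} : Finset (Fin 3)) by decide]; simp
  · rw [rightContract, if_neg (by decide), shuffleSign_eq ∅ {2} 0 (by decide),
      show insert 2 ∅ = ({2} : Finset (Fin 3)) by decide]; simp
  · rw [rightContract, if_neg (by decide), shuffleSign_eq {0} {2} 0 (by decide),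
      show insert 2 {0} = ({0, 2} : Finset (Fin 3)) by decide]; simp
  · rw [rightContract, if_neg (by decide), shuffleSign_eq {1} {2} 0 (by decide),
      show insert 2 {1} = ({1, 2} : Finset (Fin 3)) by decide]; simp
  · rw [rightContract, if_neg (by decide), shuffleSign_eq {0, 1} {2} 0 (by decide),
      show insert 2 {0, 1} = ({0, 1, 2} : Finset (Fin 3)) by decide]; simp

lemma rightContract_of_mem {i : Fin 3} {S : Finset (Fin 3)} (h : i ∈ S) (P : PolyVec) :
    rightContract i P S = 0 := if_pos h

/-! ### The Schouten bracket with a bivector field -/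

lemma bivector_apply {A : PolyVec} (hA : A ∈ ofDegree 2) :
    A ∅ = 0 ∧ A {0} = 0 ∧ A {1} = 0 ∧ A {2} = 0 ∧ A {0, 1, 2} = 0 :=
  ⟨hA _ (by decide), hA _ (by decide), hA _ (by decide), hA _ (by decide), hA _ (by decide)⟩

lemma schouten_apply_empty {A : PolyVec} (hA : A ∈ ofDegree 2) (P : PolyVec) :
    schouten A P ∅ = 0 := by
  simp [schouten, Fin.sum_univ_three, wedge_apply_empty, leftContract_apply, rightContract_apply,
    coeffDeriv, leftContract_of_mem, rightContract_of_mem, bivector_apply hA]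

lemma schouten_apply_0 {A : PolyVec} (hA : A ∈ ofDegree 2) (P : PolyVec) :
    schouten A P {0} = A {0, 1} * pderiv ℝ 1 (P ∅) + A {0, 2} * pderiv ℝ 2 (P ∅) := by
  simp [schouten, Fin.sum_univ_three, wedge_apply_0, leftContract_apply, rightContract_apply,
    coeffDeriv, leftContract_of_mem, rightContract_of_mem, bivector_apply hA]

lemma schouten_apply_1 {A : PolyVec} (hA : A ∈ ofDegree 2) (P : PolyVec) :
    schouten A P {1} = A {1, 2} * pderiv ℝ 2 (P ∅) - A {0, 1} * pderiv ℝ 0 (P ∅) := by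
  simp [schouten, Fin.sum_univ_three, wedge_apply_1, leftContract_apply, rightContract_apply,
    coeffDeriv, leftContract_of_mem, rightContract_of_mem, bivector_apply hA]
  ring

lemma schouten_apply_2 {A : PolyVec} (hA : A ∈ ofDegree 2) (P : PolyVec) :
    schouten A P {2} = -(A {0, 2} * pderiv ℝ 0 (P ∅)) - A {1, 2} * pderiv ℝ 1 (P ∅) := by
  simp [schouten, Fin.sum_univ_three, wedge_apply_2, leftContract_apply, rightContract_apply,
    coeffDeriv, leftContract_of_mem, rightContract_of_mem, bivector_apply hA]
  ring

lemma schouten_apply_01 {A : PolyVec} (hA : A ∈ ofDegree 2) (P : PolyVec) :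
    schouten A P {0, 1} = A {0, 1} * (pderiv ℝ 0 (P {0}) + pderiv ℝ 1 (P {1}))
      + A {0, 2} * pderiv ℝ 2 (P {1}) - A {1, 2} * pderiv ℝ 2 (P {0})
      - (P {0} * pderiv ℝ 0 (A {0, 1}) + P {1} * pderiv ℝ 1 (A {0, 1})
        + P {2} * pderiv ℝ 2 (A {0, 1})) := by
  simp [schouten, Fin.sum_univ_three, wedge_apply_01, leftContract_apply, rightContract_apply,
    coeffDeriv, leftContract_of_mem, rightContract_of_mem, bivector_apply hA]
  ring

lemma schouten_apply_02 {A : PolyVec} (hA : A ∈ ofDegree 2) (P : PolyVec) :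
    schouten A P {0, 2} = A {0, 2} * (pderiv ℝ 0 (P {0}) + pderiv ℝ 2 (P {2}))
      + A {0, 1} * pderiv ℝ 1 (P {2}) + A {1, 2} * pderiv ℝ 1 (P {0})
      - (P {0} * pderiv ℝ 0 (A {0, 2}) + P {1} * pderiv ℝ 1 (A {0, 2})
        + P {2} * pderiv ℝ 2 (A {0, 2})) := by
  simp [schouten, Fin.sum_univ_three, wedge_apply_02, leftContract_apply, rightContract_apply,
    coeffDeriv, leftContract_of_mem, rightContract_of_mem, bivector_apply hA]
  ring

lemma schouten_apply_12 {A : PolyVec} (hA : A ∈ ofDegree 2) (P : PolyVec) :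
    schouten A P {1, 2} = A {1, 2} * (pderiv ℝ 1 (P {1}) + pderiv ℝ 2 (P {2}))
      - A {0, 1} * pderiv ℝ 0 (P {2}) + A {0, 2} * pderiv ℝ 0 (P {1})
      - (P {0} * pderiv ℝ 0 (A {1, 2}) + P {1} * pderiv ℝ 1 (A {1, 2})
        + P {2} * pderiv ℝ 2 (A {1, 2})) := by
  simp [schouten, Fin.sum_univ_three, wedge_apply_12, leftContract_apply, rightContract_apply,
    coeffDeriv, leftContract_of_mem, rightContract_of_mem, bivector_apply hA]
  ring

lemma schouten_apply_012 {A : PolyVec} (hA : A ∈ ofDegree 2) (P : PolyVec) :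
    schouten A P {0, 1, 2} = A {0, 1} * (pderiv ℝ 0 (P {0, 2}) + pderiv ℝ 1 (P {1, 2}))
      + A {0, 2} * (pderiv ℝ 2 (P {1, 2}) - pderiv ℝ 0 (P {0, 1}))
      - A {1, 2} * (pderiv ℝ 1 (P {0, 1}) + pderiv ℝ 2 (P {0, 2}))
      - (P {0, 2} * pderiv ℝ 0 (A {0, 1}) - P {0, 1} * pderiv ℝ 0 (A {0, 2})
        + P {1, 2} * pderiv ℝ 1 (A {0, 1}) - P {0, 1} * pderiv ℝ 1 (A {1, 2})
        + P {1, 2} * pderiv ℝ 2 (A {0, 2}) - P {0, 2} * pderiv ℝ 2 (A {1, 2})) := by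
  simp [schouten, Fin.sum_univ_three, wedge_apply_012, leftContract_apply, rightContract_apply,
    coeffDeriv, leftContract_of_mem, rightContract_of_mem, bivector_apply hA]
  ring

lemma pderiv_comm (i j : Fin 3) (f : Series) :
    pderiv ℝ i (pderiv ℝ j f) = pderiv ℝ j (pderiv ℝ i f) := by
  ext e
  rw [coeff_pderiv, coeff_pderiv, coeff_pderiv, coeff_pderiv, add_right_comm]
  simp only [Finsupp.add_apply]
  by_cases h : i = j
  · subst h; ring
  · simp [Finsupp.single_apply, h, Ne.symm h]; ring

lemma finset_cases (S : Finset (Fin 3)) : S = ∅ ∨ S = {0} ∨ S = {1} ∨ S = {2} ∨ S = {0, 1} ∨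
    S = {0, 2} ∨ S = {1, 2} ∨ S = {0, 1, 2} := by
  revert S; decide

lemma polyVec_ext {P Q : PolyVec} (he : P ∅ = Q ∅) (h0 : P {0} = Q {0}) (h1 : P {1} = Q {1})
    (h2 : P {2} = Q {2}) (h01 : P {0, 1} = Q {0, 1}) (h02 : P {0, 2} = Q {0, 2})
    (h12 : P {1, 2} = Q {1, 2}) (h012 : P {0, 1, 2} = Q {0, 1, 2}) : P = Q := by
  funext S
  rcases finset_cases S with rfl | rfl | rfl | rfl | rfl | rfl | rfl | rfl <;> assumption

lemma del_apply_self (i : Fin 3) : del i {i} = 1 := Pi.single_eq_same _ _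

lemma del_apply_of_ne {i : Fin 3} {S : Finset (Fin 3)} (h : S ≠ {i}) : del i S = 0 :=
  Pi.single_eq_of_ne h _

lemma del_apply :
    (∀ i, del i ∅ = 0) ∧ del 0 {0} = 1 ∧ del 0 {1} = 0 ∧ del 0 {2} = 0 ∧ del 1 {0} = 0 ∧
    del 1 {1} = 1 ∧ del 1 {2} = 0 ∧ del 2 {0} = 0 ∧ del 2 {1} = 0 ∧ del 2 {2} = 1 ∧
    (∀ i, del i {0, 1} = 0) ∧ (∀ i, del i {0, 2} = 0) ∧ (∀ i, del i {1, 2} = 0) ∧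
    (∀ i, del i {0, 1, 2} = 0) := by
  refine ⟨fun i => ?_, ?_, ?_, ?_, ?_, ?_, ?_, ?_, ?_, ?_, fun i => ?_, fun i => ?_, fun i => ?_,
    fun i => ?_⟩ <;>
  first
  | exact del_apply_self _
  | exact del_apply_of_ne (by decide)
  | exact del_apply_of_ne (by revert i; decide)

/-! ### The rotation field -/

/-- The rotation field `x∂₂ - y∂₁` as a derivation of functions. -/
def rot (f : Series) : Series := x * pderiv ℝ 1 f - y * pderiv ℝ 0 f

/-- The Lie derivative of polyvector fields along the rotation field `Y₂`. -/
def rotLie : PolyVec →ₗ[ℝ] PolyVec := coboundaryMap Y2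

lemma Y1_apply : Y1 ∅ = 0 ∧ Y1 {0} = x ∧ Y1 {1} = y ∧ Y1 {2} = 0 ∧ Y1 {0, 1} = 0 ∧
    Y1 {0, 2} = 0 ∧ Y1 {1, 2} = 0 ∧ Y1 {0, 1, 2} = 0 := by
  simp [Y1, mulFun, del_apply]

lemma Y2_apply : Y2 ∅ = 0 ∧ Y2 {0} = -y ∧ Y2 {1} = x ∧ Y2 {2} = 0 ∧ Y2 {0, 1} = 0 ∧
    Y2 {0, 2} = 0 ∧ Y2 {1, 2} = 0 ∧ Y2 {0, 1, 2} = 0 := by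
  simp [Y2, mulFun, del_apply]

lemma Y3_apply : Y3 ∅ = 0 ∧ Y3 {0} = 0 ∧ Y3 {1} = 0 ∧ Y3 {2} = z ∧ Y3 {0, 1} = 0 ∧
    Y3 {0, 2} = 0 ∧ Y3 {1, 2} = 0 ∧ Y3 {0, 1, 2} = 0 := by
  simp [Y3, mulFun, del_apply]

lemma pderiv_xyz : pderiv ℝ 0 x = 1 ∧ pderiv ℝ 1 x = 0 ∧ pderiv ℝ 2 x = 0 ∧
    pderiv ℝ 0 y = 0 ∧ pderiv ℝ 1 y = 1 ∧ pderiv ℝ 2 y = 0 ∧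
    pderiv ℝ 0 z = 0 ∧ pderiv ℝ 1 z = 0 ∧ pderiv ℝ 2 z = 1 := by
  simp [x, y, z, pderiv_X_of_ne, pderiv_X_self]

lemma rotLie_apply (P : PolyVec) :
    rotLie P ∅ = rot (P ∅) ∧ rotLie P {0} = rot (P {0}) + P {1} ∧
    rotLie P {1} = rot (P {1}) - P {0} ∧ rotLie P {2} = rot (P {2}) ∧
    rotLie P {0, 1} = rot (P {0, 1}) ∧ rotLie P {0, 2} = rot (P {0, 2}) + P {1, 2} ∧
    rotLie P {1, 2} = rot (P {1, 2}) - P {0, 2} ∧ rotLie P {0, 1, 2} = rot (P {0, 1, 2}) := by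
  refine ⟨?_, ?_, ?_, ?_, ?_, ?_, ?_, ?_⟩ <;>
  · simp [rotLie, coboundaryMap, schouten, Fin.sum_univ_three, wedge_apply_empty, wedge_apply_0,
      wedge_apply_1, wedge_apply_2, wedge_apply_01, wedge_apply_02, wedge_apply_12,
      wedge_apply_012, leftContract_apply, rightContract_apply, coeffDeriv, leftContract_of_mem,
      rightContract_of_mem, Y2_apply, pderiv_xyz, rot]
    try ring

/-! ### The divergence homotopy -/

lemma mulFun_apply (f : Series) (P : PolyVec) (S : Finset (Fin 3)) : mulFun f P S = f * P S := rfl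

lemma smul_eq_C_mul' (a : ℝ) (f : Series) : a • f = C a * f := smul_eq_C_mul _ _

lemma del12_apply : del12 ∅ = 0 ∧ del12 {0} = 0 ∧ del12 {1} = 0 ∧ del12 {2} = 0 ∧
    del12 {0, 1} = 1 ∧ del12 {0, 2} = 0 ∧ del12 {1, 2} = 0 ∧ del12 {0, 1, 2} = 0 := by
  simp [del12, wedge_apply_empty, wedge_apply_0, wedge_apply_1, wedge_apply_2, wedge_apply_01,
    wedge_apply_02, wedge_apply_12, wedge_apply_012, del_apply]

lemma del23_apply : del23 ∅ = 0 ∧ del23 {0} = 0 ∧ del23 {1} = 0 ∧ del23 {2} = 0 ∧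
    del23 {0, 1} = 0 ∧ del23 {0, 2} = 0 ∧ del23 {1, 2} = 1 ∧ del23 {0, 1, 2} = 0 := by
  simp [del23, wedge_apply_empty, wedge_apply_0, wedge_apply_1, wedge_apply_2, wedge_apply_01,
    wedge_apply_02, wedge_apply_12, wedge_apply_012, del_apply]

lemma del31_apply : del31 ∅ = 0 ∧ del31 {0} = 0 ∧ del31 {1} = 0 ∧ del31 {2} = 0 ∧
    del31 {0, 1} = 0 ∧ del31 {0, 2} = -1 ∧ del31 {1, 2} = 0 ∧ del31 {0, 1, 2} = 0 := by
  simp [del31, wedge_apply_empty, wedge_apply_0, wedge_apply_1, wedge_apply_2, wedge_apply_01,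
    wedge_apply_02, wedge_apply_12, wedge_apply_012, del_apply]

lemma Lambda8_apply (b c ε : ℝ) :
    Lambda8 b c ε ∅ = 0 ∧ Lambda8 b c ε {0} = 0 ∧ Lambda8 b c ε {1} = 0 ∧
    Lambda8 b c ε {2} = 0 ∧ Lambda8 b c ε {0, 1} = C b * (x ^ 2 + y ^ 2) + C ε * z ^ 2 ∧
    Lambda8 b c ε {0, 2} = -((2 * C b + C c) * (y * z)) ∧
    Lambda8 b c ε {1, 2} = (2 * C b + C c) * (x * z) ∧ Lambda8 b c ε {0, 1, 2} = 0 := by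
  simp [Lambda8, Lambda8I, mulFun_apply, del12_apply, del23_apply, del31_apply, D',
    smul_eq_C_mul', map_ofNat]
  ring

lemma Lambda8_mem (b c ε : ℝ) : Lambda8 b c ε ∈ ofDegree 2 := by
  intro S hS
  rcases finset_cases S with rfl | rfl | rfl | rfl | rfl | rfl | rfl | rfl
  case inr.inr.inr.inr.inl => exact absurd (by decide) hS
  case inr.inr.inr.inr.inr.inl => exact absurd (by decide) hS
  case inr.inr.inr.inr.inr.inr.inl => exact absurd (by decide) hS
  all_goals simp [Lambda8_apply]

lemma pderiv_xyz_sq : (∀ i, pderiv ℝ i (2 : Series) = 0) ∧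
    pderiv ℝ 0 (x ^ 2) = 2 * x ∧ pderiv ℝ 1 (x ^ 2) = 0 ∧ pderiv ℝ 2 (x ^ 2) = 0 ∧
    pderiv ℝ 0 (y ^ 2) = 0 ∧ pderiv ℝ 1 (y ^ 2) = 2 * y ∧
    pderiv ℝ 2 (y ^ 2) = 0 ∧ pderiv ℝ 0 (z ^ 2) = 0 ∧ pderiv ℝ 1 (z ^ 2) = 0 ∧
    pderiv ℝ 2 (z ^ 2) = 2 * z := by
  refine ⟨fun i => ?_, ?_⟩
  · exact_mod_cast (pderiv ℝ i).map_natCast 2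
  · simp [sq, pderiv_xyz, two_mul]

/-- The divergence (BV) operator of the volume form `dx ∧ dy ∧ dz`. -/
def divergence : PolyVec →ₗ[ℝ] PolyVec where
  toFun P := ∑ i, coeffDeriv i (leftContract i P)
  map_add' P Q := by
    simp only [leftContract_add, coeffDeriv_add, Finset.sum_add_distrib]
  map_smul' a P := by
    simp only [leftContract_smul, coeffDeriv_smul, RingHom.id_apply, Finset.smul_sum]

lemma divergence_apply (P : PolyVec) :
    divergence P ∅ = pderiv ℝ 0 (P {0}) + pderiv ℝ 1 (P {1}) + pderiv ℝ 2 (P {2}) ∧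
    divergence P {0} = -pderiv ℝ 1 (P {0, 1}) - pderiv ℝ 2 (P {0, 2}) ∧
    divergence P {1} = pderiv ℝ 0 (P {0, 1}) - pderiv ℝ 2 (P {1, 2}) ∧
    divergence P {2} = pderiv ℝ 0 (P {0, 2}) + pderiv ℝ 1 (P {1, 2}) ∧
    divergence P {0, 1} = pderiv ℝ 2 (P {0, 1, 2}) ∧
    divergence P {0, 2} = -pderiv ℝ 1 (P {0, 1, 2}) ∧
    divergence P {1, 2} = pderiv ℝ 0 (P {0, 1, 2}) ∧
    divergence P {0, 1, 2} = 0 := by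
  refine ⟨?_, ?_, ?_, ?_, ?_, ?_, ?_, ?_⟩ <;>
    simp [divergence, Fin.sum_univ_three, coeffDeriv, leftContract_apply, leftContract_of_mem] <;>
    try ring

lemma coboundaryMap_apply (A P : PolyVec) : coboundaryMap A P = schouten A P := rfl

/-- The modular vector field of `Λ₈` is `c Y₂`, so the divergence operator is a homotopy between
`-c` times the Lie derivative along `Y₂` and zero. -/
lemma divergence_homotopy (b c ε : ℝ) (P : PolyVec) :
    coboundaryMap (Lambda8 b c ε) (divergence P) + divergence (coboundaryMap (Lambda8 b c ε) P) =
      (-c) • rotLie P := by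
  have h := Lambda8_mem b c ε
  apply polyVec_ext <;>
  · simp only [Pi.add_apply, Pi.smul_apply, rotLie_apply, divergence_apply,
      coboundaryMap_apply, schouten_apply_empty h, schouten_apply_0 h, schouten_apply_1 h,
      schouten_apply_2 h, schouten_apply_01 h, schouten_apply_02 h, schouten_apply_12 h,
      schouten_apply_012 h, Lambda8_apply, Derivation.leibniz, map_add, map_sub, map_neg, map_zero,
      smul_eq_C_mul', smul_eq_mul, pderiv_xyz, pderiv_xyz_sq, pderiv_C, pderiv_one, rot,
      pderiv_comm 1 0, pderiv_comm 2 0, pderiv_comm 2 1]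
    ring

/-- `Λ₈` is a Poisson tensor. -/
lemma coboundaryMap_comp_self (b c ε : ℝ) (P : PolyVec) :
    coboundaryMap (Lambda8 b c ε) (coboundaryMap (Lambda8 b c ε) P) = 0 := by
  have h := Lambda8_mem b c ε
  apply polyVec_ext <;>
  · simp only [Pi.zero_apply,
      coboundaryMap_apply, schouten_apply_empty h, schouten_apply_0 h, schouten_apply_1 h,
      schouten_apply_2 h, schouten_apply_01 h, schouten_apply_02 h, schouten_apply_12 h,
      schouten_apply_012 h, Lambda8_apply, Derivation.leibniz, map_add, map_sub, map_neg, map_zero,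
      smul_eq_mul, pderiv_xyz, pderiv_xyz_sq, pderiv_C, pderiv_one, pderiv_comm 1 0,
      pderiv_comm 2 0, pderiv_comm 2 1]
    try ring

/-! ### Coefficients of power series -/

/-- The exponent of the monomial `x ^ i * y ^ j * z ^ k`. -/
def expo (i j k : ℕ) : Fin 3 →₀ ℕ :=
  Finsupp.single 0 i + Finsupp.single 1 j + Finsupp.single 2 k

/-- The coefficient of `x ^ i * y ^ j * z ^ k` in a series. -/
def cf (f : Series) (i j k : ℕ) : ℝ := coeff (expo i j k) f

lemma expo_apply (i j k : ℕ) : expo i j k 0 = i ∧ expo i j k 1 = j ∧ expo i j k 2 = k := by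
  simp [expo]

lemma expo_eta (e : Fin 3 →₀ ℕ) : expo (e 0) (e 1) (e 2) = e := by
  ext i; fin_cases i <;> simp [expo]

lemma series_ext {f g : Series} (h : ∀ i j k, cf f i j k = cf g i j k) : f = g := by
  ext e
  rw [← expo_eta e]
  exact h _ _ _

lemma cf_add (f g : Series) (i j k : ℕ) : cf (f + g) i j k = cf f i j k + cf g i j k :=
  map_add _ _ _

lemma cf_sub (f g : Series) (i j k : ℕ) : cf (f - g) i j k = cf f i j k - cf g i j k :=
  map_sub _ _ _

lemma cf_zero (i j k : ℕ) : cf 0 i j k = 0 := map_zero _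

lemma coeff_X_mul_of_eq_zero (e : Fin 3 →₀ ℕ) (i : Fin 3) (h : e i = 0) (f : Series) :
    coeff e (X i * f) = 0 := by
  rw [X, coeff_monomial_mul, if_neg]
  intro h'
  have := h' i
  simp [h] at this

lemma expo_succ_x (i j k : ℕ) : expo (i + 1) j k = Finsupp.single 0 1 + expo i j k := by
  ext l; fin_cases l <;> simp [expo, add_comm]
lemma expo_succ_y (i j k : ℕ) : expo i (j + 1) k = Finsupp.single 1 1 + expo i j k := by
  ext l; fin_cases l <;> simp [expo, add_comm]
lemma expo_succ_z (i j k : ℕ) : expo i j (k + 1) = Finsupp.single 2 1 + expo i j k := by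
  ext l; fin_cases l <;> simp [expo, add_comm]

lemma cf_x_mul_zero (f : Series) (j k : ℕ) : cf (x * f) 0 j k = 0 :=
  coeff_X_mul_of_eq_zero _ _ (expo_apply _ _ _).1 f
lemma cf_y_mul_zero (f : Series) (i k : ℕ) : cf (y * f) i 0 k = 0 :=
  coeff_X_mul_of_eq_zero _ _ (expo_apply _ _ _).2.1 f
lemma cf_z_mul_zero (f : Series) (i j : ℕ) : cf (z * f) i j 0 = 0 :=
  coeff_X_mul_of_eq_zero _ _ (expo_apply _ _ _).2.2 f
lemma cf_x_mul_succ (f : Series) (i j k : ℕ) : cf (x * f) (i + 1) j k = cf f i j k := by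
  rw [cf, expo_succ_x, x, X, coeff_add_monomial_mul, one_mul, cf]
lemma cf_y_mul_succ (f : Series) (i j k : ℕ) : cf (y * f) i (j + 1) k = cf f i j k := by
  rw [cf, expo_succ_y, y, X, coeff_add_monomial_mul, one_mul, cf]
lemma cf_z_mul_succ (f : Series) (i j k : ℕ) : cf (z * f) i j (k + 1) = cf f i j k := by
  rw [cf, expo_succ_z, z, X, coeff_add_monomial_mul, one_mul, cf]

lemma cf_pderiv_x (f : Series) (i j k : ℕ) :
    cf (pderiv ℝ 0 f) i j k = (i + 1) * cf f (i + 1) j k := by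
  rw [cf, coeff_pderiv, (expo_apply i j k).1, cf, expo_succ_x, add_comm (expo i j k), mul_comm]
lemma cf_pderiv_y (f : Series) (i j k : ℕ) :
    cf (pderiv ℝ 1 f) i j k = (j + 1) * cf f i (j + 1) k := by
  rw [cf, coeff_pderiv, (expo_apply i j k).2.1, cf, expo_succ_y, add_comm (expo i j k), mul_comm]
lemma cf_pderiv_z (f : Series) (i j k : ℕ) :
    cf (pderiv ℝ 2 f) i j k = (k + 1) * cf f i j (k + 1) := by
  rw [cf, coeff_pderiv, (expo_apply i j k).2.2, cf, expo_succ_z, add_comm (expo i j k), mul_comm]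

/-! ### Semisimplicity of the rotation -/

/-- The Euler field of the `(x, y)`-plane. -/
def euler (f : Series) : Series := x * pderiv ℝ 0 f + y * pderiv ℝ 1 f

/-- The Laplacian in the variables `x`, `y`. -/
def laplacian (f : Series) : Series := pderiv ℝ 0 (pderiv ℝ 0 f) + pderiv ℝ 1 (pderiv ℝ 1 f)

/-- The square of the rotation is the angular part of the Laplacian. -/
lemma rot_rot (f : Series) : rot (rot f) = D' * laplacian f - euler (euler f) := by
  simp only [rot, laplacian, euler, D', map_add, map_sub, Derivation.leibniz, smul_eq_mul,
    pderiv_xyz, pderiv_comm 1 0]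
  ring

lemma rot_euler (f : Series) : rot (euler f) = euler (rot f) := by
  simp only [rot, euler, map_add, map_sub, Derivation.leibniz, smul_eq_mul, pderiv_xyz,
    pderiv_comm 1 0]
  ring

lemma rot_laplacian (f : Series) : rot (laplacian f) = laplacian (rot f) := by
  simp only [rot, laplacian, map_add, map_sub, Derivation.leibniz, smul_eq_mul, pderiv_xyz,
    pderiv_one, map_zero, pderiv_comm 1 0]
  ring

lemma rot_D'_mul (f : Series) : rot (D' * f) = D' * rot f := by
  simp only [rot, D', Derivation.leibniz, map_add, smul_eq_mul, pderiv_xyz_sq]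
  ring

lemma rot_zero : rot 0 = 0 := by simp [rot]

lemma cf_euler (f : Series) (i j k : ℕ) : cf (euler f) i j k = (i + j) * cf f i j k := by
  rw [euler, cf_add]
  rcases i with _ | i <;> rcases j with _ | j <;>
    simp [cf_x_mul_zero, cf_y_mul_zero, cf_x_mul_succ, cf_y_mul_succ, cf_pderiv_x, cf_pderiv_y]
  ring

lemma cf_D'_mul (f : Series) (i j k : ℕ) : cf (D' * f) i j k =
    (if 2 ≤ i then cf f (i - 2) j k else 0) + (if 2 ≤ j then cf f i (j - 2) k else 0) := by
  rw [D', add_mul, cf_add, sq, sq, mul_assoc, mul_assoc]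
  rcases i with _ | _ | i <;> rcases j with _ | _ | j <;>
    simp [cf_x_mul_zero, cf_y_mul_zero, cf_x_mul_succ, cf_y_mul_succ]

lemma cf_rot (f : Series) (i j k : ℕ) : cf (rot f) i j k =
    (if 1 ≤ i then (j + 1) * cf f (i - 1) (j + 1) k else 0)
      - (if 1 ≤ j then (i + 1) * cf f (i + 1) (j - 1) k else 0) := by
  rw [rot, cf_sub]
  rcases i with _ | i <;> rcases j with _ | j <;>
    simp [cf_x_mul_zero, cf_y_mul_zero, cf_x_mul_succ, cf_y_mul_succ, cf_pderiv_x, cf_pderiv_y]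

/-- If `rot (rot f) = 0`, then `rot_rot`, applied to `f` and differentiated along the rotation,
expresses the square of the Euler field on `rot f` by `x² + y²` times `rot (laplacian f)`, and
`laplacian f` satisfies the same hypothesis as `f`. -/
lemma rot_eq_zero_of_rot_rot_aux (n : ℕ) : ∀ f : Series, rot (rot f) = 0 →
    ∀ i j k, i + j < n → cf (rot f) i j k = 0 := by
  induction n with
  | zero => intro f _ i j k h; omega
  | succ n ih =>
    intro f hf i j k hij
    have h1 : euler (euler (rot f)) = D' * rot (laplacian f) := by
      rw [← rot_D'_mul, ← rot_euler, ← rot_euler]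
      congr 1
      have := rot_rot f
      rw [hf] at this
      exact (sub_eq_zero.1 this.symm).symm
    have h2 : rot (rot (laplacian f)) = 0 := by
      rw [rot_laplacian, rot_laplacian, hf]
      simp [laplacian]
    have h3 := congrArg (fun g => cf g i j k) h1
    simp only [cf_euler, cf_D'_mul] at h3
    have h4 : (if 2 ≤ i then cf (rot (laplacian f)) (i - 2) j k else 0) = 0 := by
      split_ifs with h
      · exact ih _ h2 _ _ _ (by omega)
      · rfl
    have h5 : (if 2 ≤ j then cf (rot (laplacian f)) i (j - 2) k else 0) = 0 := by
      split_ifs with h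
      · exact ih _ h2 _ _ _ (by omega)
      · rfl
    rw [h4, h5, add_zero, ← mul_assoc] at h3
    rcases Nat.eq_zero_or_pos (i + j) with h0 | h0
    · rw [cf_rot, if_neg (by omega), if_neg (by omega), sub_zero]
    · refine (mul_eq_zero.1 h3).resolve_left ?_
      have : (0 : ℝ) < i + j := by exact_mod_cast h0
      positivity

/-- The rotation field acts on functions without nilpotent part. -/
lemma rot_eq_zero_of_rot_rot {f : Series} (h : rot (rot f) = 0) : rot f = 0 :=
  series_ext fun i j k => by
    rw [rot_eq_zero_of_rot_rot_aux (i + j + 1) f h i j k (by omega), cf_zero]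

lemma cf_D'_aux : cf D' 2 0 0 = 1 := by
  have h := cf_D'_mul 1 2 0 0
  have h1 : cf 1 0 0 0 = 1 := by
    rw [cf, show expo 0 0 0 = 0 by simp [expo], coeff_zero_one]
  simpa [h1] using h

lemma D'_ne_zero : D' ≠ 0 := by
  intro h
  have := cf_D'_aux
  rw [h, cf_zero] at this
  exact zero_ne_one this

/-- The Lie derivative along the rotation field has no nilpotent part on planar vector fields
`f ∂₁ + g ∂₂`: pairing with `x dx + y dy` and `x dy - y dx` reduces the claim to functions. -/
lemma planar_eq_zero {f g : Series}
    (h1 : rot (rot f + g) + (rot g - f) = 0) (h2 : rot (rot g - f) - (rot f + g) = 0) :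
    rot f + g = 0 ∧ rot g - f = 0 := by
  have ha : rot (x * f + y * g) = x * (rot f + g) + y * (rot g - f) := by
    simp only [rot, map_add, Derivation.leibniz, smul_eq_mul, pderiv_xyz]; ring
  have hb : rot (x * g - y * f) = x * (rot g - f) - y * (rot f + g) := by
    simp only [rot, map_sub, Derivation.leibniz, smul_eq_mul, pderiv_xyz]; ring
  have ha' : rot (x * (rot f + g) + y * (rot g - f)) = 0 := by
    have : rot (x * (rot f + g) + y * (rot g - f)) = x * (rot (rot f + g) + (rot g - f)) +
        y * (rot (rot g - f) - (rot f + g)) := by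
      generalize rot f + g = u
      generalize rot g - f = v
      simp only [rot, map_add, Derivation.leibniz, smul_eq_mul, pderiv_xyz]; ring
    rw [this, h1, h2, mul_zero, mul_zero, add_zero]
  have hb' : rot (x * (rot g - f) - y * (rot f + g)) = 0 := by
    have : rot (x * (rot g - f) - y * (rot f + g)) = x * (rot (rot g - f) - (rot f + g)) -
        y * (rot (rot f + g) + (rot g - f)) := by
      generalize rot f + g = u
      generalize rot g - f = v
      simp only [rot, map_sub, Derivation.leibniz, smul_eq_mul, pderiv_xyz]; ring
    rw [this, h1, h2, mul_zero, mul_zero, sub_zero]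
  rw [← ha] at ha'
  rw [← hb] at hb'
  have ha0 := rot_eq_zero_of_rot_rot ha'
  have hb0 := rot_eq_zero_of_rot_rot hb'
  rw [ha] at ha0
  rw [hb] at hb0
  constructor
  · refine (mul_eq_zero.1 (?_ : D' * _ = 0)).resolve_left D'_ne_zero
    rw [D']; linear_combination x * ha0 - y * hb0
  · refine (mul_eq_zero.1 (?_ : D' * _ = 0)).resolve_left D'_ne_zero
    rw [D']; linear_combination y * ha0 + x * hb0

/-- The Lie derivative along the rotation field has no nilpotent part on polyvector fields. -/
lemma rotLie_eq_zero_of_rotLie_rotLie {P : PolyVec} (h : rotLie (rotLie P) = 0) :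
    rotLie P = 0 := by
  have hS : ∀ S, rotLie (rotLie P) S = 0 := fun S => congrFun h S
  obtain ⟨he, h0, h1, h2, h01, h02, h12, h012⟩ := rotLie_apply (rotLie P)
  obtain ⟨ke, k0, k1, k2, k01, k02, k12, k012⟩ := rotLie_apply P
  rw [hS] at he h0 h1 h2 h01 h02 h12 h012
  rw [ke] at he
  rw [k0, k1] at h0 h1
  rw [k2] at h2
  rw [k01] at h01
  rw [k02, k12] at h02 h12
  rw [k012] at h012
  have p := planar_eq_zero h0.symm h1.symm
  have q := planar_eq_zero h02.symm h12.symm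
  apply polyVec_ext
  · rw [ke]; exact rot_eq_zero_of_rot_rot he.symm
  · rw [k0]; exact p.1
  · rw [k1]; exact p.2
  · rw [k2]; exact rot_eq_zero_of_rot_rot h2.symm
  · rw [k01]; exact rot_eq_zero_of_rot_rot h01.symm
  · rw [k02]; exact q.1
  · rw [k12]; exact q.2
  · rw [k012]; exact rot_eq_zero_of_rot_rot h012.symm

/-- An operator on `ι → ℝ` that is a product of operators on finite-dimensional coordinate subspaces
(those of the fibres of `deg`) and vanishes wherever its square does splits the space into its
kernel and its range. -/
lemma exists_ker_add_range {ι κ : Type} (L : (ι → ℝ) →ₗ[ℝ] (ι → ℝ)) (deg : ι → κ)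
    (hfin : ∀ d, {i | deg i = d}.Finite)
    (hloc : ∀ v i, (∀ j, deg j = deg i → v j = 0) → L v i = 0)
    (hss : ∀ v, L (L v) = 0 → L v = 0) (v : ι → ℝ) :
    ∃ v₀ v₁, L v₀ = 0 ∧ v = v₀ + L v₁ := by
  classical
  have key : ∀ d, ∃ a b : ι → ℝ, L a = 0 ∧ (∀ i, deg i = d → v i = a i + L b i) := by
    intro d
    have : Finite {i | deg i = d} := hfin d
    let ex : ({i | deg i = d} → ℝ) →ₗ[ℝ] (ι → ℝ) := Function.ExtendByZero.linearMap ℝ Subtype.val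
    let re : (ι → ℝ) →ₗ[ℝ] ({i | deg i = d} → ℝ) := LinearMap.funLeft ℝ ℝ Subtype.val
    have ex_in : ∀ u (i : {i | deg i = d}), ex u i = u i := fun u i =>
      Subtype.val_injective.extend_apply _ _ _
    have ex_out : ∀ u i, deg i ≠ d → ex u i = 0 := fun u i hi =>
      Function.extend_apply' _ _ _ (by rintro ⟨a, rfl⟩; exact hi a.2)
    let M := re ∘ₗ L ∘ₗ ex
    have hM : ∀ u, L (ex u) = ex (M u) := by
      intro u
      funext i
      by_cases hi : deg i = d
      · exact (ex_in (M u) ⟨i, hi⟩).symm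
      · rw [ex_out _ _ hi]
        exact hloc _ _ fun j hj => ex_out _ _ (by rw [hj]; exact hi)
    have hdisj : Disjoint (LinearMap.range M) (LinearMap.ker M) := by
      rw [Submodule.disjoint_def]
      rintro _ ⟨u, rfl⟩ hu
      have h1 : L (L (ex u)) = 0 := by
        rw [hM, hM, LinearMap.mem_ker.1 hu, map_zero]
      funext i
      have h2 := congrFun (hss _ h1) i
      rw [hM, ex_in] at h2
      exact h2
    have htop := Submodule.eq_top_of_disjoint _ _ (LinearMap.finrank_range_add_finrank_ker M).ge
      hdisj
    have hv : re v ∈ LinearMap.range M ⊔ LinearMap.ker M := htop ▸ Submodule.mem_top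
    obtain ⟨_, ⟨b, rfl⟩, a, ha, hab⟩ := Submodule.mem_sup.1 hv
    refine ⟨ex a, ex b, by rw [hM, LinearMap.mem_ker.1 ha, map_zero], fun i hi => ?_⟩
    have := congrFun hab ⟨i, hi⟩
    rw [hM, (ex_in a ⟨i, hi⟩ : ex a i = _), (ex_in (M b) ⟨i, hi⟩ : ex (M b) i = _), add_comm]
    exact this.symm
  choose a b ha hab using key
  refine ⟨fun i => a (deg i) i, fun i => b (deg i) i, ?_, ?_⟩
  · funext i
    have := hloc ((fun i => a (deg i) i) - a (deg i)) i fun j hj => by simp [hj]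
    rw [map_sub, ha, sub_zero] at this
    exact this
  · funext i
    have := hloc ((fun i => b (deg i) i) - b (deg i)) i fun j hj => by simp [hj]
    rw [map_sub, Pi.sub_apply, sub_eq_zero] at this
    rw [Pi.add_apply, this]
    exact hab _ _ rfl

/-- The Lie derivative along the rotation field preserves the degree of coefficients in `(x, y)` and
their degree in `z`. -/
lemma rotLie_apply_eq_zero (P : PolyVec) (S : Finset (Fin 3)) (e : Fin 3 →₀ ℕ)
    (h : ∀ T e', (e' 0 + e' 1, e' 2) = (e 0 + e 1, e 2) → coeff e' (P T) = 0) :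
    coeff e (rotLie P S) = 0 := by
  have hr : ∀ T, coeff e (rot (P T)) = 0 := by
    intro T
    have hc := cf_rot (P T) (e 0) (e 1) (e 2)
    rw [cf, expo_eta] at hc
    rw [hc]
    have h1 : (if 1 ≤ e 0 then (e 1 + 1) * cf (P T) (e 0 - 1) (e 1 + 1) (e 2) else 0 : ℝ) = 0 := by
      split_ifs with hi
      · rw [cf, h, mul_zero]
        simp only [expo_apply, Prod.mk.injEq, and_true]; omega
      · rfl
    have h2 : (if 1 ≤ e 1 then (e 0 + 1) * cf (P T) (e 0 + 1) (e 1 - 1) (e 2) else 0 : ℝ) = 0 := by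
      split_ifs with hi
      · rw [cf, h, mul_zero]
        simp only [expo_apply, Prod.mk.injEq, and_true]; omega
      · rfl
    rw [h1, h2, sub_zero]
  have hp : ∀ T, coeff e (P T) = 0 := fun T => h T e rfl
  rcases finset_cases S with rfl | rfl | rfl | rfl | rfl | rfl | rfl | rfl <;>
    simp only [rotLie_apply, map_add, map_sub, hr, hp, add_zero, sub_zero]

/-- Every polyvector field is the sum of a rotation invariant one and of a Lie derivative along
the rotation field. -/
lemma exists_invariant_add_rotLie (P : PolyVec) :
    ∃ P₀ P₁, rotLie P₀ = 0 ∧ P = P₀ + rotLie P₁ := by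
  let cur : (Finset (Fin 3) × (Fin 3 →₀ ℕ) → ℝ) ≃ₗ[ℝ] PolyVec :=
    LinearEquiv.curry ℝ ℝ (Finset (Fin 3)) (Fin 3 →₀ ℕ)
  obtain ⟨v₀, v₁, h₀, h₁⟩ := exists_ker_add_range
    (cur.symm.toLinearMap ∘ₗ rotLie ∘ₗ cur.toLinearMap)
    (fun i => (i.2 0 + i.2 1, i.2 2))
    (by
      rintro ⟨n, k⟩
      have : {i : Finset (Fin 3) × (Fin 3 →₀ ℕ) | (i.2 0 + i.2 1, i.2 2) = (n, k)} ⊆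
          (fun t : Finset (Fin 3) × ℕ × ℕ => (t.1, expo t.2.1 t.2.2 k)) ''
            (Set.univ ×ˢ Set.Iic n ×ˢ Set.Iic n) := by
        rintro ⟨S, e⟩ he
        simp only [Set.mem_ofPred_eq, Prod.mk.injEq] at he
        refine ⟨(S, e 0, e 1), ?_, ?_⟩
        · simp only [Set.mem_prod, Set.mem_univ, true_and, Set.mem_Iic]; omega
        · simp only [← he.2, expo_eta]
      exact ((Set.finite_univ.prod ((Set.finite_Iic n).prod (Set.finite_Iic n))).image _).subset
        this)
    (fun v i hv => rotLie_apply_eq_zero _ i.1 i.2 fun T e' he' => hv (T, e') he')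
    (fun v hv => by
      have : rotLie (rotLie (cur v)) = 0 := by
        simpa using hv
      have := rotLie_eq_zero_of_rotLie_rotLie this
      simpa using this)
    (cur.symm P)
  refine ⟨cur v₀, cur v₁, ?_, ?_⟩
  · simpa using h₀
  · have := congrArg cur h₁
    simpa using this

/-! ### Degrees of polyvector fields -/

/-- The homogeneous component of degree `k`. -/
def degreePart (k : ℕ) (P : PolyVec) : PolyVec := fun S => if S.card = k then P S else 0

lemma degreePart_mem (k : ℕ) (P : PolyVec) : degreePart k P ∈ ofDegree k :=
  fun _ hS => if_neg hS

lemma degreePart_of_mem {k : ℕ} {P : PolyVec} (h : P ∈ ofDegree k) : degreePart k P = P := by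
  funext S
  by_cases hS : S.card = k
  · exact if_pos hS
  · rw [h S hS]; exact if_neg hS

lemma degreePart_add (k : ℕ) (P Q : PolyVec) :
    degreePart k (P + Q) = degreePart k P + degreePart k Q := by
  funext S
  by_cases hS : S.card = k <;> simp [degreePart, hS]

lemma degreePart_apply (k : ℕ) (P : PolyVec) :
    degreePart k P ∅ = (if 0 = k then P ∅ else 0) ∧
    degreePart k P {0} = (if 1 = k then P {0} else 0) ∧
    degreePart k P {1} = (if 1 = k then P {1} else 0) ∧
    degreePart k P {2} = (if 1 = k then P {2} else 0) ∧
    degreePart k P {0, 1} = (if 2 = k then P {0, 1} else 0) ∧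
    degreePart k P {0, 2} = (if 2 = k then P {0, 2} else 0) ∧
    degreePart k P {1, 2} = (if 2 = k then P {1, 2} else 0) ∧
    degreePart k P {0, 1, 2} = (if 3 = k then P {0, 1, 2} else 0) :=
  ⟨rfl, rfl, rfl, rfl, rfl, rfl, rfl, rfl⟩

lemma rotLie_degreePart (k : ℕ) (P : PolyVec) :
    rotLie (degreePart k P) = degreePart k (rotLie P) := by
  apply polyVec_ext <;>
  · simp only [rotLie_apply, degreePart_apply]
    split_ifs <;> simp [rot_zero]

lemma rotLie_mem {k : ℕ} {P : PolyVec} (h : P ∈ ofDegree k) : rotLie P ∈ ofDegree k := by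
  rw [← degreePart_of_mem h, rotLie_degreePart]
  exact degreePart_mem _ _

lemma exists_invariant_add_rotLie_of_mem {k : ℕ} {P : PolyVec} (h : P ∈ ofDegree k) :
    ∃ P₀ ∈ ofDegree k, ∃ P₁ ∈ ofDegree k, rotLie P₀ = 0 ∧ P = P₀ + rotLie P₁ := by
  obtain ⟨P₀, P₁, h₀, h₁⟩ := exists_invariant_add_rotLie P
  refine ⟨degreePart k P₀, degreePart_mem _ _, degreePart k P₁, degreePart_mem _ _, ?_, ?_⟩
  · rw [rotLie_degreePart, h₀]
    funext S; simp [degreePart]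
  · rw [rotLie_degreePart, ← degreePart_add, ← h₁, degreePart_of_mem h]

lemma mem_ofDegree_iff_of_apply (k : ℕ) (P : PolyVec) :
    P ∈ ofDegree k ↔ (0 ≠ k → P ∅ = 0) ∧ (1 ≠ k → P {0} = 0 ∧ P {1} = 0 ∧ P {2} = 0) ∧
      (2 ≠ k → P {0, 1} = 0 ∧ P {0, 2} = 0 ∧ P {1, 2} = 0) ∧ (3 ≠ k → P {0, 1, 2} = 0) := by
  constructor
  · intro h
    exact ⟨fun hk => h _ hk, fun hk => ⟨h _ hk, h _ hk, h _ hk⟩, fun hk => ⟨h _ hk, h _ hk, h _ hk⟩,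
      fun hk => h _ hk⟩
  · rintro ⟨h0, h1, h2, h3⟩ S hS
    rcases finset_cases S with rfl | rfl | rfl | rfl | rfl | rfl | rfl | rfl
    exacts [h0 hS, (h1 hS).1, (h1 hS).2.1, (h1 hS).2.2, (h2 hS).1, (h2 hS).2.1, (h2 hS).2.2, h3 hS]

lemma divergence_mem {k : ℕ} {P : PolyVec} (h : P ∈ ofDegree (k + 1)) :
    divergence P ∈ ofDegree k := by
  rw [mem_ofDegree_iff_of_apply] at h ⊢
  obtain ⟨h0, h1, h2, h3⟩ := h
  simp only [divergence_apply]
  refine ⟨fun hk => ?_, fun hk => ?_, fun hk => ?_, fun _ => trivial⟩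
  · obtain ⟨h, h', h''⟩ := h1 (by omega)
    simp [h, h', h'']
  · obtain ⟨h, h', h''⟩ := h2 (by omega)
    simp [h, h', h'']
  · simp [h3 (by omega)]

lemma divergence_eq_zero {P : PolyVec} (h : P ∈ ofDegree 0) : divergence P = 0 := by
  rw [mem_ofDegree_iff_of_apply] at h
  obtain ⟨-, h1, h2, h3⟩ := h
  apply polyVec_ext <;> simp [divergence_apply, h1, h2, h3]

lemma coboundaryMap_mem (b c ε : ℝ) {k : ℕ} {P : PolyVec} (hP : P ∈ ofDegree k) :
    coboundaryMap (Lambda8 b c ε) P ∈ ofDegree (k + 1) := by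
  have h := Lambda8_mem b c ε
  rw [mem_ofDegree_iff_of_apply] at hP ⊢
  obtain ⟨h0, h1, h2, h3⟩ := hP
  simp only [coboundaryMap_apply, schouten_apply_empty h, schouten_apply_0 h, schouten_apply_1 h,
    schouten_apply_2 h, schouten_apply_01 h, schouten_apply_02 h, schouten_apply_12 h,
    schouten_apply_012 h]
  refine ⟨fun _ => trivial, fun hk => ?_, fun hk => ?_, fun hk => ?_⟩
  · simp [h0 (by omega)]
  · obtain ⟨h, h', h''⟩ := h1 (by omega)
    simp [h, h', h'']
  · obtain ⟨h, h', h''⟩ := h2 (by omega)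
    simp [h, h', h'']

/-! ### Reduction to the invariant subcomplex -/

lemma coboundaryMap_rotLie {b c : ℝ} (ε : ℝ) (hc : c ≠ 0) (P : PolyVec) :
    coboundaryMap (Lambda8 b c ε) (rotLie P) = rotLie (coboundaryMap (Lambda8 b c ε) P) := by
  have h1 := congrArg (coboundaryMap (Lambda8 b c ε)) (divergence_homotopy b c ε P)
  have h2 := divergence_homotopy b c ε (coboundaryMap (Lambda8 b c ε) P)
  rw [map_add, coboundaryMap_comp_self, zero_add, map_smul] at h1
  rw [coboundaryMap_comp_self, map_zero, add_zero, h1] at h2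
  exact smul_right_injective _ (neg_ne_zero.2 hc) h2

lemma eq_zero_of_invariant_of_range {P R : PolyVec} (h : rotLie P = 0) (hR : P = rotLie R) :
    P = 0 := by
  rw [hR] at h ⊢
  exact rotLie_eq_zero_of_rotLie_rotLie h

/-- Every cocycle is cohomologous to a rotation invariant one. -/
lemma exists_invariant_cocycle {b c : ℝ} (ε : ℝ) (hc : c ≠ 0) {k : ℕ} {Q : PolyVec}
    (hQ : Q ∈ cocycles (Lambda8 b c ε) k) :
    ∃ Q₀ ∈ cocycles (Lambda8 b c ε) k, rotLie Q₀ = 0 ∧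
      Q - Q₀ ∈ coboundaries (Lambda8 b c ε) k := by
  set d := coboundaryMap (Lambda8 b c ε) with hd
  have hcl : d Q = 0 := hQ.2
  obtain ⟨Q₀, hQ₀, R, hR, hi, rfl⟩ := exists_invariant_add_rotLie_of_mem hQ.1
  obtain ⟨R₀, hR₀, R₁, hR₁, hi', rfl⟩ := exists_invariant_add_rotLie_of_mem hR
  have he : rotLie (R₀ + rotLie R₁) = rotLie (rotLie R₁) := by rw [map_add, hi', zero_add]
  rw [he] at hcl ⊢
  rw [map_add] at hcl
  have hrl : ∀ P, d (rotLie P) = rotLie (d P) := coboundaryMap_rotLie ε hc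
  have hdQ₀ : d Q₀ = 0 := by
    apply eq_zero_of_invariant_of_range (R := -d (rotLie R₁))
    · rw [← hrl, hi, map_zero]
    · rw [map_neg, ← hrl]
      exact eq_neg_of_add_eq_zero_left hcl
  rw [hdQ₀, zero_add] at hcl
  have hdR : d (rotLie R₁) = 0 := by
    apply eq_zero_of_invariant_of_range (R := d R₁)
    · rw [← hrl, hcl]
    · exact hrl _
  refine ⟨Q₀, ⟨hQ₀, hdQ₀⟩, hi, ?_⟩
  rw [add_sub_cancel_left]
  have hh := divergence_homotopy b c ε (rotLie R₁)
  rw [← hd, hdR, map_zero, add_zero] at hh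
  have hL : rotLie (rotLie R₁) = d ((-c)⁻¹ • divergence (rotLie R₁)) := by
    rw [map_smul, hh, smul_smul, inv_mul_cancel₀ (neg_ne_zero.2 hc), one_smul]
  rcases k with _ | k
  · rw [hL, divergence_eq_zero (rotLie_mem hR₁), smul_zero, map_zero]
    exact Submodule.zero_mem _
  · rw [hL]
    exact Submodule.mem_map_of_mem (Submodule.smul_mem _ _ (divergence_mem (rotLie_mem hR₁)))

/-- A rotation invariant coboundary is the coboundary of a rotation invariant cochain. -/
lemma exists_invariant_primitive {b c : ℝ} (ε : ℝ) (hc : c ≠ 0) {k : ℕ} {Q : PolyVec}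
    (hQ : Q ∈ coboundaries (Lambda8 b c ε) (k + 1)) (hi : rotLie Q = 0) :
    ∃ R ∈ ofDegree k, rotLie R = 0 ∧ coboundaryMap (Lambda8 b c ε) R = Q := by
  obtain ⟨R, hR, rfl⟩ := hQ
  obtain ⟨R₀, hR₀, R₁, hR₁, hi', rfl⟩ := exists_invariant_add_rotLie_of_mem hR
  refine ⟨R₀, hR₀, hi', ?_⟩
  rw [map_add, coboundaryMap_rotLie ε hc] at hi ⊢
  rw [map_add, ← coboundaryMap_rotLie ε hc R₀, hi', map_zero, zero_add] at hi
  rw [rotLie_eq_zero_of_rotLie_rotLie hi, add_zero]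

/-! ### Rotation invariant series -/

/-- Coefficient arrays of formal power series in two variables `s = x² + y²` and `z`: the entry
`a p q` is the coefficient of `s ^ p * z ^ q`. -/
abbrev Arr : Type := ℕ → ℕ → ℝ

/-- The series `∑ a p q (x² + y²) ^ p z ^ q`, given by its coefficients. -/
def ofArr : Arr →ₗ[ℝ] Series where
  toFun a := fun e => if Even (e 0) ∧ Even (e 1) then
    ((e 0 / 2 + e 1 / 2).choose (e 0 / 2) : ℝ) * a (e 0 / 2 + e 1 / 2) (e 2) else 0
  map_add' a b := by
    funext e
    change _ = @ite ℝ _ _ _ _ + @ite ℝ _ _ _ _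
    simp only [Pi.add_apply]
    split_ifs <;> ring
  map_smul' r a := by
    funext e
    change _ = r * @ite ℝ _ _ _ _
    simp only [Pi.smul_apply, smul_eq_mul]
    split_ifs <;> ring

lemma coeff_ofArr (a : Arr) (e : Fin 3 →₀ ℕ) : coeff e (ofArr a) =
    if Even (e 0) ∧ Even (e 1) then
      ((e 0 / 2 + e 1 / 2).choose (e 0 / 2) : ℝ) * a (e 0 / 2 + e 1 / 2) (e 2) else 0 := rfl

lemma cf_ofArr (a : Arr) (i j k : ℕ) :
    cf (ofArr a) (2 * i) (2 * j) k = (i + j).choose i * a (i + j) k := by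
  rw [cf, coeff_ofArr, (expo_apply _ _ _).1, (expo_apply _ _ _).2.1, (expo_apply _ _ _).2.2,
    if_pos ⟨even_two_mul i, even_two_mul j⟩, Nat.mul_div_cancel_left i two_pos,
    Nat.mul_div_cancel_left j two_pos]

lemma cf_ofArr_odd_left (a : Arr) (i j k : ℕ) : cf (ofArr a) (2 * i + 1) j k = 0 := by
  rw [cf, coeff_ofArr, (expo_apply _ _ _).1, if_neg]
  exact fun h => Nat.not_even_two_mul_add_one i h.1

lemma cf_ofArr_odd_right (a : Arr) (i j k : ℕ) : cf (ofArr a) i (2 * j + 1) k = 0 := by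
  rw [cf, coeff_ofArr, (expo_apply _ _ _).2.1, if_neg]
  exact fun h => Nat.not_even_two_mul_add_one j h.2

/-- A series which vanishes at odd exponents of `x` or `y` is determined by its even part. -/
lemma series_ext_even {f g : Series} (h : ∀ i j k, cf f (2 * i) (2 * j) k = cf g (2 * i) (2 * j) k)
    (hx : ∀ i j k, cf f (2 * i + 1) j k = cf g (2 * i + 1) j k)
    (hy : ∀ i j k, cf f i (2 * j + 1) k = cf g i (2 * j + 1) k) : f = g := by
  apply series_ext
  intro i j k
  rcases Nat.even_or_odd' i with ⟨i, rfl | rfl⟩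
  · rcases Nat.even_or_odd' j with ⟨j, rfl | rfl⟩
    · exact h _ _ _
    · exact hy _ _ _
  · exact hx _ _ _

lemma ofArr_injective : Function.Injective ofArr := by
  intro a b h
  funext p q
  have h1 := cf_ofArr a 0 p q
  rw [h, cf_ofArr b 0 p q] at h1
  simpa using h1.symm

/-- Multiplication by `s`. -/
def mulS : Arr →ₗ[ℝ] Arr where
  toFun a := fun p q => match p with
    | 0 => 0
    | p + 1 => a p q
  map_add' a b := by funext p q; rcases p with _ | p <;> simp
  map_smul' r a := by funext p q; rcases p with _ | p <;> simp

/-- Multiplication by `z`. -/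
def mulZ : Arr →ₗ[ℝ] Arr where
  toFun a := fun p q => match q with
    | 0 => 0
    | q + 1 => a p q
  map_add' a b := by funext p q; rcases q with _ | q <;> simp
  map_smul' r a := by funext p q; rcases q with _ | q <;> simp

/-- The partial derivative with respect to `s`. -/
def derivS : Arr →ₗ[ℝ] Arr where
  toFun a := fun p q => (p + 1) * a (p + 1) q
  map_add' a b := by funext p q; simp only [Pi.add_apply]; ring
  map_smul' r a := by funext p q; simp only [Pi.smul_apply, smul_eq_mul, RingHom.id_apply]; ring

/-- The partial derivative with respect to `z`. -/
def derivZ : Arr →ₗ[ℝ] Arr where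
  toFun a := fun p q => (q + 1) * a p (q + 1)
  map_add' a b := by funext p q; simp only [Pi.add_apply]; ring
  map_smul' r a := by funext p q; simp only [Pi.smul_apply, smul_eq_mul, RingHom.id_apply]; ring

@[simp] lemma mulS_zero (a : Arr) (q : ℕ) : mulS a 0 q = 0 := rfl
@[simp] lemma mulS_succ (a : Arr) (p q : ℕ) : mulS a (p + 1) q = a p q := rfl
@[simp] lemma mulZ_zero (a : Arr) (p : ℕ) : mulZ a p 0 = 0 := rfl
@[simp] lemma mulZ_succ (a : Arr) (p q : ℕ) : mulZ a p (q + 1) = a p q := rfl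
lemma derivS_apply (a : Arr) (p q : ℕ) : derivS a p q = (p + 1) * a (p + 1) q := rfl
lemma derivZ_apply (a : Arr) (p q : ℕ) : derivZ a p q = (q + 1) * a p (q + 1) := rfl

lemma ofArr_mulS (a : Arr) : ofArr (mulS a) = D' * ofArr a := by
  apply series_ext_even
  · intro i j k
    rw [cf_ofArr, cf_D'_mul]
    rcases i with _ | i <;> rcases j with _ | j
    · simp
    · rw [if_neg (by omega), if_pos (by omega),
        show 2 * (j + 1) - 2 = 2 * j by omega, cf_ofArr]
      simp [← add_assoc]
    · rw [if_pos (by omega), if_neg (by omega),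
        show 2 * (i + 1) - 2 = 2 * i by omega, cf_ofArr]
      simp
    · rw [if_pos (by omega), if_pos (by omega),
        show 2 * (i + 1) - 2 = 2 * i by omega, show 2 * (j + 1) - 2 = 2 * j by omega,
        cf_ofArr, cf_ofArr, show i + 1 + (j + 1) = (i + j + 1) + 1 by omega, mulS_succ,
        show i + (j + 1) = i + j + 1 by omega, show i + 1 + j = i + j + 1 by omega,
        Nat.choose_succ_succ]
      push_cast; ring
  · intro i j k
    rw [cf_ofArr_odd_left, cf_D'_mul]
    rcases i with _ | i
    · rw [if_neg (by omega), cf_ofArr_odd_left]; simp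
    · rw [if_pos (by omega), show 2 * (i + 1) + 1 - 2 = 2 * i + 1 by omega, cf_ofArr_odd_left,
        cf_ofArr_odd_left]
      simp
  · intro i j k
    rw [cf_ofArr_odd_right, cf_D'_mul]
    rcases j with _ | j
    · rw [if_neg (by omega : ¬ 2 ≤ 2 * 0 + 1), cf_ofArr_odd_right]; simp
    · rw [if_pos (by omega : 2 ≤ 2 * (j + 1) + 1),
        show 2 * (j + 1) + 1 - 2 = 2 * j + 1 by omega, cf_ofArr_odd_right, cf_ofArr_odd_right]
      simp

lemma ofArr_mulZ (a : Arr) : ofArr (mulZ a) = z * ofArr a := by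
  apply series_ext_even
  · intro i j k
    rw [cf_ofArr]
    rcases k with _ | k
    · rw [cf_z_mul_zero]; simp
    · rw [cf_z_mul_succ, cf_ofArr]; rfl
  · intro i j k
    rw [cf_ofArr_odd_left]
    rcases k with _ | k
    · rw [cf_z_mul_zero]
    · rw [cf_z_mul_succ, cf_ofArr_odd_left]
  · intro i j k
    rw [cf_ofArr_odd_right]
    rcases k with _ | k
    · rw [cf_z_mul_zero]
    · rw [cf_z_mul_succ, cf_ofArr_odd_right]

lemma succ_mul_choose_cast (i j : ℕ) :
    ((i : ℝ) + 1) * (i + 1 + j).choose (i + 1) = (i + j + 1) * (i + j).choose i := by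
  have := Nat.add_one_mul_choose_eq (i + j) i
  rw [show i + 1 + j = i + j + 1 by omega]
  have h : ((i + j + 1 : ℕ) : ℝ) * (i + j).choose i =
      ((i + j + 1).choose (i + 1) : ℝ) * ((i + 1 : ℕ) : ℝ) := by exact_mod_cast this
  push_cast at h
  linear_combination -h

lemma succ_mul_choose_cast' (i j : ℕ) :
    ((j : ℝ) + 1) * (i + (j + 1)).choose i = (i + j + 1) * (i + j).choose i := by
  have := succ_mul_choose_cast j i
  rw [← Nat.choose_symm_of_eq_add (show j + 1 + i = i + (j + 1) by omega),
    ← Nat.choose_symm_of_eq_add (show j + i = i + j by omega),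
    show j + 1 + i = i + (j + 1) by omega, show j + i = i + j by omega] at this
  linear_combination this

lemma pderiv_x_ofArr (a : Arr) : pderiv ℝ 0 (ofArr a) = 2 * x * ofArr (derivS a) := by
  rw [show 2 * x * ofArr (derivS a) = x * ofArr ((2 : ℝ) • derivS a) by
    rw [map_smul, smul_eq_C_mul', map_ofNat]; ring]
  apply series_ext
  intro i j k
  rw [cf_pderiv_x]
  rcases Nat.even_or_odd' i with ⟨i, rfl | rfl⟩
  · rw [cf_ofArr_odd_left]
    rcases i with _ | i
    · rw [mul_zero, cf_x_mul_zero]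
    · rw [show 2 * (i + 1) = 2 * i + 1 + 1 by omega, cf_x_mul_succ, cf_ofArr_odd_left, mul_zero]
  · rw [cf_x_mul_succ]
    rcases Nat.even_or_odd' j with ⟨j, rfl | rfl⟩
    · rw [show 2 * i + 1 + 1 = 2 * (i + 1) by omega, cf_ofArr, cf_ofArr, Pi.smul_apply,
        Pi.smul_apply, derivS_apply, smul_eq_mul]
      have := succ_mul_choose_cast i j
      rw [show i + 1 + j = i + j + 1 by omega] at this ⊢
      push_cast
      linear_combination 2 * a (i + j + 1) k * this
    · rw [cf_ofArr_odd_right, cf_ofArr_odd_right, mul_zero]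

lemma pderiv_y_ofArr (a : Arr) : pderiv ℝ 1 (ofArr a) = 2 * y * ofArr (derivS a) := by
  rw [show 2 * y * ofArr (derivS a) = y * ofArr ((2 : ℝ) • derivS a) by
    rw [map_smul, smul_eq_C_mul', map_ofNat]; ring]
  apply series_ext
  intro i j k
  rw [cf_pderiv_y]
  rcases Nat.even_or_odd' j with ⟨j, rfl | rfl⟩
  · rw [cf_ofArr_odd_right]
    rcases j with _ | j
    · rw [mul_zero, cf_y_mul_zero]
    · rw [show 2 * (j + 1) = 2 * j + 1 + 1 by omega, cf_y_mul_succ, cf_ofArr_odd_right, mul_zero]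
  · rw [cf_y_mul_succ]
    rcases Nat.even_or_odd' i with ⟨i, rfl | rfl⟩
    · rw [show 2 * j + 1 + 1 = 2 * (j + 1) by omega, cf_ofArr, cf_ofArr, Pi.smul_apply,
        Pi.smul_apply, derivS_apply, smul_eq_mul]
      have := succ_mul_choose_cast' i j
      rw [show i + (j + 1) = i + j + 1 by omega] at this ⊢
      push_cast
      linear_combination 2 * a (i + j + 1) k * this
    · rw [cf_ofArr_odd_left, cf_ofArr_odd_left, mul_zero]

lemma pderiv_z_ofArr (a : Arr) : pderiv ℝ 2 (ofArr a) = ofArr (derivZ a) := by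
  apply series_ext_even
  · intro i j k
    rw [cf_pderiv_z, cf_ofArr, cf_ofArr, derivZ_apply]; ring
  · intro i j k
    rw [cf_pderiv_z, cf_ofArr_odd_left, cf_ofArr_odd_left, mul_zero]
  · intro i j k
    rw [cf_pderiv_z, cf_ofArr_odd_right, cf_ofArr_odd_right, mul_zero]

lemma rot_ofArr (a : Arr) : rot (ofArr a) = 0 := by
  rw [rot, pderiv_x_ofArr, pderiv_y_ofArr]; ring

lemma rot_sub (f g : Series) : rot (f - g) = rot f - rot g := by
  simp only [rot, map_sub]; ring

/-- An invariant series is determined by its coefficients of `y ^ (2 * p) * z ^ q`. -/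
lemma eq_zero_of_rot_eq_zero {f : Series} (hf : rot f = 0) (h : ∀ p q, cf f 0 (2 * p) q = 0) :
    f = 0 := by
  have hr : ∀ i j k, cf (rot f) i j k = 0 := fun i j k => by rw [hf, cf_zero]
  have h1 : ∀ j k, cf f 1 j k = 0 := fun j k => by
    have := hr 0 (j + 1) k
    rw [cf_rot, if_neg (by omega), if_pos (by omega)] at this
    simpa using this
  have h2 : ∀ i k, cf f i 1 k = 0 := fun i k => by
    have := hr (i + 1) 0 k
    rw [cf_rot, if_pos (by omega), if_neg (by omega)] at this
    simpa using this
  have h3 : ∀ i j k : ℕ, ((j : ℝ) + 1 + 1) * cf f i (j + 2) k =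
      ((i : ℝ) + 1 + 1) * cf f (i + 2) j k := fun i j k => by
    have := hr (i + 1) (j + 1) k
    rw [cf_rot, if_pos (by omega), if_pos (by omega), sub_eq_zero] at this
    simpa using this
  have hup : ∀ i j k, cf f i (j + 2) k = 0 → cf f (i + 2) j k = 0 := fun i j k h => by
    have h' := h3 i j k
    rw [h, mul_zero] at h'
    exact (mul_eq_zero.1 h'.symm).resolve_left (by positivity)
  have hdown : ∀ i j k, cf f (i + 2) j k = 0 → cf f i (j + 2) k = 0 := fun i j k h => by
    have h' := h3 i j k
    rw [h, mul_zero] at h'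
    exact (mul_eq_zero.1 h').resolve_left (by positivity)
  apply series_ext_even
  · intro i
    induction i with
    | zero => intro j k; rw [cf_zero]; exact h j k
    | succ i ih =>
      intro j k
      rw [cf_zero]
      exact hup _ _ _ (by simpa [cf_zero, mul_add] using ih (j + 1) k)
  · intro i
    induction i with
    | zero => intro j k; rw [cf_zero]; exact h1 j k
    | succ i ih =>
      intro j k
      rw [cf_zero]
      exact hup (2 * i + 1) _ _ (by simpa [cf_zero] using ih (j + 2) k)
  · intro i j
    induction j generalizing i with
    | zero => intro k; rw [cf_zero]; exact h2 i k
    | succ j ih =>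
      intro k
      rw [cf_zero]
      exact hdown i (2 * j + 1) _ (by simpa [cf_zero] using ih (i + 2) k)

lemma exists_ofArr_of_rot_eq_zero {f : Series} (hf : rot f = 0) : ∃ a, f = ofArr a := by
  refine ⟨fun p q => cf f 0 (2 * p) q, sub_eq_zero.1 (eq_zero_of_rot_eq_zero ?_ fun p q => ?_)⟩
  · rw [rot_sub, hf, rot_ofArr, sub_zero]
  · rw [cf_sub]
    have := cf_ofArr (fun p q => cf f 0 (2 * p) q) 0 p q
    rw [Nat.mul_zero] at this
    rw [this]; simp

/-- Rotation invariant planar vector fields are combinations of `x∂₁ + y∂₂` and `x∂₂ - y∂₁`. -/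
lemma exists_ofArr_of_planar {f g : Series} (h1 : rot f + g = 0) (h2 : rot g - f = 0) :
    ∃ a b, f = x * ofArr a - y * ofArr b ∧ g = y * ofArr a + x * ofArr b := by
  have ha : rot (x * f + y * g) = 0 := by
    have : rot (x * f + y * g) = x * (rot f + g) + y * (rot g - f) := by
      simp only [rot, map_add, Derivation.leibniz, smul_eq_mul, pderiv_xyz]; ring
    rw [this, h1, h2, mul_zero, mul_zero, add_zero]
  have hb : rot (x * g - y * f) = 0 := by
    have : rot (x * g - y * f) = x * (rot g - f) - y * (rot f + g) := by
      simp only [rot, map_sub, Derivation.leibniz, smul_eq_mul, pderiv_xyz]; ring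
    rw [this, h1, h2, mul_zero, mul_zero, sub_zero]
  have key : ∀ u : Series, (∀ k, cf u 0 0 k = 0) → rot u = 0 → ∃ a, u = D' * ofArr a := by
    intro u hu hr
    obtain ⟨a, rfl⟩ := exists_ofArr_of_rot_eq_zero hr
    refine ⟨fun p q => a (p + 1) q, ?_⟩
    rw [← ofArr_mulS]
    congr 1
    funext p q
    rcases p with _ | p
    · have h0 := hu q
      have h1 := cf_ofArr a 0 0 q
      rw [Nat.mul_zero, h0] at h1
      simpa using h1.symm
    · rfl
  obtain ⟨a, ha'⟩ := key _ (fun k => by rw [cf_add, cf_x_mul_zero, cf_y_mul_zero, add_zero]) ha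
  obtain ⟨b, hb'⟩ := key _ (fun k => by rw [cf_sub, cf_x_mul_zero, cf_y_mul_zero, sub_zero]) hb
  refine ⟨a, b, mul_left_cancel₀ D'_ne_zero ?_, mul_left_cancel₀ D'_ne_zero ?_⟩
  · rw [mul_sub, mul_left_comm, ← ha', mul_left_comm, ← hb', D']; ring
  · rw [mul_add, mul_left_comm, ← ha', mul_left_comm, ← hb', D']; ring

/-! ### The invariant subcomplex -/

/-- The action on functions of `s = x² + y²` and `z` of the vector field `E` for which
`[Λ₈, f] = E(f) Y₂`: it is `(2b + c) z ∂_z - 2 (b s + ε z²) ∂_s`. -/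
def hamOp (b c ε : ℝ) : Arr →ₗ[ℝ] Arr :=
  (2 * b + c) • (mulZ ∘ₗ derivZ) - (2 * b) • (mulS ∘ₗ derivS)
    - (2 * ε) • (mulZ ∘ₗ mulZ ∘ₗ derivS)

lemma ofArr_hamOp (b c ε : ℝ) (f : Arr) : ofArr (hamOp b c ε f) =
    (2 * C b + C c) * (z * ofArr (derivZ f))
      - 2 * (C b * (x ^ 2 + y ^ 2) + C ε * z ^ 2) * ofArr (derivS f) := by
  simp only [hamOp, LinearMap.sub_apply, LinearMap.smul_apply, LinearMap.comp_apply, map_sub,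
    map_smul, ofArr_mulS, ofArr_mulZ, smul_eq_C_mul', map_add, map_mul, map_ofNat, D']
  ring

/-- The operator `T_μ f = s (E f - μ f) - 2ε z² f`. -/
def divOp (b c ε μ : ℝ) : Arr →ₗ[ℝ] Arr :=
  mulS ∘ₗ (hamOp b c ε - μ • LinearMap.id) - (2 * ε) • (mulZ ∘ₗ mulZ)

lemma divOp_apply (b c ε μ : ℝ) (f : Arr) : divOp b c ε μ f =
    mulS (hamOp b c ε f - μ • f) - (2 * ε) • mulZ (mulZ f) := rfl

lemma ofArr_divOp (b c ε μ : ℝ) (f : Arr) : ofArr (divOp b c ε μ f) =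
    (x ^ 2 + y ^ 2) * (ofArr (hamOp b c ε f) - C μ * ofArr f) - 2 * C ε * z ^ 2 * ofArr f := by
  simp only [divOp_apply, map_sub, map_smul, ofArr_mulS, ofArr_mulZ, smul_eq_C_mul', map_mul,
    map_ofNat, D']
  ring

/-- The invariant vector field `f Y₁ + g Y₂ + h ∂₃`. -/
def invVec (f g h : Arr) : PolyVec :=
  mulFun (ofArr f) Y1 + mulFun (ofArr g) Y2 + mulFun (ofArr h) (del 2)

/-- The invariant bivector field `p ∂₁₂ + q Y₂ ∧ ∂₃ + r Y₁ ∧ ∂₃`. -/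
def invBiv (p q r : Arr) : PolyVec :=
  mulFun (ofArr p) del12 + mulFun (ofArr q) (wedge Y2 (del 2)) + mulFun (ofArr r) (wedge Y1 (del 2))

lemma ofFun_apply (f : Series) : ofFun f ∅ = f ∧ ofFun f {0} = 0 ∧ ofFun f {1} = 0 ∧
    ofFun f {2} = 0 ∧ ofFun f {0, 1} = 0 ∧ ofFun f {0, 2} = 0 ∧ ofFun f {1, 2} = 0 ∧
    ofFun f {0, 1, 2} = 0 := by
  refine ⟨Pi.single_eq_same _ _, ?_, ?_, ?_, ?_, ?_, ?_, ?_⟩ <;>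
    exact Pi.single_eq_of_ne (by decide) _

lemma wedge_Y2_del_apply : wedge Y2 (del 2) ∅ = 0 ∧ wedge Y2 (del 2) {0} = 0 ∧
    wedge Y2 (del 2) {1} = 0 ∧ wedge Y2 (del 2) {2} = 0 ∧ wedge Y2 (del 2) {0, 1} = 0 ∧
    wedge Y2 (del 2) {0, 2} = -y ∧ wedge Y2 (del 2) {1, 2} = x ∧
    wedge Y2 (del 2) {0, 1, 2} = 0 := by
  simp [wedge_apply_empty, wedge_apply_0, wedge_apply_1, wedge_apply_2, wedge_apply_01,
    wedge_apply_02, wedge_apply_12, wedge_apply_012, del_apply, Y2_apply]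

lemma wedge_Y1_del_apply : wedge Y1 (del 2) ∅ = 0 ∧ wedge Y1 (del 2) {0} = 0 ∧
    wedge Y1 (del 2) {1} = 0 ∧ wedge Y1 (del 2) {2} = 0 ∧ wedge Y1 (del 2) {0, 1} = 0 ∧
    wedge Y1 (del 2) {0, 2} = x ∧ wedge Y1 (del 2) {1, 2} = y ∧
    wedge Y1 (del 2) {0, 1, 2} = 0 := by
  simp [wedge_apply_empty, wedge_apply_0, wedge_apply_1, wedge_apply_2, wedge_apply_01,
    wedge_apply_02, wedge_apply_12, wedge_apply_012, del_apply, Y1_apply]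

lemma del123_apply : del123 ∅ = 0 ∧ del123 {0} = 0 ∧ del123 {1} = 0 ∧ del123 {2} = 0 ∧
    del123 {0, 1} = 0 ∧ del123 {0, 2} = 0 ∧ del123 {1, 2} = 0 ∧ del123 {0, 1, 2} = 1 := by
  simp [del123, wedge_apply_empty, wedge_apply_0, wedge_apply_1, wedge_apply_2, wedge_apply_01,
    wedge_apply_02, wedge_apply_12, wedge_apply_012, del_apply]

lemma invVec_apply (f g h : Arr) : invVec f g h ∅ = 0 ∧
    invVec f g h {0} = x * ofArr f - y * ofArr g ∧ invVec f g h {1} = y * ofArr f + x * ofArr g ∧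
    invVec f g h {2} = ofArr h ∧ invVec f g h {0, 1} = 0 ∧ invVec f g h {0, 2} = 0 ∧
    invVec f g h {1, 2} = 0 ∧ invVec f g h {0, 1, 2} = 0 := by
  simp only [invVec, Pi.add_apply, mulFun_apply, Y1_apply, Y2_apply, del_apply]
  refine ⟨?_, ?_, ?_, ?_, ?_, ?_, ?_, ?_⟩ <;> ring

lemma invBiv_apply (p q r : Arr) : invBiv p q r ∅ = 0 ∧ invBiv p q r {0} = 0 ∧
    invBiv p q r {1} = 0 ∧ invBiv p q r {2} = 0 ∧ invBiv p q r {0, 1} = ofArr p ∧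
    invBiv p q r {0, 2} = x * ofArr r - y * ofArr q ∧
    invBiv p q r {1, 2} = y * ofArr r + x * ofArr q ∧ invBiv p q r {0, 1, 2} = 0 := by
  simp only [invBiv, Pi.add_apply, mulFun_apply, del12_apply, wedge_Y1_del_apply,
    wedge_Y2_del_apply]
  refine ⟨?_, ?_, ?_, ?_, ?_, ?_, ?_, ?_⟩ <;> ring

/-! ### The differential on invariant cochains -/

lemma coboundary_ofFun (b c ε : ℝ) (f : Arr) :
    coboundaryMap (Lambda8 b c ε) (ofFun (ofArr f)) = invVec 0 (hamOp b c ε f) 0 := by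
  have h := Lambda8_mem b c ε
  apply polyVec_ext <;>
  · simp only [coboundaryMap_apply, schouten_apply_empty h, schouten_apply_0 h, schouten_apply_1 h,
      schouten_apply_2 h, schouten_apply_01 h, schouten_apply_02 h, schouten_apply_12 h,
      schouten_apply_012 h, Lambda8_apply, map_zero, invVec_apply, ofFun_apply, pderiv_x_ofArr,
      pderiv_y_ofArr, pderiv_z_ofArr, ofArr_hamOp]
    try ring

lemma coboundary_invVec (b c ε : ℝ) (f g h : Arr) :
    coboundaryMap (Lambda8 b c ε) (invVec f g h) =
      invBiv (-divOp b c ε 0 f - (2 * ε) • mulZ h) (hamOp b c ε h - (2 * b + c) • h) 0 := by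
  have hΛ := Lambda8_mem b c ε
  apply polyVec_ext <;>
  · simp only [coboundaryMap_apply, schouten_apply_empty hΛ, schouten_apply_0 hΛ,
      schouten_apply_1 hΛ, schouten_apply_2 hΛ, schouten_apply_01 hΛ, schouten_apply_02 hΛ,
      schouten_apply_12 hΛ, schouten_apply_012 hΛ, Lambda8_apply, map_zero, invVec_apply,
      invBiv_apply, Derivation.leibniz, map_add, map_sub, map_neg, map_smul, smul_eq_mul,
      pderiv_x_ofArr, pderiv_y_ofArr, pderiv_z_ofArr, ofArr_divOp, ofArr_hamOp, ofArr_mulZ,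
      smul_eq_C_mul', pderiv_xyz, pderiv_xyz_sq, pderiv_C, map_mul, map_ofNat]
    try ring

lemma coboundary_invBiv (b c ε : ℝ) (p q r : Arr) :
    coboundaryMap (Lambda8 b c ε) (invBiv p q r) =
      mulFun (ofArr (-divOp b c ε (2 * b + c) r)) del123 := by
  have hΛ := Lambda8_mem b c ε
  apply polyVec_ext <;>
  · simp only [coboundaryMap_apply, schouten_apply_empty hΛ, schouten_apply_0 hΛ,
      schouten_apply_1 hΛ, schouten_apply_2 hΛ, schouten_apply_01 hΛ, schouten_apply_02 hΛ,
      schouten_apply_12 hΛ, schouten_apply_012 hΛ, Lambda8_apply, map_zero,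
      invBiv_apply, Derivation.leibniz, map_add, map_sub, map_neg, map_smul, smul_eq_mul,
      pderiv_x_ofArr, pderiv_y_ofArr, pderiv_z_ofArr, ofArr_divOp, ofArr_hamOp, ofArr_mulZ,
      smul_eq_C_mul', pderiv_xyz, pderiv_xyz_sq, pderiv_C, pderiv_one, map_mul, map_ofNat,
      mulFun_apply, del123_apply]
    ring

lemma exists_ofFun_of_invariant {P : PolyVec} (hP : P ∈ ofDegree 0) (hi : rotLie P = 0) :
    ∃ f, P = ofFun (ofArr f) := by
  have hS : ∀ S, rotLie P S = 0 := fun S => congrFun hi S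
  have h := (rotLie_apply P).1
  rw [hS] at h
  obtain ⟨f, hf⟩ := exists_ofArr_of_rot_eq_zero h.symm
  obtain ⟨-, h1, h2, h3⟩ := (mem_ofDegree_iff_of_apply 0 P).1 hP
  refine ⟨f, ?_⟩
  apply polyVec_ext <;> simp [ofFun_apply, h1, h2, h3, hf]

lemma exists_invVec_of_invariant {P : PolyVec} (hP : P ∈ ofDegree 1) (hi : rotLie P = 0) :
    ∃ f g h, P = invVec f g h := by
  have hS : ∀ S, rotLie P S = 0 := fun S => congrFun hi S
  obtain ⟨-, h0, h1, h2, -⟩ := rotLie_apply P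
  rw [hS] at h0 h1 h2
  obtain ⟨f, g, hf, hg⟩ := exists_ofArr_of_planar h0.symm h1.symm
  obtain ⟨h, hh⟩ := exists_ofArr_of_rot_eq_zero h2.symm
  obtain ⟨k0, -, k2, k3⟩ := (mem_ofDegree_iff_of_apply 1 P).1 hP
  refine ⟨f, g, h, ?_⟩
  apply polyVec_ext <;> simp [invVec_apply, k0, k2, k3, hf, hg, hh]

lemma exists_invBiv_of_invariant {P : PolyVec} (hP : P ∈ ofDegree 2) (hi : rotLie P = 0) :
    ∃ p q r, P = invBiv p q r := by
  have hS : ∀ S, rotLie P S = 0 := fun S => congrFun hi S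
  obtain ⟨-, -, -, -, h0, h1, h2, -⟩ := rotLie_apply P
  rw [hS] at h0 h1 h2
  obtain ⟨f, g, hf, hg⟩ := exists_ofArr_of_planar h1.symm h2.symm
  obtain ⟨h, hh⟩ := exists_ofArr_of_rot_eq_zero h0.symm
  obtain ⟨k0, k1, -, k3⟩ := (mem_ofDegree_iff_of_apply 2 P).1 hP
  refine ⟨h, g, f, ?_⟩
  apply polyVec_ext <;> simp [invBiv_apply, k0, k1, k3, hf, hg, hh]

lemma exists_del123_of_invariant {P : PolyVec} (hP : P ∈ ofDegree 3) (hi : rotLie P = 0) :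
    ∃ f, P = mulFun (ofArr f) del123 := by
  have hS : ∀ S, rotLie P S = 0 := fun S => congrFun hi S
  obtain ⟨-, -, -, -, -, -, -, h⟩ := rotLie_apply P
  rw [hS] at h
  obtain ⟨f, hf⟩ := exists_ofArr_of_rot_eq_zero h.symm
  obtain ⟨h0, h1, h2, -⟩ := (mem_ofDegree_iff_of_apply 3 P).1 hP
  refine ⟨f, ?_⟩
  apply polyVec_ext <;> simp [mulFun_apply, del123_apply, h0, h1, h2, hf]

lemma ofFun_mem (f : Series) : ofFun f ∈ ofDegree 0 := by
  simp [mem_ofDegree_iff_of_apply, ofFun_apply]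

lemma invVec_mem (f g h : Arr) : invVec f g h ∈ ofDegree 1 := by
  simp [mem_ofDegree_iff_of_apply, invVec_apply]

lemma invBiv_mem (p q r : Arr) : invBiv p q r ∈ ofDegree 2 := by
  simp [mem_ofDegree_iff_of_apply, invBiv_apply]

lemma del123_mem (f : Series) : mulFun f del123 ∈ ofDegree 3 := by
  simp [mem_ofDegree_iff_of_apply, mulFun_apply, del123_apply]

lemma rot_planar (a b : Arr) : rot (x * ofArr a - y * ofArr b) + (y * ofArr a + x * ofArr b) = 0 ∧
    rot (y * ofArr a + x * ofArr b) - (x * ofArr a - y * ofArr b) = 0 := by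
  simp only [rot, map_add, map_sub, Derivation.leibniz, smul_eq_mul, pderiv_xyz, pderiv_x_ofArr,
    pderiv_y_ofArr]
  constructor <;> ring

lemma rotLie_invVec (f g h : Arr) : rotLie (invVec f g h) = 0 := by
  apply polyVec_ext <;> simp [rotLie_apply, invVec_apply, rot_zero, rot_ofArr, rot_planar]

lemma rotLie_invBiv (p q r : Arr) : rotLie (invBiv p q r) = 0 := by
  apply polyVec_ext <;> simp [rotLie_apply, invBiv_apply, rot_zero, rot_ofArr, rot_planar]

lemma rotLie_del123 (f : Arr) : rotLie (mulFun (ofArr f) del123) = 0 := by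
  apply polyVec_ext <;> simp [rotLie_apply, mulFun_apply, del123_apply, rot_zero, rot_ofArr]

lemma planar_injective {a b a' b' : Arr}
    (h1 : x * ofArr a - y * ofArr b = x * ofArr a' - y * ofArr b')
    (h2 : y * ofArr a + x * ofArr b = y * ofArr a' + x * ofArr b') : a = a' ∧ b = b' := by
  constructor
  · apply ofArr_injective
    apply mul_left_cancel₀ D'_ne_zero
    rw [D']; linear_combination x * h1 + y * h2
  · apply ofArr_injective
    apply mul_left_cancel₀ D'_ne_zero
    rw [D']; linear_combination x * h2 - y * h1

lemma ofFun_ofArr_injective {f g : Arr} (h : ofFun (ofArr f) = ofFun (ofArr g)) : f = g := by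
  have := congrFun h ∅
  rw [(ofFun_apply _).1, (ofFun_apply _).1] at this
  exact ofArr_injective this

lemma invVec_injective {f g h f' g' h' : Arr} (e : invVec f g h = invVec f' g' h') :
    f = f' ∧ g = g' ∧ h = h' := by
  have h0 := congrFun e {0}
  have h1 := congrFun e {1}
  have h2 := congrFun e {2}
  simp only [invVec_apply] at h0 h1 h2
  obtain ⟨h3, h4⟩ := planar_injective h0 h1
  exact ⟨h3, h4, ofArr_injective h2⟩

lemma invBiv_injective {p q r p' q' r' : Arr} (e : invBiv p q r = invBiv p' q' r') :
    p = p' ∧ q = q' ∧ r = r' := by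
  have h0 := congrFun e {0, 2}
  have h1 := congrFun e {1, 2}
  have h2 := congrFun e {0, 1}
  simp only [invBiv_apply] at h0 h1 h2
  obtain ⟨h3, h4⟩ := planar_injective h0 h1
  exact ⟨ofArr_injective h2, h4, h3⟩

lemma del123_ofArr_injective {f g : Arr}
    (h : mulFun (ofArr f) del123 = mulFun (ofArr g) del123) : f = g := by
  have := congrFun h {0, 1, 2}
  simp only [mulFun_apply, del123_apply, mul_one] at this
  exact ofArr_injective this

/-! ### Kernel and cokernel of the invariant differential -/

/-- The eigenvalue of the linear part `(2b + c) z ∂_z - 2b s ∂_s` of `E` on `s ^ p * z ^ q`. -/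
def weight (b c : ℝ) (p q : ℕ) : ℝ := (2 * b + c) * q - 2 * b * p

/-- `s ^ p * z ^ q` is resonant for `E - μ` if it is killed by the linear part of `E - μ`. -/
def Resonant (b c μ : ℝ) (p q : ℕ) : Prop := weight b c p q = μ

lemma weight_succ (b c : ℝ) (p q : ℕ) : weight b c p (q + 1) = weight b c p q + (2 * b + c) := by
  simp only [weight]; push_cast; ring

/-- Multiplication by `z` takes resonances of `E` to those of `E - (2b + c)`. -/
lemma resonant_succ_iff (b c : ℝ) (p q : ℕ) :
    Resonant b c (2 * b + c) p (q + 1) ↔ Resonant b c 0 p q := by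
  rw [Resonant, Resonant, weight_succ, add_eq_right]

section
variable {b c ε μ : ℝ}

lemma hamOp_apply (f : Arr) (p q : ℕ) : hamOp b c ε f p q =
    weight b c p q * f p q - 2 * ε * mulZ (mulZ (derivS f)) p q := by
  have h1 : mulZ (derivZ f) p q = q * f p q := by
    rcases q with _ | q
    · simp
    · rw [mulZ_succ, derivZ_apply]; push_cast; ring
  have h2 : mulS (derivS f) p q = p * f p q := by
    rcases p with _ | p
    · simp
    · rw [mulS_succ, derivS_apply]; push_cast; ring
  simp only [hamOp, LinearMap.sub_apply, LinearMap.smul_apply, LinearMap.comp_apply, Pi.sub_apply,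
    Pi.smul_apply, smul_eq_mul, h1, h2, weight]
  ring

lemma hamOp_apply_zero (f : Arr) (p : ℕ) : hamOp b c ε f p 0 = weight b c p 0 * f p 0 := by
  rw [hamOp_apply]; simp

lemma hamOp_apply_one (f : Arr) (p : ℕ) : hamOp b c ε f p 1 = weight b c p 1 * f p 1 := by
  rw [hamOp_apply, show mulZ (mulZ (derivS f)) p 1 = 0 from rfl]; simp

lemma hamOp_apply_add_two (f : Arr) (p q : ℕ) : hamOp b c ε f p (q + 2) =
    weight b c p (q + 2) * f p (q + 2) - 2 * ε * (p + 1) * f (p + 1) q := by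
  rw [hamOp_apply, mulZ_succ, mulZ_succ, derivS_apply]; ring

lemma hamOp_mulZ (f : Arr) :
    hamOp b c ε (mulZ f) = mulZ (hamOp b c ε f) + (2 * b + c) • mulZ f := by
  funext p q
  simp only [Pi.add_apply, Pi.smul_apply, smul_eq_mul]
  rcases q with _ | _ | _ | q
  · rw [hamOp_apply_zero]; simp
  · rw [hamOp_apply_one, mulZ_succ, mulZ_succ, hamOp_apply_zero, weight_succ]; ring
  · rw [hamOp_apply_add_two, mulZ_succ, mulZ_succ, hamOp_apply_one, weight_succ, mulZ_zero]; ring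
  · rw [hamOp_apply_add_two]
    simp only [mulZ_succ]
    rw [hamOp_apply_add_two, weight_succ]
    ring

lemma hamOp_mulS (f : Arr) : hamOp b c ε (mulS f) =
    mulS (hamOp b c ε f) - (2 * b) • mulS f - (2 * ε) • mulZ (mulZ f) := by
  funext p q
  simp only [Pi.sub_apply, Pi.smul_apply, smul_eq_mul]
  rcases p with _ | p <;> rcases q with _ | _ | q
  · rw [hamOp_apply_zero]; simp
  · rw [hamOp_apply_one, mulZ_succ]; simp
  · rw [hamOp_apply_add_two, mulZ_succ, mulZ_succ]; simp
  · rw [hamOp_apply_zero, mulS_succ, mulS_succ, hamOp_apply_zero]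
    simp only [weight, mulZ_zero]; push_cast; ring
  · rw [hamOp_apply_one, mulS_succ, mulS_succ, hamOp_apply_one, mulZ_succ]
    simp only [weight, mulZ_zero]; push_cast; ring
  · rw [hamOp_apply_add_two, mulS_succ, mulS_succ, mulS_succ, hamOp_apply_add_two, mulZ_succ,
      mulZ_succ]
    simp only [weight]; push_cast; ring

lemma divOp_apply_zero (f : Arr) (q : ℕ) : divOp b c ε μ f 0 q = -(2 * ε * mulZ (mulZ f) 0 q) := by
  simp [divOp_apply]

lemma divOp_apply_succ_zero (f : Arr) (p : ℕ) :
    divOp b c ε μ f (p + 1) 0 = (weight b c p 0 - μ) * f p 0 := by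
  simp only [divOp_apply, Pi.sub_apply, Pi.smul_apply, smul_eq_mul, mulS_succ, mulZ_zero,
    hamOp_apply_zero]
  ring

lemma divOp_apply_succ_one (f : Arr) (p : ℕ) :
    divOp b c ε μ f (p + 1) 1 = (weight b c p 1 - μ) * f p 1 := by
  simp only [divOp_apply, Pi.sub_apply, Pi.smul_apply, smul_eq_mul, mulS_succ, hamOp_apply_one,
    show mulZ (mulZ f) (p + 1) 1 = 0 from rfl]
  ring

lemma divOp_apply_succ_add_two (f : Arr) (p q : ℕ) : divOp b c ε μ f (p + 1) (q + 2) =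
    (weight b c p (q + 2) - μ) * f p (q + 2) - 2 * ε * (p + 2) * f (p + 1) q := by
  simp only [divOp_apply, Pi.sub_apply, Pi.smul_apply, smul_eq_mul, mulS_succ, mulZ_succ,
    hamOp_apply_add_two]
  ring

lemma divOp_mulZ (f : Arr) :
    divOp b c ε (2 * b + c) (mulZ f) = mulZ (divOp b c ε 0 f) := by
  have hc : ∀ g : Arr, mulS (mulZ g) = mulZ (mulS g) := by
    intro g; funext p q; rcases p with _ | p <;> rcases q with _ | q <;> rfl
  rw [divOp_apply, divOp_apply, hamOp_mulZ, add_sub_cancel_right, hc, zero_smul, sub_zero, map_sub,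
    map_smul]

lemma mulZ_injective : Function.Injective mulZ := by
  intro f g h
  funext p q
  exact congrFun (congrFun h p) (q + 1)

/-- The array is supported in a set of exponents. -/
def SuppIn (B : Set (ℕ × ℕ)) (a : Arr) : Prop := ∀ p q, (p, q) ∉ B → a p q = 0

/-- Each weighted degree (`s` of degree two) contains at most one resonant exponent. -/
def UniqueResonance (b c μ : ℝ) : Prop := ∀ p q p' q', Resonant b c μ p q → Resonant b c μ p' q' →
  2 * p + q = 2 * p' + q' → p = p'

/-- For `3b + c ≠ 0` the weight separates the exponents of a given degree. -/
lemma uniqueResonance_of_ne (h : 3 * b + c ≠ 0) : UniqueResonance b c μ := by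
  intro p q p' q' h1 h2 h3
  have h4 : (2 : ℝ) * p + q = 2 * p' + q' := by exact_mod_cast h3
  rw [Resonant, weight] at h1 h2
  have : (2 * (3 * b + c)) * ((p : ℝ) - p') = 0 := by
    linear_combination h2 - h1 + (2 * b + c) * h4
  have h5 := (mul_eq_zero.1 this).resolve_left (mul_ne_zero two_ne_zero h)
  exact_mod_cast sub_eq_zero.1 h5

/-- For `3b + c = 0` the weight is `2b + c` times the degree, and the degree zero has only one
exponent. -/
lemma uniqueResonance_zero (hbc : 2 * b + c ≠ 0) : UniqueResonance b c 0 := by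
  by_cases h : 3 * b + c = 0
  · intro p q p' q' h1 h2 h3
    have key : ∀ p q, Resonant b c 0 p q → p = 0 := by
      intro p q h1
      rw [Resonant, weight] at h1
      have : (2 * b + c) * (q + 2 * p : ℝ) = 0 := by linear_combination h1 + 2 * p * h
      have h5 := (mul_eq_zero.1 this).resolve_left hbc
      have : q + 2 * p = 0 := by exact_mod_cast h5
      omega
    rw [key _ _ h1, key _ _ h2]
  · exact uniqueResonance_of_ne h

/-- For `3b + c = 0` the weight is `2b + c` times the degree, and the degree one has only one
exponent. -/
lemma uniqueResonance_zWeight (hbc : 2 * b + c ≠ 0) : UniqueResonance b c (2 * b + c) := by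
  by_cases h : 3 * b + c = 0
  · intro p q p' q' h1 h2 h3
    have key : ∀ p q, Resonant b c (2 * b + c) p q → p = 0 := by
      intro p q h1
      rw [Resonant, weight] at h1
      have : (2 * b + c) * (q + 2 * p : ℝ) = (2 * b + c) * 1 := by
        linear_combination h1 + 2 * p * h
      have h5 := mul_left_cancel₀ hbc this
      have : q + 2 * p = 1 := by exact_mod_cast h5
      omega
    rw [key _ _ h1, key _ _ h2]
  · exact uniqueResonance_of_ne h

/-- The array with `f p q = A p q + B p (q - 2) * f (p + 1) (q - 2)`, where the second term is
absent for `q < 2`. Up to the names of the coefficients, this is the recursion along a degree that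
the equations for `hamOp` and `divOp` impose. -/
def lineRec (A B : Arr) : ℕ → ℕ → ℝ
  | p, 0 => A p 0
  | p, 1 => A p 1
  | p, q + 2 => A p (q + 2) + B p q * lineRec A B (p + 1) q

/-- The cokernel of `E - μ` is spanned by the resonant monomials: `g` is the sum of an array `a`
with resonant support and an element of the range. -/
lemma exists_hamOp_solution (b c ε μ : ℝ) (g : Arr) : ∃ a f, SuppIn {x | Resonant b c μ x.1 x.2} a ∧
    g = a + (hamOp b c ε f - μ • f) := by
  -- The equation is solved by recursion on the exponent of `z`; at resonant exponents
  -- the division by zero returns the value zero.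
  let F : Arr := lineRec (fun p q => g p q / (weight b c p q - μ))
    (fun p q => 2 * ε * (p + 1) / (weight b c p (q + 2) - μ))
  refine ⟨g - (hamOp b c ε F - μ • F), F, ?_, by abel⟩
  intro p q hq
  have hne : weight b c p q - μ ≠ 0 := sub_ne_zero.2 hq
  simp only [Pi.sub_apply, Pi.smul_apply, smul_eq_mul]
  rcases q with _ | _ | q
  · have h : F p 0 = g p 0 / (weight b c p 0 - μ) := by simp only [F, lineRec]
    rw [hamOp_apply_zero]
    rw [eq_div_iff hne] at h
    linear_combination -h
  · have h : F p 1 = g p 1 / (weight b c p 1 - μ) := by simp only [F, lineRec]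
    rw [hamOp_apply_one]
    rw [eq_div_iff hne] at h
    linear_combination -h
  · have h : F p (q + 2) = (g p (q + 2) + 2 * ε * (p + 1) * F (p + 1) q) /
        (weight b c p (q + 2) - μ) := by
      simp only [F, lineRec]; ring
    rw [hamOp_apply_add_two]
    rw [eq_div_iff hne] at h
    linear_combination -h

/-- The entry `f p q` of a solution of `E f = μ f` vanishes if none of the exponents from which the
recursion along its degree reaches `(p, q)` is resonant. -/
lemma eq_zero_of_hamOp_apply_of_not_resonant {f : Arr} (q : ℕ) : ∀ p,
    (∀ i, 2 * i ≤ q → ¬ Resonant b c μ (p + i) (q - 2 * i) ∧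
      hamOp b c ε f (p + i) (q - 2 * i) = μ * f (p + i) (q - 2 * i)) → f p q = 0 := by
  induction q using Nat.strong_induction_on with
  | _ q ih =>
    intro p h
    obtain ⟨h1, h2⟩ := h 0 (by omega)
    rw [Nat.mul_zero, Nat.sub_zero, Nat.add_zero] at h1 h2
    have hne : weight b c p q - μ ≠ 0 := sub_ne_zero.2 h1
    refine (mul_eq_zero.1 (?_ : (weight b c p q - μ) * f p q = 0)).resolve_left hne
    rcases q with _ | _ | q
    · rw [hamOp_apply_zero] at h2; linear_combination h2
    · rw [hamOp_apply_one] at h2; linear_combination h2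
    · rw [hamOp_apply_add_two, ih q (by omega) (p + 1)] at h2
      · linear_combination h2
      · intro i hi
        have := h (i + 1) (by omega)
        rwa [show p + (i + 1) = p + 1 + i by omega,
          show q + 2 - 2 * (i + 1) = q - 2 * i by omega] at this

/-- The entry that couples to a resonant exponent vanishes. -/
lemma eq_zero_of_line {f : Arr} (hU : UniqueResonance b c μ) {p q : ℕ}
    (hr : Resonant b c μ p (q + 2))
    (h : ∀ p q, ¬ Resonant b c μ p q → hamOp b c ε f p q = μ * f p q) : f (p + 1) q = 0 := by
  refine eq_zero_of_hamOp_apply_of_not_resonant (b := b) (c := c) (ε := ε) (μ := μ) q (p + 1)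
    fun i hi => ?_
  have hn : ¬ Resonant b c μ (p + 1 + i) (q - 2 * i) := fun h' => by
    have := hU _ _ _ _ hr h' (by omega)
    omega
  exact ⟨hn, h _ _ hn⟩

/-- The resonant monomials are linearly independent in the cokernel of `E - μ`. -/
lemma eq_zero_of_suppIn_resonant (hU : UniqueResonance b c μ) {a f : Arr}
    (ha : SuppIn {x | Resonant b c μ x.1 x.2} a) (h : a = hamOp b c ε f - μ • f) : a = 0 := by
  funext p q
  by_cases hr : Resonant b c μ p q
  · have hv : a p q = hamOp b c ε f p q - μ * f p q := congrFun (congrFun h p) q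
    have hr' : weight b c p q = μ := hr
    rw [hv]
    rcases q with _ | _ | q
    · rw [hamOp_apply_zero, hr', sub_self]; rfl
    · rw [hamOp_apply_one, hr', sub_self]; rfl
    · rw [hamOp_apply_add_two, hr', eq_zero_of_line (ε := ε) (f := f) hU hr]
      · rw [mul_zero, sub_zero, sub_self]; rfl
      · intro p q hn
        have h0 := ha p q hn
        have hv : a p q = hamOp b c ε f p q - μ * f p q := congrFun (congrFun h p) q
        rw [h0] at hv
        exact (sub_eq_zero.1 hv.symm)
  · exact ha p q hr

/-- An eigenvector of `E` is determined by its resonant coefficients. -/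
lemma eq_zero_of_hamOp_eq {f : Arr} (h : hamOp b c ε f = μ • f)
    (hr : ∀ p q, Resonant b c μ p q → f p q = 0) : f = 0 := by
  have h' : ∀ p q, hamOp b c ε f p q = μ * f p q := fun p q => congrFun (congrFun h p) q
  have key : ∀ q p, f p q = 0 := by
    intro q
    induction q using Nat.strong_induction_on with
    | _ q ih =>
      intro p
      by_cases hp : Resonant b c μ p q
      · exact hr p q hp
      have hne : weight b c p q - μ ≠ 0 := sub_ne_zero.2 hp
      refine (mul_eq_zero.1 (?_ : (weight b c p q - μ) * f p q = 0)).resolve_left hne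
      have h2 := h' p q
      rcases q with _ | _ | q
      · rw [hamOp_apply_zero] at h2; linear_combination h2
      · rw [hamOp_apply_one] at h2; linear_combination h2
      · rw [hamOp_apply_add_two, ih q (by omega) (p + 1)] at h2
        linear_combination h2
  funext p q
  exact key q p

/-- The resonant coefficients of an eigenvector of `E` can be prescribed. -/
lemma exists_hamOp_eq (ε : ℝ) (hU : UniqueResonance b c μ) (r : Arr) :
    ∃ f, hamOp b c ε f = μ • f ∧ ∀ p q, Resonant b c μ p q → f p q = r p q := by
  classical
  let F : Arr := lineRec (fun p q => if Resonant b c μ p q then r p q else 0)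
    (fun p q => if Resonant b c μ p (q + 2) then 0 else
      2 * ε * (p + 1) / (weight b c p (q + 2) - μ))
  have hres : ∀ p q, Resonant b c μ p q → F p q = r p q := by
    rintro p (_ | _ | q) h <;> simp [F, lineRec, h]
  have hnr : ∀ p q, ¬ Resonant b c μ p q → hamOp b c ε F p q = μ * F p q := by
    intro p q hq
    have hne : weight b c p q - μ ≠ 0 := sub_ne_zero.2 hq
    rcases q with _ | _ | q
    · have h : F p 0 = 0 := by simp [F, lineRec, hq]
      rw [hamOp_apply_zero, h, mul_zero, mul_zero]
    · have h : F p 1 = 0 := by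
        rw [zero_add] at hq
        simp [F, lineRec, hq]
      rw [hamOp_apply_one, h, mul_zero, mul_zero]
    · have h : F p (q + 2) = 2 * ε * (p + 1) * F (p + 1) q / (weight b c p (q + 2) - μ) := by
        simp only [F, lineRec, if_neg hq]; ring
      rw [hamOp_apply_add_two]
      rw [eq_div_iff hne] at h
      linear_combination h
  refine ⟨F, ?_, hres⟩
  funext p q
  simp only [Pi.smul_apply, smul_eq_mul]
  by_cases hr : Resonant b c μ p q
  · have hr' : weight b c p q = μ := hr
    rcases q with _ | _ | q
    · rw [hamOp_apply_zero, hr']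
    · rw [hamOp_apply_one, hr']
    · rw [hamOp_apply_add_two, hr', eq_zero_of_line (ε := ε) hU hr hnr, mul_zero, sub_zero]
  · exact hnr p q hr

/-- The exponents of the monomials spanning a complement of the range of `divOp`: `s · s ^ p z ^ q`
for the resonant `(p, q)`, and `z ^ k` if there is no resonance in degree `k - 2`. -/
def divSupp (b c μ : ℝ) : Set (ℕ × ℕ) := {x | (∃ p, x.1 = p + 1 ∧ Resonant b c μ p x.2) ∨
  (x.1 = 0 ∧ ∀ p q, Resonant b c μ p q → 2 * p + q + 2 ≠ x.2)}

lemma succ_mem_divSupp {p q : ℕ} : (p + 1, q) ∈ divSupp b c μ ↔ Resonant b c μ p q := by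
  constructor
  · rintro (⟨p', h, h'⟩ | ⟨h, -⟩)
    · rwa [Nat.succ_injective h]
    · exact absurd h (Nat.succ_ne_zero p)
  · exact fun h => Or.inl ⟨p, rfl, h⟩

lemma zero_mem_divSupp {k : ℕ} : (0, k) ∈ divSupp b c μ ↔
    ∀ p q, Resonant b c μ p q → 2 * p + q + 2 ≠ k := by
  constructor
  · rintro (⟨p', h, h'⟩ | ⟨-, h⟩)
    · exact absurd h.symm (Nat.succ_ne_zero p')
    · exact h
  · exact fun h => Or.inr ⟨rfl, h⟩

/-- The degree of `s ^ p z ^ q` contains a resonant monomial `s ^ p' z ^ q'` with `p ≤ p'`. -/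
def BelowResonance (b c μ : ℝ) (p q : ℕ) : Prop :=
  ∃ p' q', Resonant b c μ p' q' ∧ 2 * p' + q' = 2 * p + q ∧ p ≤ p'

lemma BelowResonance.of_succ {p q : ℕ} (h : BelowResonance b c μ (p + 1) q) :
    BelowResonance b c μ p (q + 2) := by
  obtain ⟨p', q', h1, h2, h3⟩ := h
  exact ⟨p', q', h1, by omega, by omega⟩

/-- The cokernel of `divOp` is spanned by the monomials with exponents in `divSupp`. -/
lemma exists_divOp_solution (b c μ : ℝ) (hε : ε ≠ 0) (g : Arr) : ∃ a f,
    SuppIn (divSupp b c μ) a ∧ g = a + divOp b c ε μ f := by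
  classical
  -- Below the resonance in a given degree the equation is solved by recursion on the exponent
  -- of `s`, above it by recursion on the exponent of `z`.
  let F : ℕ → ℕ → ℝ := fun p => Nat.rec (fun q => -g 0 (q + 2) / (2 * ε))
    (fun p ih q => ((weight b c p (q + 2) - μ) * ih (q + 2) - g (p + 1) (q + 2)) /
      (2 * ε * (p + 2))) p
  let G : Arr := lineRec (fun p q => g (p + 1) q / (weight b c p q - μ))
    (fun p q => 2 * ε * (p + 2) / (weight b c p (q + 2) - μ))
  have hF0 : ∀ q, F 0 q = -g 0 (q + 2) / (2 * ε) := fun q => rfl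
  have hF : ∀ p q, F (p + 1) q = ((weight b c p (q + 2) - μ) * F p (q + 2) - g (p + 1) (q + 2)) /
      (2 * ε * (p + 2)) := fun p q => rfl
  let f : Arr := fun p q => if BelowResonance b c μ p q then F p q else G p q
  have hfF : ∀ p q, BelowResonance b c μ p q → f p q = F p q := fun p q h => if_pos h
  have hfG : ∀ p q, ¬ BelowResonance b c μ p q → f p q = G p q := fun p q h => if_neg h
  refine ⟨g - divOp b c ε μ f, f, ?_, by abel⟩
  intro P Q hPQ
  simp only [Pi.sub_apply]
  rw [sub_eq_zero]
  rcases P with _ | p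
  · rw [zero_mem_divSupp] at hPQ
    push Not at hPQ
    obtain ⟨p', q', h1, rfl⟩ := hPQ
    rw [divOp_apply_zero, mulZ_succ, mulZ_succ, hfF _ _ ⟨p', q', h1, by omega, by omega⟩, hF0]
    field_simp
  · rw [succ_mem_divSupp] at hPQ
    by_cases hb : BelowResonance b c μ p Q
    · obtain ⟨p', q', h1, h2, h3⟩ := id hb
      have hne : p ≠ p' := by
        rintro rfl
        exact hPQ (by rwa [show Q = q' by omega])
      obtain ⟨q, rfl⟩ : ∃ q, Q = q + 2 := ⟨Q - 2, by omega⟩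
      rw [divOp_apply_succ_add_two, hfF _ _ hb, hfF _ _ ⟨p', q', h1, by omega, by omega⟩, hF]
      field_simp
      ring
    · have hne : weight b c p Q - μ ≠ 0 := sub_ne_zero.2 hPQ
      rcases Q with _ | _ | q
      · have h : G p 0 = g (p + 1) 0 / (weight b c p 0 - μ) := by simp only [G, lineRec]
        rw [divOp_apply_succ_zero, hfG _ _ hb]
        rw [eq_div_iff hne] at h
        linear_combination -h
      · have h : G p 1 = g (p + 1) 1 / (weight b c p 1 - μ) := by simp only [G, lineRec]
        rw [divOp_apply_succ_one, hfG _ _ hb]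
        rw [eq_div_iff hne] at h
        linear_combination -h
      · have h : G p (q + 2) = (g (p + 1) (q + 2) + 2 * ε * (p + 2) * G (p + 1) q) /
            (weight b c p (q + 2) - μ) := by
          simp only [G, lineRec]; ring
        rw [divOp_apply_succ_add_two, hfG _ _ hb, hfG _ _ fun h' => hb h'.of_succ]
        rw [eq_div_iff hne] at h
        linear_combination -h

/-- The operator `divOp` is injective, and the monomials with exponents in `divSupp` are linearly
independent in its cokernel. -/
lemma eq_zero_of_divOp_eq (hε : ε ≠ 0) (hU : UniqueResonance b c μ) {a f : Arr}
    (ha : SuppIn (divSupp b c μ) a) (h : a = divOp b c ε μ f) : a = 0 ∧ f = 0 := by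
  have hv : ∀ p q, a p q = divOp b c ε μ f p q := fun p q => congrFun (congrFun h p) q
  have hbelow : ∀ p q, BelowResonance b c μ p q → f p q = 0 := by
    intro p
    induction p with
    | zero =>
      rintro q ⟨p', q', h1, h2, -⟩
      have h3 := hv 0 (q + 2)
      rw [ha, divOp_apply_zero, mulZ_succ, mulZ_succ] at h3
      · have : (2 * ε) * f 0 q = 0 := by linear_combination h3
        exact (mul_eq_zero.1 this).resolve_left (mul_ne_zero two_ne_zero hε)
      · rw [zero_mem_divSupp]
        exact fun h => h p' q' h1 (by omega)
    | succ p ih =>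
      intro q hb
      have h3 := hv (p + 1) (q + 2)
      rw [ha, divOp_apply_succ_add_two, ih _ hb.of_succ] at h3
      · have : (2 * ε * (p + 2)) * f (p + 1) q = 0 := by linear_combination h3
        exact (mul_eq_zero.1 this).resolve_left
          (mul_ne_zero (mul_ne_zero two_ne_zero hε) (by positivity))
      · rw [succ_mem_divSupp]
        intro hr
        obtain ⟨p', q', h1, h2, h4⟩ := hb
        have := hU _ _ _ _ hr h1 (by omega)
        omega
  have hall : ∀ q p, f p q = 0 := by
    intro q
    induction q using Nat.strong_induction_on with
    | _ q ih =>
      intro p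
      by_cases hb : BelowResonance b c μ p q
      · exact hbelow p q hb
      have hr : ¬ Resonant b c μ p q := fun hr => hb ⟨p, q, hr, rfl, le_rfl⟩
      have hne : weight b c p q - μ ≠ 0 := sub_ne_zero.2 hr
      refine (mul_eq_zero.1 (?_ : (weight b c p q - μ) * f p q = 0)).resolve_left hne
      have h3 := hv (p + 1) q
      rw [ha _ _ (by rwa [succ_mem_divSupp])] at h3
      rcases q with _ | _ | q
      · rw [h3, divOp_apply_succ_zero]
      · rw [h3, divOp_apply_succ_one]
      · rw [divOp_apply_succ_add_two, ih q (by omega)] at h3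
        linear_combination -h3
  have hf : f = 0 := by funext p q; exact hall q p
  exact ⟨by rw [h, hf, map_zero], hf⟩

/-- The exponents of the monomials `m` for which `m ∂₁₂` is a basis element of the second
cohomology: `s · s ^ p z ^ q` for the resonances `(p, q)` of `E`, and `z ^ k` if `k - 2` is not the
degree of a resonance of `E` and `k - 1` is not that of a resonance `s ^ p` of `E - (2b + c)`. -/
def bivSupp (b c : ℝ) : Set (ℕ × ℕ) := {x | (∃ p, x.1 = p + 1 ∧ Resonant b c 0 p x.2) ∨
  (x.1 = 0 ∧ (∀ p q, Resonant b c 0 p q → 2 * p + q + 2 ≠ x.2) ∧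
    ∀ p, Resonant b c (2 * b + c) p 0 → 2 * p + 1 ≠ x.2)}

/-- Multiplication by `z` identifies `bivSupp` with the exponents of `divSupp` divisible by `z`. -/
lemma mem_bivSupp_iff (P Q : ℕ) :
    (P, Q) ∈ bivSupp b c ↔ (P, Q + 1) ∈ divSupp b c (2 * b + c) := by
  rcases P with _ | p
  · rw [zero_mem_divSupp]
    constructor
    · rintro (⟨p', h, -⟩ | ⟨-, h1, h2⟩)
      · exact absurd h.symm (Nat.succ_ne_zero p')
      · rintro p (_ | q) hr
        · have := h2 p hr
          dsimp only at this
          omega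
        · have := h1 p q ((resonant_succ_iff b c p q).1 hr)
          dsimp only at this
          omega
    · intro h
      refine Or.inr ⟨rfl, fun p q hr => ?_, fun p hr => ?_⟩
      · have := h p (q + 1) ((resonant_succ_iff b c p q).2 hr)
        dsimp only
        omega
      · have := h p 0 hr
        dsimp only
        omega
  · rw [succ_mem_divSupp, resonant_succ_iff]
    constructor
    · rintro (⟨p', h, h'⟩ | ⟨h, -⟩)
      · rwa [Nat.succ_injective h]
      · exact absurd h (Nat.succ_ne_zero p)
    · exact fun h => Or.inl ⟨p, rfl, h⟩

lemma divOp_of_hamOp_eq {h : Arr} (hh : hamOp b c ε h = μ • h) :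
    divOp b c ε μ h = -((2 * ε) • mulZ (mulZ h)) := by
  rw [divOp_apply, hh, sub_self, map_zero, zero_sub]

/-- After multiplication by `z`, the `∂₁₂`-coefficient of the coboundary of `f Y₁ + h ∂₃` depends
only on `h - z f`. -/
lemma mulZ_vector_coboundary {f h : Arr} (hh : hamOp b c ε h = (2 * b + c) • h) :
    mulZ (-divOp b c ε 0 f - (2 * ε) • mulZ h) = divOp b c ε (2 * b + c) (h - mulZ f) := by
  rw [map_sub, map_neg, map_smul, map_sub, divOp_of_hamOp_eq hh, divOp_mulZ]
  abel

/-- An invariant cocycle `f Y₁ + g Y₂ + h ∂₃` is `f (Y₁ + Y₃) + g Y₂` with `E f = 0`. -/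
lemma eq_mulZ_of_cocycle (hε : ε ≠ 0) (hbc : 2 * b + c ≠ 0) {f h : Arr}
    (h1 : -divOp b c ε 0 f - (2 * ε) • mulZ h = 0) (h2 : hamOp b c ε h - (2 * b + c) • h = 0) :
    h = mulZ f ∧ hamOp b c ε f = 0 := by
  have hh := sub_eq_zero.1 h2
  have h3 := mulZ_vector_coboundary (f := f) hh
  rw [h1, map_zero] at h3
  have h4 := (eq_zero_of_divOp_eq hε (uniqueResonance_zWeight hbc) (fun _ _ _ => rfl) h3).2
  have h5 := sub_eq_zero.1 h4
  refine ⟨h5, mulZ_injective ?_⟩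
  rw [h5, hamOp_mulZ, add_eq_right] at hh
  rw [hh, map_zero]

/-- The invariant bivector fields supported in `bivSupp` and in the resonances of `E - (2b + c)` are
linearly independent modulo coboundaries. -/
lemma eq_zero_of_bivector_coboundary (hε : ε ≠ 0) (hbc : 2 * b + c ≠ 0) {a a' f h : Arr}
    (ha : SuppIn (bivSupp b c) a) (ha' : SuppIn {x | Resonant b c (2 * b + c) x.1 x.2} a')
    (h1 : a = -divOp b c ε 0 f - (2 * ε) • mulZ h)
    (h2 : a' = hamOp b c ε h - (2 * b + c) • h) : a = 0 ∧ a' = 0 := by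
  have h3 := eq_zero_of_suppIn_resonant (uniqueResonance_zWeight hbc) ha' h2
  rw [h3] at h2
  have h4 := mulZ_vector_coboundary (f := f) (sub_eq_zero.1 h2.symm)
  rw [← h1] at h4
  refine ⟨mulZ_injective ?_, h3⟩
  rw [map_zero]
  refine (eq_zero_of_divOp_eq hε (uniqueResonance_zWeight hbc) ?_ h4).1
  rintro p (_ | q) hq
  · rfl
  · exact ha p q fun h => hq ((mem_bivSupp_iff p q).1 h)

lemma exists_mulZ {f : Arr} (h : ∀ p, f p 0 = 0) : ∃ g, f = mulZ g := by
  refine ⟨fun p q => f p (q + 1), ?_⟩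
  funext p q
  rcases q with _ | q
  · exact h p
  · rfl

/-- The invariant bivector fields supported in `bivSupp` and in the resonances of `E - (2b + c)`
span the `p ∂₁₂ + q Y₂ ∧ ∂₃` modulo coboundaries. -/
lemma exists_bivector_solution (hε : ε ≠ 0) (hbc : 2 * b + c ≠ 0) (p q : Arr) :
    ∃ a a' f h, SuppIn (bivSupp b c) a ∧ SuppIn {x | Resonant b c (2 * b + c) x.1 x.2} a' ∧
      p = a + (-divOp b c ε 0 f - (2 * ε) • mulZ h) ∧
      q = a' + (hamOp b c ε h - (2 * b + c) • h) := by
  -- After `q` is reduced with `h₀`, the product of the remaining `∂₁₂`-coefficient with `z` is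
  -- `A + T u`. There is room for a further `h₁` with `E h₁ = (2b + c) h₁`, which is chosen so that
  -- `u - h₁` has no terms `s ^ p`, hence is divisible by `z`.
  obtain ⟨a', h₀, ha', hq⟩ := exists_hamOp_solution b c ε (2 * b + c) q
  obtain ⟨A, u, hA, hp⟩ := exists_divOp_solution b c (2 * b + c) hε
    (mulZ (p + (2 * ε) • mulZ h₀))
  have hv : ∀ P, 0 = A P 0 + divOp b c ε (2 * b + c) u P 0 := fun P => congrFun (congrFun hp P) 0
  have hcol : ∀ P, A P 0 = 0 ∧ (¬ Resonant b c (2 * b + c) P 0 → u P 0 = 0) := by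
    have hA0 : ∀ P, A P 0 = 0 := by
      rintro (_ | P)
      · have := hv 0
        rw [divOp_apply_zero] at this
        simpa using this.symm
      · by_cases hr : Resonant b c (2 * b + c) P 0
        · have h3 := hv (P + 1)
          have hr' : weight b c P 0 = 2 * b + c := hr
          rw [divOp_apply_succ_zero, hr', sub_self, zero_mul, add_zero] at h3
          exact h3.symm
        · exact hA _ _ (by rwa [succ_mem_divSupp])
    refine fun P => ⟨hA0 P, fun hr => ?_⟩
    have h3 := hv (P + 1)
    rw [hA0, zero_add, divOp_apply_succ_zero] at h3
    exact (mul_eq_zero.1 h3.symm).resolve_left (sub_ne_zero.2 hr)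
  obtain ⟨h₁, hh₁, hr₁⟩ := exists_hamOp_eq ε (uniqueResonance_zWeight hbc) u
  obtain ⟨a, rfl⟩ := exists_mulZ fun P => (hcol P).1
  obtain ⟨f, hf⟩ := exists_mulZ (f := u - h₁) fun P => by
    simp only [Pi.sub_apply]
    by_cases hr : Resonant b c (2 * b + c) P 0
    · rw [hr₁ _ _ hr, sub_self]
    · have h3 : hamOp b c ε h₁ P 0 = (2 * b + c) * h₁ P 0 := congrFun (congrFun hh₁ P) 0
      rw [hamOp_apply_zero] at h3
      have h4 : (weight b c P 0 - (2 * b + c)) * h₁ P 0 = 0 := by linear_combination h3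
      rw [(hcol P).2 hr, (mul_eq_zero.1 h4).resolve_left (sub_ne_zero.2 hr), sub_zero]
  refine ⟨a, a', -f, h₀ + h₁, ?_, ha', ?_, ?_⟩
  · intro P Q hPQ
    rw [mem_bivSupp_iff] at hPQ
    exact hA P (Q + 1) hPQ
  · have hu : u = mulZ f + h₁ := by rw [← hf]; abel
    have hp' : p + (2 * ε) • mulZ h₀ = a + (divOp b c ε 0 f - (2 * ε) • mulZ h₁) := by
      apply mulZ_injective
      rw [hp, hu, map_add (divOp b c ε _), divOp_mulZ, divOp_of_hamOp_eq hh₁, map_add mulZ a,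
        map_sub mulZ, map_smul mulZ, sub_eq_add_neg]
    rw [map_neg, map_add, smul_add, neg_neg, eq_sub_of_add_eq hp']
    abel
  · rw [map_add, hh₁, hq, smul_add]
    abel

end

/-! ### Formal sums -/

section
variable {ι : Type}

/-- The entrywise sum `∑ cᵢ vᵢ` of a family of coefficient arrays. -/
def arrSum (c : ι → ℝ) (v : ι → Arr) : Arr := fun p q => ∑ᶠ i, c i * v i p q

/-- Every entry is nonzero in finitely many members of the family only. -/
def LocFinite (v : ι → Arr) : Prop := ∀ p q, {i | v i p q ≠ 0}.Finite

/-- Every coefficient is nonzero in finitely many members of the family only. -/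
def PolyLocFinite (r : ι → PolyVec) : Prop := ∀ S e, {i | coeff e (r i S) ≠ 0}.Finite

lemma finite_support_mul {c f : ι → ℝ} (h : {i | f i ≠ 0}.Finite) :
    (Function.support fun i => c i * f i).Finite :=
  h.subset fun _ hi => right_ne_zero_of_mul hi

lemma finsum_mul_add {c f g : ι → ℝ} (hf : {i | f i ≠ 0}.Finite) (hg : {i | g i ≠ 0}.Finite) :
    ∑ᶠ i, c i * (f i + g i) = ∑ᶠ i, c i * f i + ∑ᶠ i, c i * g i := by
  rw [← finsum_add_distrib (finite_support_mul hf) (finite_support_mul hg)]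
  simp only [mul_add]

lemma finsum_mul_const_mul (a : ℝ) (c f : ι → ℝ) :
    ∑ᶠ i, c i * (a * f i) = a * ∑ᶠ i, c i * f i := by
  rw [← smul_eq_mul a, smul_finsum]
  exact finsum_congr fun i => by rw [smul_eq_mul]; ring

lemma coeff_formalSum (c : ι → ℝ) (r : ι → PolyVec) (S : Finset (Fin 3)) (e : Fin 3 →₀ ℕ) :
    coeff e (formalSum c r S) = ∑ᶠ i, c i * coeff e (r i S) := rfl

lemma polyVec_coeff_ext {P Q : PolyVec} (h : ∀ S e, coeff e (P S) = coeff e (Q S)) : P = Q := by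
  funext S
  ext e
  exact h S e

lemma PolyLocFinite.add {r r' : ι → PolyVec} (h : PolyLocFinite r) (h' : PolyLocFinite r') :
    PolyLocFinite fun i => r i + r' i := by
  intro S e
  refine ((h S e).union (h' S e)).subset fun i hi => ?_
  by_contra hn
  simp only [Set.mem_union, Set.mem_ofPred_eq, not_or, not_not] at hn
  refine hi ?_
  change coeff e (r i S + r' i S) = 0
  rw [map_add, hn.1, hn.2, add_zero]

lemma formalSum_add {r r' : ι → PolyVec} (h : PolyLocFinite r) (h' : PolyLocFinite r')
    (c : ι → ℝ) : formalSum c (fun i => r i + r' i) = formalSum c r + formalSum c r' := by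
  apply polyVec_coeff_ext
  intro S e
  rw [Pi.add_apply, map_add, coeff_formalSum, coeff_formalSum, coeff_formalSum,
    ← finsum_mul_add (h S e) (h' S e)]
  simp only [Pi.add_apply, map_add]

lemma formalSum_sub {r : ι → PolyVec} (h : PolyLocFinite r) (c c' : ι → ℝ) :
    formalSum (c - c') r = formalSum c r - formalSum c' r := by
  apply polyVec_coeff_ext
  intro S e
  rw [Pi.sub_apply, map_sub, coeff_formalSum, coeff_formalSum, coeff_formalSum,
    ← finsum_sub_distrib (finite_support_mul (h S e)) (finite_support_mul (h S e))]
  simp only [Pi.sub_apply, sub_mul]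

lemma LocFinite.coeff_ofArr {v : ι → Arr} (h : LocFinite v) (e : Fin 3 →₀ ℕ) :
    {i | coeff e (ofArr (v i)) ≠ 0}.Finite := by
  refine (h (e 0 / 2 + e 1 / 2) (e 2)).subset fun i hi hn => hi ?_
  rw [FormalPoisson.coeff_ofArr, hn, mul_zero, ite_self]

lemma coeff_ofArr_arrSum (c : ι → ℝ) (v : ι → Arr) (e : Fin 3 →₀ ℕ) :
    coeff e (ofArr (arrSum c v)) = ∑ᶠ i, c i * coeff e (ofArr (v i)) := by
  simp only [coeff_ofArr]
  split_ifs
  · rw [finsum_mul_const_mul]; rfl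
  · simp

lemma LocFinite.mulFun {v : ι → Arr} (h : LocFinite v) (P : PolyVec) :
    PolyLocFinite fun i => mulFun (ofArr (v i)) P := by
  intro S e
  refine ((Finset.HasAntidiagonal.antidiagonal e).finite_toSet.biUnion fun x _ =>
    h.coeff_ofArr x.1).subset fun i hi => ?_
  by_contra hn
  simp only [Set.mem_iUnion, Set.mem_ofPred_eq, not_exists, not_not] at hn
  refine hi ?_
  change coeff e (ofArr (v i) * P S) = 0
  rw [coeff_mul]
  exact Finset.sum_eq_zero fun x hx => by rw [hn x hx, zero_mul]

lemma formalSum_mulFun {v : ι → Arr} (h : LocFinite v) (c : ι → ℝ) (P : PolyVec) :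
    formalSum c (fun i => mulFun (ofArr (v i)) P) = mulFun (ofArr (arrSum c v)) P := by
  apply polyVec_coeff_ext
  intro S e
  rw [coeff_formalSum, mulFun_apply, coeff_mul]
  simp only [mulFun_apply, coeff_mul, coeff_ofArr_arrSum, Finset.mul_sum]
  rw [finsum_sum_comm]
  · refine Finset.sum_congr rfl fun x _ => ?_
    rw [mul_comm, ← finsum_mul_const_mul]
    exact finsum_congr fun i => by ring
  · intro x _
    refine (h.coeff_ofArr x.1).subset fun i hi => ?_
    exact left_ne_zero_of_mul (right_ne_zero_of_mul hi)

lemma ofFun_eq_mulFun (f : Series) : ofFun f = mulFun f (ofFun 1) := by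
  apply polyVec_ext <;> simp [mulFun_apply, ofFun_apply]

lemma formalSum_ofFun {v : ι → Arr} (h : LocFinite v) (c : ι → ℝ) :
    formalSum c (fun i => ofFun (ofArr (v i))) = ofFun (ofArr (arrSum c v)) := by
  rw [ofFun_eq_mulFun, ← formalSum_mulFun h]
  simp only [← ofFun_eq_mulFun]

lemma LocFinite.invVec {f g h : ι → Arr} (hf : LocFinite f) (hg : LocFinite g)
    (hh : LocFinite h) : PolyLocFinite fun i => invVec (f i) (g i) (h i) :=
  ((hf.mulFun _).add (hg.mulFun _)).add (hh.mulFun _)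

lemma formalSum_invVec {f g h : ι → Arr} (hf : LocFinite f) (hg : LocFinite g)
    (hh : LocFinite h) (c : ι → ℝ) : formalSum c (fun i => invVec (f i) (g i) (h i)) =
      invVec (arrSum c f) (arrSum c g) (arrSum c h) := by
  simp only [FormalPoisson.invVec]
  rw [formalSum_add ((hf.mulFun _).add (hg.mulFun _)) (hh.mulFun _),
    formalSum_add (hf.mulFun _) (hg.mulFun _), formalSum_mulFun hf, formalSum_mulFun hg,
    formalSum_mulFun hh]

lemma LocFinite.invBiv {f g h : ι → Arr} (hf : LocFinite f) (hg : LocFinite g)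
    (hh : LocFinite h) : PolyLocFinite fun i => invBiv (f i) (g i) (h i) :=
  ((hf.mulFun _).add (hg.mulFun _)).add (hh.mulFun _)

lemma formalSum_invBiv {f g h : ι → Arr} (hf : LocFinite f) (hg : LocFinite g)
    (hh : LocFinite h) (c : ι → ℝ) : formalSum c (fun i => invBiv (f i) (g i) (h i)) =
      invBiv (arrSum c f) (arrSum c g) (arrSum c h) := by
  simp only [FormalPoisson.invBiv]
  rw [formalSum_add ((hf.mulFun _).add (hg.mulFun _)) (hh.mulFun _),
    formalSum_add (hf.mulFun _) (hg.mulFun _), formalSum_mulFun hf, formalSum_mulFun hg,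
    formalSum_mulFun hh]

lemma mulFun_zero (P : PolyVec) : mulFun 0 P = 0 := by
  funext S
  exact zero_mul _

lemma invVec_zero : invVec 0 0 0 = 0 := by
  simp [FormalPoisson.invVec, mulFun_zero]

lemma invBiv_zero : invBiv 0 0 0 = 0 := by
  simp [FormalPoisson.invBiv, mulFun_zero]

lemma mem_cocycles {Λ P : PolyVec} {k : ℕ} :
    P ∈ cocycles Λ k ↔ P ∈ ofDegree k ∧ coboundaryMap Λ P = 0 := Iff.rfl

/-- A criterion for formal bases of cohomology in terms of cocycles and coboundaries. -/
lemma isFormalBasis_of {Λ : PolyVec} {k : ℕ} {r : ι → PolyVec} (hr : PolyLocFinite r)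
    (hcoc : ∀ c : ι → ℝ, formalSum c r ∈ cocycles Λ k)
    (hsurj : ∀ Q ∈ cocycles Λ k, ∃ c : ι → ℝ, Q - formalSum c r ∈ coboundaries Λ k)
    (hinj : ∀ c : ι → ℝ, formalSum c r ∈ coboundaries Λ k → c = 0) : IsFormalBasis Λ k r where
  locallyFinite := hr
  isCocycle := hcoc
  bijective := by
    constructor
    · intro c c' h
      have h' := (Submodule.Quotient.eq _).1 h
      change formalSum c r - formalSum c' r ∈ coboundaries Λ k at h'
      refine sub_eq_zero.1 (hinj _ ?_)
      rw [formalSum_sub hr]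
      exact h'
    · intro X
      obtain ⟨⟨Q, hQ⟩, rfl⟩ := Submodule.Quotient.mk_surjective _ X
      obtain ⟨c, hc⟩ := hsurj Q hQ
      refine ⟨c, ((Submodule.Quotient.eq _).2 ?_).symm⟩
      exact hc

/-- The family of arrays whose member `i` has the entry one at the exponents which `emb` sends to
`loc i`, and zero elsewhere. With `emb` the identity these are monomials; the inclusions into a sum
type give the components of a family whose members are monomials of two kinds. -/
def deltaFamily {X : Type} [DecidableEq X] (emb : ℕ × ℕ → X) (loc : ι → X) : ι → Arr :=
  fun i p q => if loc i = emb (p, q) then 1 else 0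

section
variable {X : Type} [DecidableEq X] {emb : ℕ × ℕ → X} {loc : ι → X}

lemma deltaFamily_locFinite (hloc : Function.Injective loc) :
    LocFinite (deltaFamily emb loc) := by
  intro p q
  refine Set.Subsingleton.finite fun i hi j hj => hloc ?_
  have h1 : loc i = emb (p, q) := by
    by_contra h; exact hi (if_neg h)
  have h2 : loc j = emb (p, q) := by
    by_contra h; exact hj (if_neg h)
  rw [h1, h2]

lemma arrSum_deltaFamily (hloc : Function.Injective loc) (c : ι → ℝ) {i : ι} {p q : ℕ}
    (h : loc i = emb (p, q)) : arrSum c (deltaFamily emb loc) p q = c i := by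
  rw [arrSum, finsum_eq_single _ i]
  · rw [deltaFamily, if_pos h, mul_one]
  · intro j hj
    rw [deltaFamily, if_neg, mul_zero]
    intro h'
    exact hj (hloc (h'.trans h.symm))

lemma arrSum_deltaFamily_suppIn (c : ι → ℝ) :
    SuppIn {x | ∃ i, loc i = emb x} (arrSum c (deltaFamily emb loc)) := by
  intro p q h
  rw [arrSum]
  refine finsum_eq_zero_of_forall_eq_zero fun i => ?_
  rw [deltaFamily, if_neg, mul_zero]
  exact fun h' => h ⟨i, h'⟩

end

/-- The array of the monomial `s ^ p * z ^ q`. -/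
def mono (x : ℕ × ℕ) : Arr := fun p q => if x = (p, q) then 1 else 0

lemma deltaFamily_id (loc : ι → ℕ × ℕ) : deltaFamily id loc = fun i => mono (loc i) := rfl

lemma hamOp_arrSum (b c ε : ℝ) {v : ι → Arr} (hv : LocFinite v) (a : ι → ℝ) :
    hamOp b c ε (arrSum a v) = arrSum a fun i => hamOp b c ε (v i) := by
  have hf : ∀ (r : ℝ) p q, {i | r * v i p q ≠ 0}.Finite := fun r p q =>
    (hv p q).subset fun i hi => right_ne_zero_of_mul hi
  funext p q
  rcases q with _ | _ | q
  · simp only [arrSum, hamOp_apply_zero, finsum_mul_const_mul]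
  · simp only [arrSum, zero_add, hamOp_apply_one, finsum_mul_const_mul]
  · simp only [arrSum, hamOp_apply_add_two]
    simp only [sub_eq_add_neg, ← neg_mul]
    rw [finsum_mul_add (hf _ _ _) (hf _ _ _), finsum_mul_const_mul, finsum_mul_const_mul]

lemma arrSum_zero (a : ι → ℝ) : arrSum a (fun _ => 0) = 0 := by
  funext p q
  simp [arrSum]

lemma mulZ_arrSum (v : ι → Arr) (a : ι → ℝ) :
    mulZ (arrSum a v) = arrSum a fun i => mulZ (v i) := by
  funext p q
  rcases q with _ | q
  · simp [arrSum]
  · rfl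

lemma LocFinite.mulZ {v : ι → Arr} (hv : LocFinite v) : LocFinite fun i => mulZ (v i) := by
  rintro p (_ | q)
  · simp
  · exact hv p q

lemma locFinite_zero : LocFinite fun _ : ι => (0 : Arr) := fun _ _ => by simp

lemma LocFinite.elim {κ : Type} {v : ι → Arr} {w : κ → Arr} (hv : LocFinite v)
    (hw : LocFinite w) : LocFinite (Sum.elim v w) := by
  intro p q
  refine (((hv p q).image Sum.inl).union ((hw p q).image Sum.inr)).subset ?_
  rintro (i | i) hi
  · exact Or.inl ⟨i, hi, rfl⟩
  · exact Or.inr ⟨i, hi, rfl⟩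

lemma arrSum_elim_zero_left {κ : Type} (a : ι ⊕ κ → ℝ) (w : κ → Arr) :
    arrSum a (Sum.elim (fun _ => 0) w) = arrSum (fun i => a (Sum.inr i)) w := by
  funext p q
  simp only [arrSum]
  refine (finsum_congr fun i => ?_).trans (finsum_mem_range
    (f := fun i => a i * Sum.elim (fun _ => 0) w i p q) Sum.inr_injective)
  rcases i with i | i <;> simp

lemma arrSum_elim_zero_right {κ : Type} (a : ι ⊕ κ → ℝ) (v : ι → Arr) :
    arrSum a (Sum.elim v (fun _ => 0)) = arrSum (fun i => a (Sum.inl i)) v := by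
  funext p q
  simp only [arrSum]
  refine (finsum_congr fun i => ?_).trans (finsum_mem_range
    (f := fun i => a i * Sum.elim v (fun _ => 0) i p q) Sum.inl_injective)
  rcases i with i | i <;> simp

end

/-! ### Bases from enumerations of resonances -/

/-- The map `loc` enumerates the elements of `B`. -/
structure Enumerates {ι X : Type} (loc : ι → X) (B : Set X) : Prop where
  injective : Function.Injective loc
  mem_iff : ∀ x, x ∈ B ↔ ∃ i, loc i = x

/-- The resonant exponents of `E - μ`. -/
def resSet (b c μ : ℝ) : Set (ℕ × ℕ) := {x | Resonant b c μ x.1 x.2}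

/-- The `w i` are homogeneous elements of the kernel of `E`, with leading monomials the resonant
monomials of exponents `loc i`. -/
structure IsKernelFamily (b c ε : ℝ) {ι : Type} (loc : ι → ℕ × ℕ) (w : ι → Arr) : Prop where
  enumerates : Enumerates loc (resSet b c 0)
  hamOp_eq_zero : ∀ i, hamOp b c ε (w i) = 0
  homogeneous : ∀ i p q, w i p q ≠ 0 → 2 * p + q = 2 * (loc i).1 + (loc i).2
  leading : ∀ i, w i (loc i).1 (loc i).2 = 1

section
variable {ι : Type} {b c ε : ℝ}

lemma IsKernelFamily.locFinite {loc : ι → ℕ × ℕ} {w : ι → Arr} (h : IsKernelFamily b c ε loc w) :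
    LocFinite w := by
  intro p q
  have hfin : (Set.Iic (2 * p + q) ×ˢ Set.Iic (2 * p + q) : Set (ℕ × ℕ)).Finite :=
    (Set.finite_Iic _).prod (Set.finite_Iic _)
  refine (hfin.preimage (f := loc) h.enumerates.injective.injOn).subset fun i hi => ?_
  have := h.homogeneous i p q hi
  simp only [Set.mem_preimage, Set.mem_prod, Set.mem_Iic]
  omega

lemma IsKernelFamily.arrSum_apply {loc : ι → ℕ × ℕ} {w : ι → Arr}
    (h : IsKernelFamily b c ε loc w) (hbc : 2 * b + c ≠ 0) (a : ι → ℝ) (i : ι) :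
    arrSum a w (loc i).1 (loc i).2 = a i := by
  rw [arrSum, finsum_eq_single _ i, h.leading, mul_one]
  intro j hj
  by_contra hne
  have h1 := h.homogeneous j _ _ (right_ne_zero_of_mul hne)
  have hi : Resonant b c 0 (loc i).1 (loc i).2 := (h.enumerates.mem_iff _).2 ⟨i, rfl⟩
  have hj' : Resonant b c 0 (loc j).1 (loc j).2 := (h.enumerates.mem_iff _).2 ⟨j, rfl⟩
  have h2 := uniqueResonance_zero hbc _ _ _ _ hi hj' h1
  refine hj (h.enumerates.injective (Prod.ext h2.symm (by omega)))

lemma IsKernelFamily.hamOp_arrSum {loc : ι → ℕ × ℕ} {w : ι → Arr}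
    (h : IsKernelFamily b c ε loc w) (a : ι → ℝ) : hamOp b c ε (arrSum a w) = 0 := by
  rw [FormalPoisson.hamOp_arrSum b c ε h.locFinite]
  simp only [h.hamOp_eq_zero, arrSum_zero]

lemma IsKernelFamily.eq_arrSum {loc : ι → ℕ × ℕ} {w : ι → Arr}
    (h : IsKernelFamily b c ε loc w) (hbc : 2 * b + c ≠ 0) {f : Arr} (hf : hamOp b c ε f = 0) :
    f = arrSum (fun i => f (loc i).1 (loc i).2) w := by
  refine sub_eq_zero.1 (eq_zero_of_hamOp_eq (b := b) (c := c) (ε := ε) (μ := 0) ?_ ?_)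
  · rw [map_sub, hf, h.hamOp_arrSum, sub_zero, zero_smul]
  · intro p q hr
    obtain ⟨i, hi⟩ := (h.enumerates.mem_iff (p, q)).1 hr
    have := h.arrSum_apply hbc (fun i => f (loc i).1 (loc i).2) i
    rw [hi] at this
    simp only [Pi.sub_apply]
    rw [this, sub_self]

/-- The formal Casimir functions: the kernel of `E`. -/
lemma IsKernelFamily.isFormalBasis_zero {loc : ι → ℕ × ℕ} {w : ι → Arr}
    (h : IsKernelFamily b c ε loc w) (hc : c ≠ 0) (hbc : 2 * b + c ≠ 0) :
    IsFormalBasis (Lambda8 b c ε) 0 fun i => ofFun (ofArr (w i)) := by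
  have hlf : PolyLocFinite fun i => ofFun (ofArr (w i)) := by
    have := h.locFinite.mulFun (ofFun 1)
    simpa only [← ofFun_eq_mulFun] using this
  apply isFormalBasis_of hlf
  · intro a
    rw [formalSum_ofFun h.locFinite]
    rw [mem_cocycles, coboundary_ofFun, h.hamOp_arrSum, invVec_zero]
    exact ⟨ofFun_mem _, rfl⟩
  · intro Q hQ
    obtain ⟨Q₀, hQ₀, hi, hex⟩ := exists_invariant_cocycle ε hc hQ
    obtain ⟨f, rfl⟩ := exists_ofFun_of_invariant hQ₀.1 hi
    have hd : coboundaryMap (Lambda8 b c ε) (ofFun (ofArr f)) = 0 := hQ₀.2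
    rw [coboundary_ofFun] at hd
    have hf : hamOp b c ε f = 0 := by
      rw [← invVec_zero] at hd
      exact (invVec_injective hd).2.1
    refine ⟨fun i => f (loc i).1 (loc i).2, ?_⟩
    rw [formalSum_ofFun h.locFinite, ← h.eq_arrSum hbc hf]
    exact hex
  · intro a ha
    rw [formalSum_ofFun h.locFinite] at ha
    have h0 : ofFun (ofArr (arrSum a w)) = 0 := ha
    have h1 : arrSum a w = 0 := by
      apply ofFun_ofArr_injective
      rw [h0, map_zero, ofFun, Pi.single_zero]
    funext i
    rw [← h.arrSum_apply hbc a i, h1]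
    rfl

/-- The first cohomology: `Y₂` times the cokernel of `E`, and the kernel of `E` times `Y₁ + Y₃`. -/
lemma IsKernelFamily.isFormalBasis_one {loc : ι → ℕ × ℕ} {w : ι → Arr}
    (h : IsKernelFamily b c ε loc w) (hc : c ≠ 0) (hbc : 2 * b + c ≠ 0) (hε : ε ≠ 0) :
    IsFormalBasis (Lambda8 b c ε) 1 (Sum.elim
      (fun i => mulFun (ofArr (mono (loc i))) Y2) (fun i => mulFun (ofArr (w i)) (Y1 + Y3))) := by
  set V : ι ⊕ ι → Arr := Sum.elim (fun _ => 0) w with hV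
  set U : ι ⊕ ι → Arr := Sum.elim (fun i => mono (loc i)) (fun _ => 0) with hU
  have hr : (Sum.elim (fun i => mulFun (ofArr (mono (loc i))) Y2)
      (fun i => mulFun (ofArr (w i)) (Y1 + Y3))) = fun i => invVec (V i) (U i) (mulZ (V i)) := by
    funext i
    rcases i with i | i
    · apply polyVec_ext <;>
        simp [V, U, mulFun_apply, invVec_apply, Y2_apply] <;> ring
    · apply polyVec_ext <;>
        simp [V, U, mulFun_apply, invVec_apply, Y1_apply, Y3_apply, ofArr_mulZ] <;> ring
  have hUl : LocFinite U :=
    (deltaFamily_locFinite (emb := id) h.enumerates.injective).elim locFinite_zero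
  have hVl : LocFinite V := locFinite_zero.elim h.locFinite
  have hsum : ∀ a : ι ⊕ ι → ℝ, formalSum a (fun i => invVec (V i) (U i) (mulZ (V i))) =
      invVec (arrSum (fun i => a (Sum.inr i)) w)
        (arrSum (fun i => a (Sum.inl i)) (deltaFamily id loc))
        (mulZ (arrSum (fun i => a (Sum.inr i)) w)) := by
    intro a
    rw [formalSum_invVec hVl hUl hVl.mulZ, ← mulZ_arrSum, hV, hU, arrSum_elim_zero_left,
      arrSum_elim_zero_right, deltaFamily_id]
  rw [hr]
  have hres : {x | ∃ i, loc i = id x} = {x : ℕ × ℕ | Resonant b c 0 x.1 x.2} :=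
    Set.ext fun x => (h.enumerates.mem_iff x).symm
  apply isFormalBasis_of (hVl.invVec hUl hVl.mulZ)
  · intro a
    have hk := h.hamOp_arrSum fun i => a (Sum.inr i)
    rw [hsum, mem_cocycles, coboundary_invVec, hamOp_mulZ,
      divOp_of_hamOp_eq (by rw [hk, zero_smul]), hk, neg_neg, sub_self,
      map_zero, zero_add, sub_self, invBiv_zero]
    exact ⟨invVec_mem _ _ _, rfl⟩
  · intro Q hQ
    obtain ⟨Q₀, hQ₀, hi, hex⟩ := exists_invariant_cocycle ε hc hQ
    obtain ⟨f, g, k, rfl⟩ := exists_invVec_of_invariant hQ₀.1 hi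
    have hd := (mem_cocycles.1 hQ₀).2
    rw [coboundary_invVec, ← invBiv_zero] at hd
    obtain ⟨h1, h2, -⟩ := invBiv_injective hd
    obtain ⟨rfl, hf⟩ := eq_mulZ_of_cocycle hε hbc h1 h2
    obtain ⟨a, u, ha, rfl⟩ := exists_hamOp_solution b c ε 0 g
    refine ⟨Sum.elim (fun i => a (loc i).1 (loc i).2) (fun i => f (loc i).1 (loc i).2), ?_⟩
    have haa : arrSum (fun i => a (loc i).1 (loc i).2) (deltaFamily id loc) = a := by
      funext p q
      by_cases hpq : (p, q) ∈ {x | ∃ i, loc i = id x}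
      · obtain ⟨i, hi⟩ := id hpq
        rw [arrSum_deltaFamily h.enumerates.injective _ hi, hi]
        rfl
      · rw [arrSum_deltaFamily_suppIn _ _ _ hpq]
        rw [hres] at hpq
        exact (ha _ _ hpq).symm
    rw [hsum]
    simp only [Sum.elim_inl, Sum.elim_inr]
    rw [← h.eq_arrSum hbc hf, haa]
    have hex2 : invVec f (a + (hamOp b c ε u - (0 : ℝ) • u)) (mulZ f) - invVec f a (mulZ f) =
        coboundaryMap (Lambda8 b c ε) (ofFun (ofArr u)) := by
      rw [coboundary_ofFun, invVec, invVec, invVec, zero_smul, sub_zero, map_add, map_zero,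
        mulFun_zero, mulFun_zero]
      funext S
      simp only [Pi.add_apply, Pi.sub_apply, mulFun_apply, Pi.zero_apply]
      ring
    have := Submodule.add_mem _ hex
      (Submodule.mem_map_of_mem (f := coboundaryMap (Lambda8 b c ε)) (ofFun_mem (ofArr u)))
    rw [← hex2, sub_add_sub_cancel] at this
    exact this
  · intro a ha
    rw [hsum] at ha
    obtain ⟨R, hR, hi, hd⟩ := exists_invariant_primitive ε hc ha (rotLie_invVec _ _ _)
    obtain ⟨u, rfl⟩ := exists_ofFun_of_invariant hR hi
    rw [coboundary_ofFun] at hd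
    obtain ⟨h1, h2, -⟩ := invVec_injective hd
    have h3 := eq_zero_of_suppIn_resonant (f := u) (ε := ε) (uniqueResonance_zero hbc)
      (hres ▸ arrSum_deltaFamily_suppIn _) (by rw [zero_smul, sub_zero, h2])
    funext i
    rcases i with i | i
    · rw [← arrSum_deltaFamily (emb := id) h.enumerates.injective (fun i => a (Sum.inl i))
        (i := i) (p := (loc i).1) (q := (loc i).2) rfl, h3]
      rfl
    · rw [← h.arrSum_apply hbc (fun i => a (Sum.inr i)) i, ← h1]
      rfl

lemma eq_arrSum_deltaFamily {X : Type} [DecidableEq X] {emb : ℕ × ℕ → X} {loc : ι → X}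
    (hloc : Function.Injective loc) {d : Arr} (hd : SuppIn {x | ∃ i, loc i = emb x} d)
    {a : ι → ℝ} (ha : ∀ i p q, loc i = emb (p, q) → a i = d p q) :
    d = arrSum a (deltaFamily emb loc) := by
  funext p q
  by_cases hpq : (p, q) ∈ {x | ∃ i, loc i = emb x}
  · obtain ⟨i, hi⟩ := id hpq
    rw [arrSum_deltaFamily hloc _ hi, ha i p q hi]
  · rw [arrSum_deltaFamily_suppIn _ _ _ hpq, hd _ _ hpq]

/-- The third cohomology: the cokernel of `T_{2b+c}`. -/
lemma isFormalBasis_three {loc : ι → ℕ × ℕ} (h : Enumerates loc (divSupp b c (2 * b + c)))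
    (hc : c ≠ 0) (hbc : 2 * b + c ≠ 0) (hε : ε ≠ 0) :
    IsFormalBasis (Lambda8 b c ε) 3 fun i => mulFun (ofArr (mono (loc i))) del123 := by
  have hlf : LocFinite (deltaFamily id loc) := deltaFamily_locFinite h.injective
  have hsum : ∀ a : ι → ℝ, formalSum a (fun i => mulFun (ofArr (mono (loc i))) del123) =
      mulFun (ofArr (arrSum a (deltaFamily id loc))) del123 :=
    fun a => formalSum_mulFun hlf a del123
  have hset : {x | ∃ i, loc i = id x} = divSupp b c (2 * b + c) :=
    Set.ext fun x => (h.mem_iff x).symm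
  refine isFormalBasis_of (r := fun i => mulFun (ofArr (mono (loc i))) del123) (hlf.mulFun del123)
    ?_ ?_ ?_
  · intro a
    rw [hsum, mem_cocycles]
    refine ⟨del123_mem _, ?_⟩
    have := coboundaryMap_mem b c ε (del123_mem (ofArr (arrSum a (deltaFamily id loc))))
    funext S
    exact this S fun hS => absurd (S.card_le_univ) (by simp [hS])
  · intro Q hQ
    obtain ⟨Q₀, hQ₀, hi, hex⟩ := exists_invariant_cocycle ε hc hQ
    obtain ⟨g, rfl⟩ := exists_del123_of_invariant hQ₀.1 hi
    obtain ⟨d, f, hd, rfl⟩ := exists_divOp_solution b c (2 * b + c) hε g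
    refine ⟨fun i => d (loc i).1 (loc i).2, ?_⟩
    rw [hsum, ← eq_arrSum_deltaFamily h.injective (hset ▸ hd) fun i p q hi => by rw [hi]; rfl]
    have := Submodule.add_mem _ hex
      (Submodule.mem_map_of_mem (f := coboundaryMap (Lambda8 b c ε)) (invBiv_mem 0 0 (-f)))
    rw [coboundary_invBiv, map_neg (divOp b c ε _), neg_neg] at this
    convert this using 1
    funext S
    simp only [Pi.add_apply, Pi.sub_apply, mulFun_apply, map_add]
    ring
  · intro a ha
    rw [hsum] at ha
    obtain ⟨R, hR, hi, hd⟩ := exists_invariant_primitive ε hc ha (rotLie_del123 _)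
    obtain ⟨p, q, r, rfl⟩ := exists_invBiv_of_invariant hR hi
    rw [coboundary_invBiv] at hd
    have h1 := del123_ofArr_injective hd
    rw [← map_neg] at h1
    have h3 := (eq_zero_of_divOp_eq hε (uniqueResonance_zWeight hbc)
      (hset ▸ arrSum_deltaFamily_suppIn _) h1.symm).1
    funext i
    rw [← arrSum_deltaFamily (emb := id) h.injective a (i := i) (p := (loc i).1)
      (q := (loc i).2) rfl, h3]
    rfl

/-- The bivector field `s ^ p z ^ q ∂₁₂` or `s ^ p z ^ q Y₂ ∧ ∂₃`. -/
def bivMono : (ℕ × ℕ) ⊕ (ℕ × ℕ) → PolyVec :=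
  Sum.elim (fun x => mulFun (ofArr (mono x)) del12)
    (fun x => mulFun (ofArr (mono x)) (wedge Y2 (del 2)))

/-- The second cohomology: the cokernel of `(f, h) ↦ (-(T₀ f + 2 ε z h), E h - (2b + c) h)`.
There is no contribution of `Y₁ ∧ ∂₃`, as `divOp` is injective. -/
lemma isFormalBasis_two {loc : ι → (ℕ × ℕ) ⊕ (ℕ × ℕ)}
    (h : Enumerates loc (Sum.inl '' bivSupp b c ∪ Sum.inr '' resSet b c (2 * b + c)))
    (hc : c ≠ 0) (hbc : 2 * b + c ≠ 0) (hε : ε ≠ 0) :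
    IsFormalBasis (Lambda8 b c ε) 2 fun i => bivMono (loc i) := by
  set V : ι → Arr := deltaFamily Sum.inl loc with hV
  set U : ι → Arr := deltaFamily Sum.inr loc with hU
  have hVl : LocFinite V := deltaFamily_locFinite h.injective
  have hUl : LocFinite U := deltaFamily_locFinite h.injective
  have hr : (fun i => bivMono (loc i)) = fun i => invBiv (V i) (U i) 0 := by
    funext i
    rcases hi : loc i with x | x
    · have h1 : V i = mono x := by funext p q; simp [V, deltaFamily, hi, mono]
      have h2 : U i = 0 := by funext p q; simp [U, deltaFamily, hi]
      rw [h1, h2, invBiv, map_zero, mulFun_zero, mulFun_zero, add_zero, add_zero]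
      rfl
    · have h1 : U i = mono x := by funext p q; simp [U, deltaFamily, hi, mono]
      have h2 : V i = 0 := by funext p q; simp [V, deltaFamily, hi]
      rw [h1, h2, invBiv, map_zero, mulFun_zero, mulFun_zero, add_zero, zero_add]
      rfl
  have hsum : ∀ a : ι → ℝ, formalSum a (fun i => invBiv (V i) (U i) 0) =
      invBiv (arrSum a V) (arrSum a U) 0 := by
    intro a
    rw [formalSum_invBiv hVl hUl locFinite_zero, arrSum_zero]
  have hsetV : {x | ∃ i, loc i = Sum.inl x} = bivSupp b c := by
    ext x
    rw [Set.mem_ofPred_eq, ← h.mem_iff]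
    simp
  have hsetU : {x | ∃ i, loc i = Sum.inr x} = resSet b c (2 * b + c) := by
    ext x
    rw [Set.mem_ofPred_eq, ← h.mem_iff]
    simp
  rw [hr]
  apply isFormalBasis_of (hVl.invBiv hUl locFinite_zero)
  · intro a
    rw [hsum, mem_cocycles, coboundary_invBiv, map_zero, neg_zero, map_zero, mulFun_zero]
    exact ⟨invBiv_mem _ _ _, rfl⟩
  · intro Q hQ
    obtain ⟨Q₀, hQ₀, hi, hex⟩ := exists_invariant_cocycle ε hc hQ
    obtain ⟨p, q, r, rfl⟩ := exists_invBiv_of_invariant hQ₀.1 hi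
    have hd := (mem_cocycles.1 hQ₀).2
    have h0 : divOp b c ε (2 * b + c) r = 0 := by
      rw [coboundary_invBiv, ← mulFun_zero del123, ← map_zero ofArr] at hd
      exact neg_eq_zero.1 (del123_ofArr_injective hd)
    obtain ⟨-, rfl⟩ := eq_zero_of_divOp_eq (a := 0) hε (uniqueResonance_zWeight hbc)
      (fun _ _ _ => rfl) h0.symm
    obtain ⟨d, d', f, k, hd1, hd2, rfl, rfl⟩ := exists_bivector_solution hε hbc p q
    refine ⟨fun i => Sum.elim (fun x => d x.1 x.2) (fun x => d' x.1 x.2) (loc i), ?_⟩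
    rw [hsum, ← eq_arrSum_deltaFamily h.injective (d := d) (hsetV ▸ hd1)
      (fun i p q hi => by rw [hi]; rfl), ← eq_arrSum_deltaFamily h.injective (d := d')
      (hsetU ▸ hd2) (fun i p q hi => by rw [hi]; rfl)]
    have := Submodule.add_mem _ hex
      (Submodule.mem_map_of_mem (f := coboundaryMap (Lambda8 b c ε)) (invVec_mem f 0 k))
    rw [coboundary_invVec] at this
    convert this using 1
    funext S
    simp only [invBiv, Pi.add_apply, Pi.sub_apply, mulFun_apply, map_add, map_zero, zero_mul]
    ring
  · intro a ha
    rw [hsum] at ha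
    obtain ⟨R, hR, hi, hd⟩ := exists_invariant_primitive ε hc ha (rotLie_invBiv _ _ _)
    obtain ⟨f, g, k, rfl⟩ := exists_invVec_of_invariant hR hi
    rw [coboundary_invVec] at hd
    obtain ⟨h1, h2, -⟩ := invBiv_injective hd
    have hV' : SuppIn (bivSupp b c) (arrSum a V) := hsetV ▸ arrSum_deltaFamily_suppIn _
    have hU' : SuppIn (resSet b c (2 * b + c)) (arrSum a U) := hsetU ▸ arrSum_deltaFamily_suppIn _
    obtain ⟨h3, h4⟩ := eq_zero_of_bivector_coboundary hε hbc hV' hU' h1.symm h2.symm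
    funext i
    rcases hi : loc i with x | x
    · rw [← arrSum_deltaFamily (emb := Sum.inl) h.injective a (i := i) (p := x.1) (q := x.2) hi,
        h3]
      rfl
    · rw [← arrSum_deltaFamily (emb := Sum.inr) h.injective a (i := i) (p := x.1) (q := x.2) hi,
        h4]
      rfl

end

/-! ### Monomials and Casimir functions -/

lemma mono_succ_left (p q : ℕ) : mono (p + 1, q) = mulS (mono (p, q)) := by
  funext P Q
  rcases P with _ | P
  · simp [mono]
  · simp [mono]

lemma mono_succ_right (p q : ℕ) : mono (p, q + 1) = mulZ (mono (p, q)) := by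
  funext P Q
  rcases Q with _ | Q
  · simp [mono]
  · simp [mono]

lemma ofArr_mono_zero : ofArr (mono (0, 0)) = 1 := by
  ext e
  rw [coeff_ofArr, coeff_one]
  by_cases he : e = 0
  · subst he; simp [mono]
  · rw [if_neg he]
    split_ifs with h
    · obtain ⟨⟨i, hi⟩, ⟨j, hj⟩⟩ := h
      rw [mono, if_neg, mul_zero]
      intro h0
      rw [Prod.mk.injEq] at h0
      apply he
      ext l
      fin_cases l <;> simp <;> omega
    · rfl

lemma ofArr_mono (p q : ℕ) : ofArr (mono (p, q)) = D' ^ p * z ^ q := by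
  induction p with
  | zero =>
    induction q with
    | zero => rw [ofArr_mono_zero, pow_zero, pow_zero, one_mul]
    | succ q ih => rw [mono_succ_right, ofArr_mulZ, ih]; ring
  | succ p ih => rw [mono_succ_left, ofArr_mulS, ih]; ring

/-- The array of `(s + κ z²) ^ p * z ^ q`. -/
def casArr (κ : ℝ) : ℕ → ℕ → Arr
  | 0, q => mono (0, q)
  | p + 1, q => mulS (casArr κ p q) + κ • mulZ (mulZ (casArr κ p q))

lemma ofArr_casArr (κ : ℝ) (p q : ℕ) : ofArr (casArr κ p q) = (D' + κ • z ^ 2) ^ p * z ^ q := by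
  induction p with
  | zero => rw [casArr, ofArr_mono, pow_zero, pow_zero]
  | succ p ih =>
    rw [casArr, map_add, map_smul, ofArr_mulS, ofArr_mulZ, ofArr_mulZ, ih, pow_succ,
      smul_eq_C_mul', smul_eq_C_mul']
    ring

lemma mulZ_mulZ_ne_zero {f : Arr} {p q : ℕ} (h : mulZ (mulZ f) p q ≠ 0) :
    ∃ q', q = q' + 2 ∧ f p q' ≠ 0 := by
  rcases q with _ | _ | q
  · exact absurd rfl h
  · exact absurd rfl h
  · exact ⟨q, rfl, h⟩

lemma casArr_homogeneous (κ : ℝ) (p q : ℕ) : ∀ P Q, casArr κ p q P Q ≠ 0 →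
    2 * P + Q = 2 * p + q ∧ P ≤ p := by
  induction p with
  | zero =>
    intro P Q h
    by_cases h' : (0, q) = (P, Q)
    · rw [Prod.mk.injEq] at h'; omega
    · exact absurd (if_neg h') h
  | succ p ih =>
    intro P Q h
    by_cases h1 : mulS (casArr κ p q) P Q = 0
    · have h2 : mulZ (mulZ (casArr κ p q)) P Q ≠ 0 := by
        intro h2
        apply h
        simp only [casArr, Pi.add_apply, Pi.smul_apply, h1, h2, smul_zero, add_zero]
      obtain ⟨Q', rfl, h3⟩ := mulZ_mulZ_ne_zero h2
      have := ih _ _ h3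
      omega
    · rcases P with _ | P
      · exact absurd rfl h1
      · have := ih _ _ h1
        omega

lemma casArr_leading (κ : ℝ) (p q : ℕ) : casArr κ p q p q = 1 := by
  induction p with
  | zero => exact if_pos rfl
  | succ p ih =>
    have h : mulZ (mulZ (casArr κ p q)) (p + 1) q = 0 := by
      by_contra h
      obtain ⟨q', rfl, h3⟩ := mulZ_mulZ_ne_zero h
      have := casArr_homogeneous κ _ _ _ _ h3
      omega
    simp only [casArr, Pi.add_apply, Pi.smul_apply, h, smul_zero, add_zero, mulS_succ, ih]

section
variable {b c ε : ℝ}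

lemma hamOp_mono_zero (b c ε : ℝ) (q : ℕ) :
    hamOp b c ε (mono (0, q)) = weight b c 0 q • mono (0, q) := by
  funext P Q
  have h : ∀ Q, mono (0, q) (P + 1) Q = 0 := fun Q => if_neg (by simp)
  have h' : ∀ Q, weight b c P Q * mono (0, q) P Q = weight b c 0 q * mono (0, q) P Q := by
    intro Q
    by_cases hq : (0, q) = (P, Q)
    · rw [Prod.mk.injEq] at hq
      rw [← hq.1, ← hq.2]
    · rw [mono, if_neg hq, mul_zero, mul_zero]
  simp only [Pi.smul_apply, smul_eq_mul]
  rcases Q with _ | _ | Q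
  · rw [hamOp_apply_zero, h']
  · rw [zero_add, hamOp_apply_one, h']
  · rw [hamOp_apply_add_two, h', h, mul_zero, sub_zero]

/-- For `κ (3b + c) = ε` the function `s + κ z²` is an eigenvector of the derivation `E`, with the
same eigenvalue as `s`. -/
lemma hamOp_casArr {κ : ℝ} (hκ : κ * (3 * b + c) = ε) (p q : ℕ) :
    hamOp b c ε (casArr κ p q) = weight b c p q • casArr κ p q := by
  induction p with
  | zero => exact hamOp_mono_zero b c ε q
  | succ p ih =>
    simp only [casArr, map_add, map_smul, hamOp_mulS, hamOp_mulZ, ih]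
    have hw : weight b c (p + 1) q = weight b c p q - 2 * b := by
      simp only [weight]; push_cast; ring
    rw [hw]
    funext P Q
    simp only [Pi.add_apply, Pi.sub_apply, Pi.smul_apply, smul_eq_mul]
    linear_combination 2 * mulZ (mulZ (casArr κ p q)) P Q * hκ

lemma isKernelFamily_casArr {ι : Type} {loc : ι → ℕ × ℕ} (h : Enumerates loc (resSet b c 0))
    {κ : ℝ} (hκ : κ * (3 * b + c) = ε) :
    IsKernelFamily b c ε loc fun i => casArr κ (loc i).1 (loc i).2 where
  enumerates := h
  hamOp_eq_zero i := by
    have hr : weight b c (loc i).1 (loc i).2 = 0 := (h.mem_iff (loc i)).2 ⟨i, rfl⟩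
    rw [hamOp_casArr hκ, hr, zero_smul]
  homogeneous i p q hne := (casArr_homogeneous κ _ _ _ _ hne).1
  leading i := casArr_leading κ _ _

/-- If the resonances of `E` are enumerated by `loc` and no power of `s` is resonant for
`E - (2b + c)`, the resonances of `E - (2b + c)` are those of `E` shifted by one power of `z`. -/
lemma resonant_zWeight_iff {ι : Type} {loc : ι → ℕ × ℕ} (h : Enumerates loc (resSet b c 0))
    (h0 : ∀ p, ¬ Resonant b c (2 * b + c) p 0) (p q : ℕ) :
    Resonant b c (2 * b + c) p q ↔ ∃ i, loc i = (p, q - 1) ∧ q = (loc i).2 + 1 := by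
  rcases q with _ | q
  · simp [h0]
  · rw [resonant_succ_iff, show Resonant b c 0 p q ↔ (p, q) ∈ resSet b c 0 from Iff.rfl, h.mem_iff]
    constructor
    · rintro ⟨i, hi⟩
      exact ⟨i, hi, by rw [hi]⟩
    · rintro ⟨i, hi, -⟩
      exact ⟨i, hi⟩

/-- The basis monomials in degree two: from each resonance `s ^ p z ^ q` of `E` one obtains
`s ^ (p + 1) z ^ q ∂₁₂` and `s ^ p z ^ (q + 1) Y₂ ∧ ∂₃`. -/
lemma enumerates_bivSupp {ι : Type} {loc : ι → ℕ × ℕ} (h : Enumerates loc (resSet b c 0))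
    (h0 : ∀ p, ¬ Resonant b c (2 * b + c) p 0) {K : ℕ → Prop}
    (hK : ∀ k, K k ↔ ∀ i, k ≠ 2 * (loc i).1 + (loc i).2 + 2) :
    Enumerates (Sum.elim (fun i => Sum.inl ((loc i).1 + 1, (loc i).2))
      (Sum.elim (fun i => Sum.inr ((loc i).1, (loc i).2 + 1))
        fun k : {k // K k} => Sum.inl (0, k.1)))
      (Sum.inl '' bivSupp b c ∪ Sum.inr '' resSet b c (2 * b + c)) where
  injective := by
    have hinj := h.injective
    rintro (i | i | ⟨k, hk⟩) (j | j | ⟨l, hl⟩) hij <;>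
      simp only [Sum.elim_inl, Sum.elim_inr, Sum.inl.injEq, Sum.inr.injEq, Prod.mk.injEq,
        add_left_inj, reduceCtorEq] at hij
    · rw [hinj (Prod.ext hij.1 hij.2)]
    · exact hij.1.elim
    · rw [hinj (Prod.ext hij.1 hij.2)]
    · exact hij.1.elim
    · obtain ⟨-, rfl⟩ := hij; rfl
  mem_iff := by
    have hmem : ∀ p q, Resonant b c 0 p q ↔ ∃ i, loc i = (p, q) := fun p q => h.mem_iff (p, q)
    rintro (⟨P, Q⟩ | ⟨P, Q⟩)
    · simp only [Set.mem_union, Set.mem_image, Sum.inl.injEq, exists_eq_right, reduceCtorEq,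
        and_false, exists_false, or_false, Sum.exists, Sum.elim_inl, Sum.elim_inr, false_or,
        Prod.mk.injEq, Subtype.exists]
      constructor
      · rintro (⟨p, rfl, hr⟩ | ⟨rfl, hr, -⟩)
        · obtain ⟨i, hi⟩ := (hmem _ _).1 hr
          exact Or.inl ⟨i, by rw [hi], by rw [hi]⟩
        · refine Or.inr ⟨Q, (hK Q).2 fun i hi => ?_, rfl, rfl⟩
          exact hr _ _ ((hmem _ _).2 ⟨i, rfl⟩) hi.symm
      · rintro (⟨i, rfl, rfl⟩ | ⟨k, hk, rfl, rfl⟩)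
        · exact Or.inl ⟨_, rfl, (hmem _ _).2 ⟨i, rfl⟩⟩
        · refine Or.inr ⟨rfl, fun p q hr => ?_, fun p hp => absurd hp (h0 p)⟩
          obtain ⟨i, hi⟩ := (hmem _ _).1 hr
          have := (hK k).1 hk i
          rw [hi] at this
          exact this.symm
    · simp only [Set.mem_union, Set.mem_image, Sum.inr.injEq, exists_eq_right, reduceCtorEq,
        and_false, exists_false, or_false, Sum.exists, Sum.elim_inl, Sum.elim_inr, false_or,
        Prod.mk.injEq]
      change Resonant b c (2 * b + c) P Q ↔ _
      rw [resonant_zWeight_iff h h0]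
      constructor
      · rintro ⟨i, hi, rfl⟩
        exact ⟨i, by rw [hi], rfl⟩
      · rintro ⟨i, rfl, rfl⟩
        exact ⟨i, rfl, rfl⟩

/-- The basis monomials in degree three: each resonance `s ^ p z ^ q` of `E` gives
`s ^ (p + 1) z ^ (q + 1)`. -/
lemma enumerates_divSupp {ι : Type} {loc : ι → ℕ × ℕ} (h : Enumerates loc (resSet b c 0))
    (h0 : ∀ p, ¬ Resonant b c (2 * b + c) p 0) {K : ℕ → Prop}
    (hK : ∀ k, K k ↔ ∀ i, k ≠ 2 * (loc i).1 + (loc i).2 + 3) :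
    Enumerates (Sum.elim (fun i => ((loc i).1 + 1, (loc i).2 + 1)) fun k : {k // K k} => (0, k.1))
      (divSupp b c (2 * b + c)) where
  injective := by
    have hinj := h.injective
    rintro (i | ⟨k, hk⟩) (j | ⟨l, hl⟩) hij <;>
      simp only [Sum.elim_inl, Sum.elim_inr, Prod.mk.injEq, add_left_inj] at hij
    · rw [hinj (Prod.ext hij.1 hij.2)]
    · exact absurd hij.1 (Nat.succ_ne_zero _)
    · exact absurd hij.1.symm (Nat.succ_ne_zero _)
    · obtain ⟨-, rfl⟩ := hij; rfl
  mem_iff := by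
    rintro ⟨P, Q⟩
    simp only [Sum.exists, Sum.elim_inl, Sum.elim_inr, Prod.mk.injEq, Subtype.exists]
    rcases P with _ | p
    · rw [zero_mem_divSupp]
      constructor
      · intro hr
        refine Or.inr ⟨Q, (hK Q).2 fun i hi => ?_, rfl, rfl⟩
        exact hr _ _ ((resonant_zWeight_iff h h0 _ _).2 ⟨i, rfl, rfl⟩) (by omega)
      · rintro (⟨i, hi, -⟩ | ⟨k, hk, -, rfl⟩)
        · exact absurd hi (Nat.succ_ne_zero _)
        · intro p q hr
          obtain ⟨i, hi, hq⟩ := (resonant_zWeight_iff h h0 _ _).1 hr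
          have := (hK k).1 hk i
          have h1 : (loc i).1 = p := by rw [hi]
          omega
    · rw [succ_mem_divSupp, resonant_zWeight_iff h h0]
      constructor
      · rintro ⟨i, hi, rfl⟩
        exact Or.inl ⟨i, by rw [hi], rfl⟩
      · rintro (⟨i, hi, rfl⟩ | ⟨k, hk, hp, -⟩)
        · exact ⟨i, by rw [← Nat.succ_injective hi]; rfl, rfl⟩
        · exact absurd hp.symm (Nat.succ_ne_zero _)

lemma Y12_eq : Y12 = mulFun D' del12 := by
  apply polyVec_ext <;> simp [Y12, wedge_apply_empty, wedge_apply_0, wedge_apply_1, wedge_apply_2,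
    wedge_apply_01, wedge_apply_02, wedge_apply_12, wedge_apply_012, Y1_apply, Y2_apply,
    mulFun_apply, del12_apply, D', sq]

lemma Y23_eq : Y23 = mulFun z (wedge Y2 (del 2)) := by
  apply polyVec_ext <;> simp [Y23, wedge_apply_empty, wedge_apply_0, wedge_apply_1, wedge_apply_2,
    wedge_apply_01, wedge_apply_02, wedge_apply_12, wedge_apply_012, Y2_apply, Y3_apply,
    mulFun_apply, del_apply, mul_comm]

lemma wedge_Y12_del_eq : wedge (wedge Y1 Y2) (del 2) = mulFun D' del123 := by
  apply polyVec_ext <;> simp [wedge_apply_empty, wedge_apply_0, wedge_apply_1, wedge_apply_2,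
    wedge_apply_01, wedge_apply_02, wedge_apply_12, wedge_apply_012, Y1_apply, Y2_apply,
    mulFun_apply, del_apply, del123_apply, D', sq]

lemma Y123_eq : Y123 = mulFun (D' * z) del123 := by
  apply polyVec_ext <;> simp [Y123, wedge_apply_empty, wedge_apply_0, wedge_apply_1,
    wedge_apply_2, wedge_apply_01, wedge_apply_02, wedge_apply_12, wedge_apply_012, Y1_apply,
    Y2_apply, Y3_apply, mulFun_apply, del123_apply, D', sq]

lemma mulFun_mulFun (f g : Series) (P : PolyVec) : mulFun f (mulFun g P) = mulFun (f * g) P := by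
  funext S
  simp only [mulFun_apply, mul_assoc]

/-- The second cohomology when no power of `s` is resonant for `E - (2b + c)`. -/
lemma isFormalBasis_two_of_enumerates {ι : Type} {loc : ι → ℕ × ℕ}
    (h : Enumerates loc (resSet b c 0)) (h0 : ∀ p, ¬ Resonant b c (2 * b + c) p 0)
    (hc : c ≠ 0) (hbc : 2 * b + c ≠ 0) (hε : ε ≠ 0) {K : ℕ → Prop}
    (hK : ∀ k, K k ↔ ∀ i, k ≠ 2 * (loc i).1 + (loc i).2 + 2) :
    IsFormalBasis (Lambda8 b c ε) 2 (Sum.elim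
      (fun i => mulFun (D' ^ (loc i).1 * z ^ (loc i).2) Y12)
      (Sum.elim (fun i => mulFun (D' ^ (loc i).1 * z ^ (loc i).2) Y23)
        (fun k : {k // K k} => mulFun (z ^ k.1) del12))) := by
  convert isFormalBasis_two (enumerates_bivSupp h h0 hK) hc hbc hε using 1
  funext i
  rcases i with i | i | k
  · simp only [Sum.elim_inl, bivMono, ofArr_mono, Y12_eq, mulFun_mulFun]
    congr 1; ring
  · simp only [Sum.elim_inl, Sum.elim_inr, bivMono, ofArr_mono, Y23_eq, mulFun_mulFun]
    congr 1; ring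
  · simp only [Sum.elim_inl, Sum.elim_inr, bivMono, ofArr_mono, pow_zero, one_mul]

/-- The third cohomology when no power of `s` is resonant for `E - (2b + c)`. -/
lemma isFormalBasis_three_of_enumerates {ι : Type} {loc : ι → ℕ × ℕ}
    (h : Enumerates loc (resSet b c 0)) (h0 : ∀ p, ¬ Resonant b c (2 * b + c) p 0)
    (hc : c ≠ 0) (hbc : 2 * b + c ≠ 0) (hε : ε ≠ 0) {K : ℕ → Prop}
    (hK : ∀ k, K k ↔ ∀ i, k ≠ 2 * (loc i).1 + (loc i).2 + 3) :
    IsFormalBasis (Lambda8 b c ε) 3 (Sum.elim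
      (fun i => mulFun (D' ^ (loc i).1 * z ^ (loc i).2) Y123)
      (fun k : {k // K k} => mulFun (z ^ k.1) del123)) := by
  convert isFormalBasis_three (enumerates_divSupp h h0 hK) hc hbc hε using 1
  funext i
  rcases i with i | k
  · simp only [Sum.elim_inl, ofArr_mono, Y123_eq, mulFun_mulFun]
    congr 1; ring
  · simp only [Sum.elim_inr, ofArr_mono, pow_zero, one_mul]

end

/-! ### The three cases -/

lemma mulFun_one (P : PolyVec) : mulFun 1 P = P := by
  funext S
  exact one_mul _

lemma Lambda8_zero (b c : ℝ) : Lambda8 b c 0 = Lambda8I b c := by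
  rw [Lambda8, zero_smul, add_zero]

section
variable {b c ε : ℝ}

lemma two_mul_casExp {β : ℕ} {γ : ℤ} (hN : 0 < 2 * (β : ℤ) + γ) (i : Admissible γ) :
    2 * (casExp β γ i : ℤ) = (2 * (β : ℤ) + γ) * (i : ℕ) := by
  obtain ⟨i, k, hk⟩ := i
  have h1 : (2 * (β : ℤ) + γ) * (i : ℤ) = 2 * (β * i + k) := by linear_combination hk
  have h2 : 0 ≤ (2 * (β : ℤ) + γ) * (i : ℤ) := by positivity
  simp only [casExp]
  rw [h1] at h2 ⊢
  omega

lemma two_mul_add_pos {β : ℕ} {γ : ℤ} (hb : 0 < b * (2 * b + c)) (hβ : 0 < β)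
    (hbγ : b * (γ : ℝ) = c * (β : ℝ)) : 0 < 2 * (β : ℤ) + γ := by
  have hβ' : (0 : ℝ) < β := by exact_mod_cast hβ
  have h : (0 : ℝ) < b ^ 2 * (2 * β + γ) := by
    have h1 : b ^ 2 * (2 * β + γ) = b * (2 * b + c) * β := by linear_combination b * hbγ
    rw [h1]
    positivity
  have h2 : (0 : ℝ) < 2 * β + γ := pos_of_mul_pos_right h (sq_nonneg b)
  exact_mod_cast h2

/-- As `b : c = β : γ`, the equation `(2b + c) q = 2 b p` says `(2β + γ) q = 2 β p`. -/
lemma enumerates_of_pos {β : ℕ} {γ : ℤ} (hb : 0 < b * (2 * b + c)) (hβ : 0 < β)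
    (hco : IsCoprime (β : ℤ) γ) (hbγ : b * (γ : ℝ) = c * (β : ℝ)) :
    Enumerates (fun i : Admissible γ => (casExp β γ i, β * (i : ℕ))) (resSet b c 0) where
  injective i j h :=
    Subtype.ext (Nat.eq_of_mul_eq_mul_left hβ (Prod.mk.inj h).2)
  mem_iff := by
    rintro ⟨p, q⟩
    have hN := two_mul_add_pos hb hβ hbγ
    have hb0 : b ≠ 0 := by rintro rfl; simp at hb
    have hβ' : (β : ℝ) ≠ 0 := by exact_mod_cast hβ.ne'
    have key : Resonant b c 0 p q ↔ (2 * (β : ℤ) + γ) * q = 2 * β * p := by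
      rw [Resonant, weight]
      have h1 : ((2 * b + c) * q - 2 * b * p) * β = b * ((2 * β + γ) * q - 2 * β * p) := by
        linear_combination -(q : ℝ) * hbγ
      constructor
      · intro h
        rw [h, zero_mul] at h1
        have := (mul_eq_zero.1 h1.symm).resolve_left hb0
        exact_mod_cast sub_eq_zero.1 this
      · intro h
        have h2 : (2 * (β : ℝ) + γ) * q = 2 * β * p := by exact_mod_cast h
        rw [h2, sub_self, mul_zero] at h1
        exact (mul_eq_zero.1 h1).resolve_right hβ'
    change Resonant b c 0 p q ↔ _
    rw [key]
    constructor
    · intro h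
      have hdvd : (β : ℤ) ∣ q := by
        have h1 : IsCoprime (β : ℤ) (2 * (β : ℤ) + γ) := by
          rw [add_comm]
          exact hco.add_mul_right_right 2
        exact h1.dvd_of_dvd_mul_left ⟨2 * p, by linear_combination h⟩
      obtain ⟨i, rfl⟩ := Int.natCast_dvd_natCast.1 hdvd
      have hβ'' : (β : ℤ) ≠ 0 := by exact_mod_cast hβ.ne'
      have h2 : (2 * (β : ℤ) + γ) * i = 2 * p := by
        apply mul_left_cancel₀ hβ''
        push_cast at h
        linear_combination h
      refine ⟨⟨i, p - β * i, by linear_combination h2⟩, ?_⟩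
      have h3 := two_mul_casExp hN ⟨i, p - β * i, by linear_combination h2⟩
      simp only at h3
      refine Prod.ext ?_ rfl
      simp only
      rw [h2] at h3
      omega
    · rintro ⟨i, hi⟩
      obtain ⟨rfl, rfl⟩ := Prod.mk.inj hi
      have := two_mul_casExp hN i
      push_cast
      linear_combination -(β : ℤ) * this

/-- For `b (2b + c) ≥ 0` the equation `-2 b p = 2b + c` has no solution `p`. -/
lemma not_resonant_zWeight_of_nonneg (hbc : 2 * b + c ≠ 0) (hb : 0 ≤ b * (2 * b + c)) (p : ℕ) :
    ¬ Resonant b c (2 * b + c) p 0 := by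
  intro h
  rw [Resonant, weight] at h
  have h1 : (2 * b + c) ^ 2 + 2 * p * (b * (2 * b + c)) = 0 := by
    push_cast at h
    linear_combination -(2 * b + c) * h
  have h2 : 0 < (2 * b + c) ^ 2 := by positivity
  have h3 : 0 ≤ 2 * p * (b * (2 * b + c)) := by positivity
  linarith

lemma resonant_zero_iff (hc : c ≠ 0) (h : Irrational (b / c) ∨ b * (2 * b + c) < 0) (p q : ℕ) :
    Resonant b c 0 p q ↔ p = 0 ∧ q = 0 := by
  constructor
  · intro hr
    rw [Resonant, weight, sub_eq_zero] at hr
    rcases h with h | h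
    · have hq : q = p := by
        by_contra hne
        refine h ⟨-(q : ℚ) / (2 * ((q : ℚ) - p)), ?_⟩
        have hne' : (q : ℝ) - p ≠ 0 := sub_ne_zero.2 (by exact_mod_cast hne)
        push_cast
        rw [div_eq_div_iff (mul_ne_zero two_ne_zero hne') hc]
        linear_combination -hr
      subst hq
      have h1 : c * q = 0 := by linear_combination hr
      have h2 := (mul_eq_zero.1 h1).resolve_left hc
      have : q = 0 := by exact_mod_cast h2
      exact ⟨this, this⟩
    · have hb : b ≠ 0 := by rintro rfl; simp at h
      have h1 : -(b * (2 * b + c)) * q + 2 * b ^ 2 * p = 0 := by linear_combination -b * hr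
      have h2 : 0 < -(b * (2 * b + c)) := by linarith
      have h3 : 0 < 2 * b ^ 2 := by positivity
      have h4 : 0 ≤ -(b * (2 * b + c)) * q := by positivity
      have h5 : 0 ≤ 2 * b ^ 2 * (p : ℝ) := by positivity
      have h6 : 2 * b ^ 2 * (p : ℝ) = 0 := by linarith
      have h7 : -(b * (2 * b + c)) * (q : ℝ) = 0 := by linarith
      exact ⟨by exact_mod_cast (mul_eq_zero.1 h6).resolve_left h3.ne',
        by exact_mod_cast (mul_eq_zero.1 h7).resolve_left h2.ne'⟩
  · rintro ⟨rfl, rfl⟩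
    simp [Resonant, weight]

lemma enumerates_unit (hc : c ≠ 0) (h : Irrational (b / c) ∨ b * (2 * b + c) < 0) :
    Enumerates (fun _ : Unit => ((0, 0) : ℕ × ℕ)) (resSet b c 0) where
  injective _ _ _ := rfl
  mem_iff := by
    rintro ⟨p, q⟩
    change Resonant b c 0 p q ↔ _
    rw [resonant_zero_iff hc h]
    simp [eq_comm]

/-- Without further resonances the constants are the only Casimir functions. -/
lemma isKernelFamily_unit (hc : c ≠ 0) (h : Irrational (b / c) ∨ b * (2 * b + c) < 0) :
    IsKernelFamily b c ε (fun _ : Unit => ((0, 0) : ℕ × ℕ)) fun _ => mono (0, 0) where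
  enumerates := enumerates_unit hc h
  hamOp_eq_zero _ := by
    rw [hamOp_mono_zero]
    simp [weight]
  homogeneous _ p q hne := by
    by_cases h' : ((0, 0) : ℕ × ℕ) = (p, q)
    · rw [Prod.mk.injEq] at h'
      omega
    · exact absurd (if_neg h') hne
  leading _ := if_pos rfl

/-- The resonances of `E - (2b + c)` for `c = -2(g + 1) b`: besides `z` there is `s ^ g`. -/
lemma resonant_zWeight_iff_of_eq {g : ℕ} (hg : 0 < g) (hb : b ≠ 0) (hcb : c = -(2 * (g + 1) * b))
    (p q : ℕ) : Resonant b c (2 * b + c) p q ↔ (p = g ∧ q = 0) ∨ (p = 0 ∧ q = 1) := by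
  have key : Resonant b c (2 * b + c) p q ↔ g * q + p = g := by
    rw [Resonant, weight, hcb]
    have h1 : (2 * b + -(2 * (g + 1) * b)) * q - 2 * b * p - (2 * b + -(2 * (g + 1) * b)) =
        -(2 * b) * (g * q + p - g) := by ring
    rw [← sub_eq_zero, h1, mul_eq_zero, sub_eq_zero]
    constructor
    · intro h
      have := h.resolve_left (neg_ne_zero.2 (mul_ne_zero two_ne_zero hb))
      exact_mod_cast this
    · intro h
      right
      exact_mod_cast h
  rw [key]
  constructor
  · intro h
    rcases q with _ | _ | q
    · left; simpa using h
    · right; simpa using h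
    · exfalso
      have : g * (q + 1 + 1) = g * q + g + g := by ring
      have := Nat.zero_le (g * q)
      omega
  · rintro (⟨rfl, rfl⟩ | ⟨rfl, rfl⟩) <;> simp

/-- For `c = -2(g + 1) b` the resonance `s ^ g` of `E - (2b + c)` adds `s ^ g Y₂ ∧ ∂₃` and removes
`z ^ (2g + 1) ∂₁₂`. -/
lemma enumerates_bivSupp_of_eq {g : ℕ} (hg : 0 < g) (hb : b ≠ 0) (hc : c ≠ 0)
    (hcb : c = -(2 * (g + 1) * b)) (h : Irrational (b / c) ∨ b * (2 * b + c) < 0) :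
    Enumerates (Sum.elim (fun _ : Unit => Sum.inl (1, 0)) (Sum.elim (fun _ : Unit => Sum.inr (0, 1))
      (Sum.elim (fun k : {k : ℕ // k ≠ 2 ∧ k ≠ 2 * g + 1} => Sum.inl (0, k.1))
        fun _ : Unit => Sum.inr (g, 0))))
      (Sum.inl '' bivSupp b c ∪ Sum.inr '' resSet b c (2 * b + c)) where
  injective := by
    rintro (i | i | ⟨k, hk⟩ | i) (j | j | ⟨l, hl⟩ | j) hij <;>
      simp at hij ⊢
    all_goals omega
  mem_iff := by
    have h0 := resonant_zero_iff hc h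
    have h1 := resonant_zWeight_iff_of_eq hg hb hcb
    rintro (⟨P, Q⟩ | ⟨P, Q⟩)
    · simp only [Set.mem_union, Set.mem_image, Sum.inl.injEq, exists_eq_right, reduceCtorEq,
        and_false, exists_false, or_false, Sum.exists, Sum.elim_inl, Sum.elim_inr, false_or,
        Prod.mk.injEq, Subtype.exists, exists_const]
      constructor
      · rintro (⟨p, rfl, hr⟩ | ⟨rfl, hr, hs⟩)
        · rw [h0] at hr
          exact Or.inl ⟨by rw [hr.1], hr.2.symm⟩
        · refine Or.inr ⟨Q, ⟨?_, ?_⟩, rfl, rfl⟩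
          · exact (hr 0 0 ((h0 _ _).2 ⟨rfl, rfl⟩)).symm
          · exact (hs g ((h1 _ _).2 (Or.inl ⟨rfl, rfl⟩))).symm
      · rintro (⟨rfl, rfl⟩ | ⟨k, ⟨hk1, hk2⟩, rfl, rfl⟩)
        · exact Or.inl ⟨0, rfl, (h0 _ _).2 ⟨rfl, rfl⟩⟩
        · refine Or.inr ⟨rfl, fun p q hr => ?_, fun p hr => ?_⟩
          · rw [h0] at hr
            obtain ⟨rfl, rfl⟩ := hr
            exact hk1.symm
          · rw [h1] at hr
            rcases hr with ⟨rfl, -⟩ | ⟨-, hr⟩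
            · exact hk2.symm
            · exact absurd hr zero_ne_one
    · simp only [Set.mem_union, Set.mem_image, Sum.inr.injEq, exists_eq_right, reduceCtorEq,
        and_false, exists_false, Sum.exists, Sum.elim_inl, Sum.elim_inr, false_or,
        Prod.mk.injEq, exists_const]
      change Resonant b c (2 * b + c) P Q ↔ _
      rw [h1]
      constructor
      · rintro (⟨rfl, rfl⟩ | ⟨rfl, rfl⟩)
        · exact Or.inr ⟨rfl, rfl⟩
        · exact Or.inl ⟨rfl, rfl⟩
      · rintro (⟨rfl, rfl⟩ | ⟨rfl, rfl⟩)
        · exact Or.inr ⟨rfl, rfl⟩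
        · exact Or.inl ⟨rfl, rfl⟩

/-- For `c = -2(g + 1) b` the resonance `s ^ g` of `E - (2b + c)` adds `s ^ (g + 1)` and removes
`z ^ (2g + 2)`. -/
lemma enumerates_divSupp_of_eq {g : ℕ} (hg : 0 < g) (hb : b ≠ 0) (hcb : c = -(2 * (g + 1) * b)) :
    Enumerates (Sum.elim (fun _ : Unit => ((1, 1) : ℕ × ℕ))
      (Sum.elim (fun k : {k : ℕ // k ≠ 3 ∧ k ≠ 2 * g + 2} => (0, k.1))
        fun _ : Unit => (g + 1, 0))) (divSupp b c (2 * b + c)) where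
  injective := by
    rintro (i | ⟨k, hk⟩ | i) (j | ⟨l, hl⟩ | j) hij <;>
      simp at hij ⊢
    all_goals omega
  mem_iff := by
    have h1 := resonant_zWeight_iff_of_eq hg hb hcb
    rintro ⟨P, Q⟩
    simp only [Sum.exists, Sum.elim_inl, Sum.elim_inr, Prod.mk.injEq, Subtype.exists, exists_const]
    rcases P with _ | p
    · rw [zero_mem_divSupp]
      constructor
      · intro hr
        refine Or.inr (Or.inl ⟨Q, ⟨?_, ?_⟩, rfl, rfl⟩)
        · exact (hr 0 1 ((h1 _ _).2 (Or.inr ⟨rfl, rfl⟩))).symm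
        · exact (hr g 0 ((h1 _ _).2 (Or.inl ⟨rfl, rfl⟩))).symm
      · rintro (⟨h, -⟩ | ⟨k, ⟨hk1, hk2⟩, -, rfl⟩ | ⟨h, -⟩)
        · exact absurd h one_ne_zero
        · intro p q hr
          rw [h1] at hr
          rcases hr with ⟨rfl, rfl⟩ | ⟨rfl, rfl⟩
          · exact hk2.symm
          · exact hk1.symm
        · exact absurd h (Nat.succ_ne_zero g)
    · rw [succ_mem_divSupp, h1]
      constructor
      · rintro (⟨rfl, rfl⟩ | ⟨rfl, rfl⟩)
        · exact Or.inr (Or.inr ⟨rfl, rfl⟩)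
        · exact Or.inl ⟨rfl, rfl⟩
      · rintro (⟨h, rfl⟩ | ⟨k, -, h, -⟩ | ⟨h, rfl⟩)
        · exact Or.inr ⟨by omega, rfl⟩
        · exact absurd h.symm (Nat.succ_ne_zero p)
        · exact Or.inl ⟨by omega, rfl⟩

lemma enumerates_of_eq_zero (hc : c ≠ 0) :
    Enumerates (fun i : ℕ => (i, 0)) (resSet 0 c 0) where
  injective _ _ h := (Prod.mk.inj h).1
  mem_iff := by
    rintro ⟨p, q⟩
    change Resonant 0 c 0 p q ↔ _
    simp [Resonant, weight, hc, eq_comm]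

/-- The case `b (2b + c) > 0` with `b / c = β / γ`. -/
lemma isFormalBasis_of_pos (hc : c ≠ 0) (hbc : 2 * b + c ≠ 0) (hε : ε ≠ 0) {β : ℕ} {γ : ℤ}
    (hb : 0 < b * (2 * b + c)) (hβ : 0 < β) (hco : IsCoprime (β : ℤ) γ)
    (hbγ : b * (γ : ℝ) = c * (β : ℝ)) :
      IsFormalBasis (Lambda8I b c) 0 (fun i : Admissible γ => ofFun (casI β γ i)) ∧
      IsFormalBasis (Lambda8 b c ε) 0
        (fun i : Admissible γ => ofFun (cas (ε / (3 * b + c)) β γ i)) ∧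
      IsFormalBasis (Lambda8 b c ε) 1
        (Sum.elim
          (fun i : Admissible γ => mulFun (casI β γ i) Y2)
          (fun i : Admissible γ => mulFun (cas (ε / (3 * b + c)) β γ i) (Y1 + Y3))) ∧
      IsFormalBasis (Lambda8 b c ε) 2
        (Sum.elim
          (fun i : Admissible γ => mulFun (casI β γ i) Y12)
          (Sum.elim
            (fun i : Admissible γ => mulFun (casI β γ i) Y23)
            (fun k : {k : ℕ // ∀ i : Admissible γ,
                (k : ℤ) ≠ ((i : ℕ) : ℤ) * (3 * (β : ℤ) + γ) + 2} =>
              mulFun (z ^ (k : ℕ)) del12))) ∧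
      IsFormalBasis (Lambda8 b c ε) 3
        (Sum.elim
          (fun i : Admissible γ => mulFun (casI β γ i) Y123)
          (fun k : {k : ℕ // ∀ i : Admissible γ,
              (k : ℤ) ≠ ((i : ℕ) : ℤ) * (3 * (β : ℤ) + γ) + 3} =>
            mulFun (z ^ (k : ℕ)) del123)) := by
  have he := enumerates_of_pos hb hβ hco hbγ
  have hN := two_mul_add_pos hb hβ hbγ
  have h3 : 3 * b + c ≠ 0 := by
    intro h
    have : b * (2 * b + c) = -b ^ 2 := by linear_combination b * h
    nlinarith [sq_nonneg b]
  have hI := isKernelFamily_casArr (ε := 0) he (κ := 0) (zero_mul _)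
  have hw := isKernelFamily_casArr he (div_mul_cancel₀ ε h3)
  have h0 := not_resonant_zWeight_of_nonneg hbc hb.le
  have hdeg : ∀ (i : Admissible γ) (m k : ℕ), (k : ℤ) ≠ ((i : ℕ) : ℤ) * (3 * (β : ℤ) + γ) + m ↔
      k ≠ 2 * casExp β γ i + β * (i : ℕ) + m := by
    intro i m k
    have h2 := two_mul_casExp hN i
    rw [not_iff_not]
    constructor
    · intro h
      have h' : (k : ℤ) = 2 * (casExp β γ i : ℤ) + β * (i : ℕ) + m := by linear_combination h - h2
      exact_mod_cast h'
    · rintro rfl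
      push_cast
      linear_combination h2
  refine ⟨?_, ?_, ?_, ?_, ?_⟩
  · rw [← Lambda8_zero]
    simpa only [casI, ofArr_casArr, zero_smul, add_zero] using hI.isFormalBasis_zero hc hbc
  · simpa only [cas, ofArr_casArr] using hw.isFormalBasis_zero hc hbc
  · simpa only [casI, cas, ofArr_casArr, ofArr_mono] using hw.isFormalBasis_one hc hbc hε
  · exact isFormalBasis_two_of_enumerates he h0 hc hbc hε
      fun k => forall_congr' fun i => hdeg i 2 k
  · exact isFormalBasis_three_of_enumerates he h0 hc hbc hε
      fun k => forall_congr' fun i => hdeg i 3 k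

end

end FormalPoisson

end

open FormalPoisson

theorem theorem3 (b c ε : ℝ) (hc : c ≠ 0) (hbc : 2 * b + c ≠ 0) (hε : ε = 1 ∨ ε = -1) :
    -- First case: `b / c` is rational, `b (2b + c) > 0`, and `(β, γ)` is the irreducible
    -- representative of `b / c` with positive numerator.
    (∀ (β : ℕ) (γ : ℤ), 0 < b * (2 * b + c) → 0 < β → IsCoprime (β : ℤ) γ →
        b * (γ : ℝ) = c * (β : ℝ) →
      IsFormalBasis (Lambda8I b c) 0 (fun i : Admissible γ => ofFun (casI β γ i)) ∧
      IsFormalBasis (Lambda8 b c ε) 0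
        (fun i : Admissible γ => ofFun (cas (ε / (3 * b + c)) β γ i)) ∧
      IsFormalBasis (Lambda8 b c ε) 1
        (Sum.elim
          (fun i : Admissible γ => mulFun (casI β γ i) Y2)
          (fun i : Admissible γ => mulFun (cas (ε / (3 * b + c)) β γ i) (Y1 + Y3))) ∧
      IsFormalBasis (Lambda8 b c ε) 2
        (Sum.elim
          (fun i : Admissible γ => mulFun (casI β γ i) Y12)
          (Sum.elim
            (fun i : Admissible γ => mulFun (casI β γ i) Y23)
            (fun k : {k : ℕ // ∀ i : Admissible γ,
                (k : ℤ) ≠ ((i : ℕ) : ℤ) * (3 * (β : ℤ) + γ) + 2} =>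
              mulFun (z ^ (k : ℕ)) del12))) ∧
      IsFormalBasis (Lambda8 b c ε) 3
        (Sum.elim
          (fun i : Admissible γ => mulFun (casI β γ i) Y123)
          (fun k : {k : ℕ // ∀ i : Admissible γ,
              (k : ℤ) ≠ ((i : ℕ) : ℤ) * (3 * (β : ℤ) + γ) + 3} =>
            mulFun (z ^ (k : ℕ)) del123))) ∧
    -- Second case: `b / c` is irrational or `b (2b + c) < 0`.
    (Irrational (b / c) ∨ b * (2 * b + c) < 0 →
      IsFormalBasis (Lambda8 b c ε) 0 (fun _ : Unit => ofFun 1) ∧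
      IsFormalBasis (Lambda8 b c ε) 1
        (Sum.elim (fun _ : Unit => Y2) (fun _ : Unit => Y1 + Y3)) ∧
      (∀ γ : ℕ, Even γ → 4 ≤ γ → c = -((γ : ℝ) * b) →
        IsFormalBasis (Lambda8 b c ε) 2
          (Sum.elim (fun _ : Unit => Y12)
            (Sum.elim (fun _ : Unit => Y23)
              (Sum.elim
                (fun k : {k : ℕ // k ≠ 2 ∧ k ≠ γ - 1} => mulFun (z ^ (k : ℕ)) del12)
                (fun _ : Unit => mulFun (D' ^ (γ / 2 - 1)) (wedge Y2 (del 2)))))) ∧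
        IsFormalBasis (Lambda8 b c ε) 3
          (Sum.elim (fun _ : Unit => Y123)
            (Sum.elim
              (fun k : {k : ℕ // k ≠ 3 ∧ k ≠ γ} => mulFun (z ^ (k : ℕ)) del123)
              (fun _ : Unit =>
                mulFun (D' ^ (γ / 2 - 1)) (wedge (wedge Y1 Y2) (del 2)))))) ∧
      ((¬ ∃ γ : ℕ, Even γ ∧ 4 ≤ γ ∧ c = -((γ : ℝ) * b)) →
        IsFormalBasis (Lambda8 b c ε) 2
          (Sum.elim (fun _ : Unit => Y12)
            (Sum.elim (fun _ : Unit => Y23)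
              (fun k : {k : ℕ // k ≠ 2} => mulFun (z ^ (k : ℕ)) del12))) ∧
        IsFormalBasis (Lambda8 b c ε) 3
          (Sum.elim (fun _ : Unit => Y123)
            (fun k : {k : ℕ // k ≠ 3} => mulFun (z ^ (k : ℕ)) del123)))) ∧
    -- Third case: `b = 0`.
    (b = 0 →
      IsFormalBasis (Lambda8I b c) 0 (fun i : ℕ => ofFun (D' ^ i)) ∧
      IsFormalBasis (Lambda8 b c ε) 0 (fun i : ℕ => ofFun ((D' + (ε / c) • z ^ 2) ^ i)) ∧
      IsFormalBasis (Lambda8 b c ε) 1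
        (Sum.elim
          (fun i : ℕ => mulFun (D' ^ i) Y2)
          (fun i : ℕ => mulFun ((D' + (ε / c) • z ^ 2) ^ i) (Y1 + Y3))) ∧
      IsFormalBasis (Lambda8 b c ε) 2
        (Sum.elim
          (fun i : ℕ => mulFun (D' ^ i) Y12)
          (Sum.elim
            (fun i : ℕ => mulFun (D' ^ i) Y23)
            (fun k : {k : ℕ // ∀ i : ℕ, k ≠ 2 * i + 2} => mulFun (z ^ (k : ℕ)) del12))) ∧
      IsFormalBasis (Lambda8 b c ε) 3
        (Sum.elim
          (fun i : ℕ => mulFun (D' ^ i) Y123)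
          (fun k : {k : ℕ // ∀ i : ℕ, k ≠ 2 * i + 3} => mulFun (z ^ (k : ℕ)) del123))) := by
  have hε0 : ε ≠ 0 := by rcases hε with rfl | rfl <;> norm_num
  refine ⟨fun β γ hb hβ hco hbγ => isFormalBasis_of_pos hc hbc hε0 hb hβ hco hbγ, fun h => ?_, ?_⟩
  · have hw := isKernelFamily_unit (ε := ε) hc h
    have he := hw.enumerates
    refine ⟨?_, ?_, ?_, ?_⟩
    · simpa only [ofArr_mono_zero] using hw.isFormalBasis_zero hc hbc
    · simpa only [ofArr_mono_zero, mulFun_one] using hw.isFormalBasis_one hc hbc hε0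
    · intro γ hγ h4 hcb
      obtain ⟨g, rfl⟩ : ∃ g, γ = 2 * g + 2 := by
        have := Nat.div_two_mul_two_of_even hγ
        exact ⟨γ / 2 - 1, by omega⟩
      have hb : b ≠ 0 := by
        rintro rfl
        exact hc (by rw [hcb, mul_zero, neg_zero])
      have hcb' : c = -(2 * (g + 1) * b) := by
        rw [hcb]; push_cast; ring
      have hg : 0 < g := by omega
      have hg' : (2 * g + 2) / 2 - 1 = g := by omega
      have hg'' : 2 * g + 2 - 1 = 2 * g + 1 := by omega
      rw [hg', hg'']
      constructor
      · convert isFormalBasis_two (enumerates_bivSupp_of_eq hg hb hc hcb' h) hc hbc hε0 using 1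
        funext i
        rcases i with i | i | k | i <;>
          simp [bivMono, ofArr_mono, Y12_eq, Y23_eq]
      · convert isFormalBasis_three (enumerates_divSupp_of_eq hg hb hcb') hc hbc hε0 using 1
        funext i
        rcases i with i | k | i <;>
          simp [ofArr_mono, Y123_eq, wedge_Y12_del_eq, mulFun_mulFun, pow_succ]
    · intro hn
      have h0 : ∀ p, ¬ Resonant b c (2 * b + c) p 0 := by
        intro p hr
        rw [Resonant, weight] at hr
        push_cast at hr
        rcases Nat.eq_zero_or_pos p with rfl | hp
        · exact hbc (by rw [← hr]; simp)
        · refine hn ⟨2 * (p + 1), even_two_mul _, by omega, ?_⟩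
          push_cast
          linear_combination -hr
      constructor
      · simpa only [pow_zero, one_mul, mulFun_one] using
          isFormalBasis_two_of_enumerates he h0 hc hbc hε0 (K := fun k => k ≠ 2) fun k => by simp
      · simpa only [pow_zero, one_mul, mulFun_one] using
          isFormalBasis_three_of_enumerates he h0 hc hbc hε0 (K := fun k => k ≠ 3) fun k => by simp
  · rintro rfl
    have he := enumerates_of_eq_zero hc
    have hI := isKernelFamily_casArr (ε := 0) he (κ := 0) (zero_mul _)
    have hw := isKernelFamily_casArr (ε := ε) (κ := ε / c) he
      (by rw [mul_zero, zero_add, div_mul_cancel₀ ε hc])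
    have h0 := not_resonant_zWeight_of_nonneg hbc (by rw [zero_mul])
    refine ⟨?_, ?_, ?_, ?_, ?_⟩
    · rw [← Lambda8_zero]
      simpa only [ofArr_casArr, zero_smul, add_zero, pow_zero, mul_one] using
        hI.isFormalBasis_zero hc hbc
    · simpa only [ofArr_casArr, pow_zero, mul_one] using hw.isFormalBasis_zero hc hbc
    · simpa only [ofArr_casArr, ofArr_mono, pow_zero, mul_one] using
        hw.isFormalBasis_one hc hbc hε0
    · simpa only [pow_zero, mul_one] using isFormalBasis_two_of_enumerates he h0 hc hbc hε0
        (K := fun k => ∀ i : ℕ, k ≠ 2 * i + 2) fun k => by simp only [add_zero]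
    · simpa only [pow_zero, mul_one] using isFormalBasis_three_of_enumerates he h0 hc hbc hε0
        (K := fun k => ∀ i : ℕ, k ≠ 2 * i + 3) fun k => by simp only [add_zero]
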